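/- **Setting.** Let $N$ be a lattice of rank $n$, $N^*=\mathrm{Hom}(N,\mathbb Z)$, $V=N\otimes\mathbb R$, $V^*=\mathrm{Hom}(N,\mathbb R)$. A *simplicial multi-fan* $\Delta$ in $N$ consists of an augmented simplicial set $\Sigma$ on the vertex set $\{1,\dots,d\}$ (all singletons and $\emptyset$ belong to $\Sigma$), primitive vectors $v_1,\dots,v_d\in N$ such that $\{v_i\}_{i\in I}$ is linearly independent for every $I\in\Sigma$, and functions $w^\pm:\Sigma^{(n)}\to\mathbb Z_{\ge0}$ on $\Sigma^{(n)}=\{I\in\Sigma: |I|=n\}$ which do not vanish simultaneously. Put $w=w^+-w^-$, and let $C(I)\subset V$ be the cone spanned by $v_i$, $i\in I$. For $K\in\Sigma$ let $V_K$ be the span of $C(K)$, and for $K\subset J\in\Sigma$ let $C_K(J)$ be the image of $C(J)$ in $V/V_K$. A vector of $V/V_K$ is *generic* if it lies in no linear subspace spanned by a $C_K(J)$ with $K\subset J\in\Sigma$, $|J|<n$. $\Delta$ is *complete* if for every $K\in\Sigma$ some $I\in\Sigma^{(n)}$ contains $K$, and $\sum_{K\subset I\in\Sigma^{(n)},\ \bar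 v\in C_K(I)}w(I)$ does not depend on the generic vector $\bar v\in V/V_K$. A *simple multi-polytope* $\mathcal P$ is a complete simplicial multi-fan $\Delta$ together with affine hyperplanes $F_i=\{u\in V^*:\langle u,v_i\rangle=c_i\}$, $c_i\in\mathbb R$. For $I\in\Sigma^{(n)}$ let $\{u_i^I\}_{i\in I}$ be the basis dual to $\{v_i\}_{i\in I}$ and let $u_I$ be the unique point of $\bigcap_{i\in I}F_i$; $\mathcal P$ is a *lattice* multi-polytope if $u_I\in N^*$ for all $I\in\Sigma^{(n)}$. For a generic $v\in V$ put $$\mathrm{DH}_{\mathcal P}=\sum_{I\in\Sigma^{(n)}}(-1)^{\#\{i\in I:\langle u_i^I,v\rangle>0\}}\,w(I)\,\phi_I ,$$ where $\phi_I$ is the characteristic function of the cone with apex $u_I$ spanned by the vectors $\operatorname{sign}(\langle u_i^I,v\rangle)\,u_i^I$, $i\in I$. For a lattice multi-polytope let $\mathcal P_+$ be obtained by replacing each $c_i$ by $c_i+\varepsilon_i$ with $0<\varepsilon_i<1$, and put $\sharp(\mathcal P)=\sum_{u\in N^*}\mathrm{DH}_{\mathcal P_+}(u)$. Let $H_T^*(\Delta)=\mathbb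 C[x_1,\dots,x_d]/(\prod_{i\in I}x_i: I\notin\Sigma)$ be the face ring of $\Sigma$, let $H^*(\Delta)$ be its quotient by the linear forms $\sum_i\langle u,v_i\rangle x_i$, $u\in N^*$, let $\bar x_i$ be the (nilpotent) image of $x_i$ in $H^*(\Delta)$, and let $H^*(BT)$ be the symmetric algebra of $\mathrm{Hom}(N,\mathbb C)$. For $I\in\Sigma^{(n)}$ let $\iota_I^*:H_T^*(\Delta)\to H^*(BT)$ be the ring homomorphism with $x_i\mapsto u_i^I$ for $i\in I$ and $x_i\mapsto0$ for $i\notin I$; let $G_I\subset\mathbb R^d/\mathbb Z^d$ be the finite group of classes of those $a$ with $\sum_ia_iv_i\in N$ and $a_j=0$ for $j\notin I$; let $G_\Delta=\bigcup_{I\in\Sigma^{(n)}}G_I$ and $\rho_i([a])=e^{2\pi\sqrt{-1}a_i}$. Put $$\pi_!(x)=\sum_{I\in\Sigma^{(n)}}\frac{w(I)\,\iota_I^*(x)}{|G_I|\prod_{i\in I}u_i^I},\qquad \mathcal T(\Delta)=\sum_{g\in G_\Delta}\prod_{i=1}^d\frac{\bar x_i}{1-\rho_i(g)e^{-\bar x_i}},\qquad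 c_1(\mathcal P)=\sum_{i=1}^dc_i\bar x_i,$$ where $\pi_!(x)$ lies in the fraction field of $H^*(BT)$. **Theorem 8.5.** Let $\mathcal P$ be a simple lattice multi-polytope. Then $\pi_!$ takes its values in $H^*(BT)$, and there is a unique linear map $\int_\Delta:H^*(\Delta)\to\mathbb C$ whose value at the image of any $x\in H_T^*(\Delta)$ is the degree-$0$ component of $\pi_!(x)$. For every generic $v\in V$ and all $\varepsilon_i\in(0,1)$ the sum defining $\sharp(\mathcal P)$ has only finitely many nonzero terms, and $$\int_\Delta e^{c_1(\mathcal P)}\,\mathcal T(\Delta)=\sharp(\mathcal P).$$ -/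

import Mathlib

open scoped TensorProduct

noncomputable section

/-- The real vector space `N ⊗ ℝ` of a lattice `N`. -/
abbrev RealSpace (N : Type*) [AddCommGroup N] : Type _ := ℝ ⊗[ℤ] N

/-- A simplicial multi-fan `(Σ, C, w⁺, w⁻)` in a lattice `N`. The augmented simplicial set `Σ` has
vertex set `ι` (every singleton is a simplex, and the empty set is one), `v i` is the primitive
vector of the half line `C({i})`, and `C(I)` is the cone spanned by the `v i`, `i ∈ I`, which have
to be linearly independent. The weights are relevant only on the simplices `I` with `|I| = rank N`,
where one of them is positive. -/
structure SimplicialMultiFan (N : Type*) [AddCommGroup N] (ι : Type*) where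
  faces : Finset (Finset ι)
  empty_mem : ∅ ∈ faces
  down_closed : ∀ I ∈ faces, ∀ J ⊆ I, J ∈ faces
  singleton_mem : ∀ i, {i} ∈ faces
  v : ι → N
  primitive : ∀ (i : ι) (m : ℤ) (x : N), v i = m • x → IsUnit m
  linearIndependent : ∀ I ∈ faces,
    LinearIndependent ℝ (fun i : I => (1 : ℝ) ⊗ₜ[ℤ] v i : I → RealSpace N)
  wPlus : Finset ι → ℕ
  wMinus : Finset ι → ℕ
  weight_pos : ∀ I ∈ faces, I.card = Module.finrank ℤ N → 0 < wPlus I ∨ 0 < wMinus I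

namespace SimplicialMultiFan

variable {N : Type*} [AddCommGroup N] {ι : Type*} (Δ : SimplicialMultiFan N ι)

/-- `Σ^(n)`, `n = rank N`. -/
def facets : Finset (Finset ι) := Δ.faces.filter fun I => I.card = Module.finrank ℤ N

/-- `w = w⁺ - w⁻`. -/
def w (I : Finset ι) : ℤ := (Δ.wPlus I : ℤ) - (Δ.wMinus I : ℤ)

/-- The vector `v i` in `N ⊗ ℝ`. -/
def vR (i : ι) : RealSpace N := (1 : ℝ) ⊗ₜ[ℤ] Δ.v i

/-- The cone `C(I)`. -/
def cone (I : Finset ι) : PointedCone ℝ (RealSpace N) := PointedCone.hull ℝ (Δ.vR '' (I : Set ι))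

/-- The linear subspace spanned by `C(I)`. -/
def coneSpan (I : Finset ι) : Submodule ℝ (RealSpace N) :=
  Submodule.span ℝ (Δ.cone I : Set (RealSpace N))

/-- A vector of `N ⊗ ℝ` is generic if it lies in no subspace spanned by a cone of dimension
less than `n`. -/
def IsGeneric (x : RealSpace N) : Prop :=
  ∀ J ∈ Δ.faces, J.card < Module.finrank ℤ N → x ∉ Δ.coneSpan J

theorem exists_isGeneric [Module.Free ℤ N] [Module.Finite ℤ N] : ∃ x, Δ.IsGeneric x := by
  classical
  have h := Subspace.biUnion_ne_univ_of_top_notMem (k := ℝ) (E := RealSpace N)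
    (s := (Δ.faces.filter fun J => J.card < Module.finrank ℤ N).image Δ.coneSpan) (by
      intro h
      obtain ⟨J, hJ, hT⟩ := Finset.mem_image.1 h
      have hle : Δ.coneSpan J ≤ Submodule.span ℝ (J.image Δ.vR : Set (RealSpace N)) := by
        refine Submodule.span_le.2 fun y hy => ?_
        rw [Finset.coe_image]
        exact Submodule.span_le_restrictScalars {c : ℝ // 0 ≤ c} ℝ _ hy
      rw [hT, top_le_iff] at hle
      have h1 := finrank_span_finset_le_card (R := ℝ) (J.image Δ.vR)
      rw [Set.finrank, hle, finrank_top, Module.finrank_baseChange] at h1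
      exact absurd (h1.trans Finset.card_image_le) (not_le.2 (Finset.mem_filter.1 hJ).2))
  obtain ⟨x, hx⟩ := (Set.ne_univ_iff_exists_notMem _).1 h
  refine ⟨x, fun J hJ hc hxJ => hx ?_⟩
  exact Set.mem_biUnion (Finset.mem_coe.2 (Finset.mem_image_of_mem _ (Finset.mem_filter.2 ⟨hJ, hc⟩))) hxJ

/-- The cone `C_K(J)`, `K ⊆ J`, of the projected multi-fan `Δ_K`: the image of `C(J)` in the
quotient of `N ⊗ ℝ` by the subspace spanned by `C(K)`. -/
def projCone (K J : Finset ι) : PointedCone ℝ (RealSpace N ⧸ Δ.coneSpan K) :=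
  PointedCone.map (Δ.coneSpan K).mkQ (Δ.cone J)

/-- Generic vectors for the projected multi-fan `Δ_K`, whose simplices are the `J ∈ Σ`
containing `K`, with `dim C_K(J) = |J| - |K|`. -/
def IsGenericProj (K : Finset ι) (x : RealSpace N ⧸ Δ.coneSpan K) : Prop :=
  ∀ J ∈ Δ.faces, K ⊆ J → J.card < Module.finrank ℤ N →
    x ∉ Submodule.span ℝ (Δ.projCone K J : Set (RealSpace N ⧸ Δ.coneSpan K))

open scoped Classical in
/-- The number `d_x` of the projected multi-fan `Δ_K`. -/
def degProj (K : Finset ι) (x : RealSpace N ⧸ Δ.coneSpan K) : ℤ :=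
  ∑ I ∈ Δ.facets with K ⊆ I ∧ x ∈ Δ.projCone K I, Δ.w I

/-- The projected multi-fan `Δ_K` is pre-complete. -/
def IsPreCompleteProj (K : Finset ι) : Prop :=
  (∃ I ∈ Δ.facets, K ⊆ I) ∧
    ∀ x y, Δ.IsGenericProj K x → Δ.IsGenericProj K y → Δ.degProj K x = Δ.degProj K y

/-- `Δ` is complete if `Δ_K` is pre-complete for all `K ∈ Σ` (`Δ_∅` is `Δ` itself). -/
def IsComplete : Prop := ∀ K ∈ Δ.faces, Δ.IsPreCompleteProj K

section DualBasis

variable (K : Type*) [Field K]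

open scoped Classical in
/-- For `I ∈ Σ^(n)`, the element `u_i^I` (`i ∈ I`) of the basis of `Hom(N, K)` dual to the
`v j`, `j ∈ I`. For these `I` and `K` of characteristic `0` it exists and is unique. -/
def dualVec (I : Finset ι) (i : ι) : N →ₗ[ℤ] K :=
  if h : ∃ u : N →ₗ[ℤ] K, ∀ j ∈ I, u (Δ.v j) = if j = i then 1 else 0 then h.choose else 0

open scoped Classical in
theorem exists_dualVec [CharZero K] {I : Finset ι} (hI : I ∈ Δ.faces) (i : ι) :
    ∃ u : N →ₗ[ℤ] K, ∀ j ∈ I, u (Δ.v j) = if j = i then 1 else 0 := by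
  have h1 : LinearIndependent ℤ (fun i : I => (1 : ℝ) ⊗ₜ[ℤ] Δ.v i : I → RealSpace N) :=
    (Δ.linearIndependent I hI).restrict_scalars' ℤ
  have h2 : LinearIndependent ℤ (fun i : I => Δ.v i) :=
    LinearIndependent.of_comp (TensorProduct.mk ℤ ℝ N 1) h1
  have h3 : LinearIndependent K (fun i : I => (1 : K) ⊗ₜ[ℤ] Δ.v i : I → K ⊗[ℤ] N) :=
    Module.Flat.linearIndependent_one_tmul h2
  obtain ⟨g, hg⟩ := LinearMap.exists_leftInverse_of_injective
    (Finsupp.linearCombination K (fun i : I => (1 : K) ⊗ₜ[ℤ] Δ.v i : I → K ⊗[ℤ] N))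
    (LinearMap.ker_eq_bot.2 h3)
  by_cases hi : i ∈ I
  · refine ⟨((Finsupp.lapply (⟨i, hi⟩ : I) ∘ₗ g).restrictScalars ℤ) ∘ₗ TensorProduct.mk ℤ K N 1,
      fun j hj => ?_⟩
    have hs := LinearMap.congr_fun hg (Finsupp.single (⟨j, hj⟩ : I) (1 : K))
    simp only [LinearMap.comp_apply, Finsupp.linearCombination_single, one_smul,
      LinearMap.id_apply] at hs
    change g ((1 : K) ⊗ₜ[ℤ] Δ.v j) ⟨i, hi⟩ = _
    rw [hs, Finsupp.single_apply]
    simp only [Subtype.mk.injEq]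
  · exact ⟨0, fun j hj => by rw [if_neg (fun h : j = i => hi (h ▸ hj)), LinearMap.zero_apply]⟩

open scoped Classical in
theorem dualVec_apply [CharZero K] {I : Finset ι} (hI : I ∈ Δ.faces) (i : ι) {j : ι}
    (hj : j ∈ I) : Δ.dualVec K I i (Δ.v j) = if j = i then 1 else 0 := by
  have h := Δ.exists_dualVec K hI i
  rw [dualVec, dif_pos h]
  exact h.choose_spec j hj

theorem exists_intMultiple {N : Type*} [AddCommGroup N] [Module.Finite ℤ N] (u : N →ₗ[ℤ] ℚ) :
    ∃ D : ℤ, D ≠ 0 ∧ ∃ u' : N →ₗ[ℤ] ℤ, ∀ x, (u' x : ℚ) = D * u x := by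
  classical
  obtain ⟨S, hS⟩ := (Module.Finite.fg_top : (⊤ : Submodule ℤ N).FG)
  obtain ⟨D, hD⟩ := IsLocalization.exist_integer_multiples (nonZeroDivisors ℤ) S (fun x => u x)
  have key : ∀ x : N, ∃ m : ℤ, (m : ℚ) = (D : ℤ) * u x := by
    intro x
    have hx : x ∈ Submodule.span ℤ (S : Set N) := hS ▸ Submodule.mem_top
    induction hx using Submodule.span_induction with
    | mem x hx =>
      obtain ⟨m, hm⟩ := hD x hx
      exact ⟨m, by simpa using hm⟩
    | zero => exact ⟨0, by simp⟩
    | add x y _ _ hx hy =>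
      obtain ⟨a, ha⟩ := hx
      obtain ⟨b, hb⟩ := hy
      exact ⟨a + b, by push_cast; rw [ha, hb, map_add]; ring⟩
    | smul k x _ hx =>
      obtain ⟨a, ha⟩ := hx
      exact ⟨k * a, by push_cast; rw [ha, map_smul, zsmul_eq_mul]; ring⟩
  choose f hf using key
  refine ⟨D, nonZeroDivisors.coe_ne_zero D, { toFun := f, map_add' := ?_, map_smul' := ?_ }, hf⟩
  · intro x y
    have : ((f (x + y) : ℤ) : ℚ) = ((f x + f y : ℤ) : ℚ) := by
      push_cast
      rw [hf, hf, hf, map_add]; ring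
    exact_mod_cast this
  · intro k x
    have : ((f (k • x) : ℤ) : ℚ) = ((k * f x : ℤ) : ℚ) := by
      push_cast
      rw [hf, hf, map_smul, zsmul_eq_mul]; ring
    simpa using (by exact_mod_cast this : f (k • x) = k * f x)

end DualBasis

section Groups

/-- `η : ℝ^d → N ⊗ ℝ`, `a ↦ ∑ a_i v_i`. -/
def eta [Fintype ι] : (ι → ℝ) →ₗ[ℝ] RealSpace N := Fintype.linearCombination ℝ Δ.vR

/-- `G'_I ⊆ ℝ^d`: the `a` with `η(a) ∈ N` and `a_j = 0` for `j ∉ I`. -/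
def preG [Fintype ι] (I : Finset ι) : AddSubgroup (ι → ℝ) where
  carrier := {a | (∃ x : N, Δ.eta a = (1 : ℝ) ⊗ₜ[ℤ] x) ∧ ∀ j ∉ I, a j = 0}
  zero_mem' := ⟨⟨0, by simp⟩, fun _ _ => rfl⟩
  add_mem' := by
    rintro a b ⟨⟨x, hx⟩, ha⟩ ⟨⟨y, hy⟩, hb⟩
    exact ⟨⟨x + y, by rw [map_add, hx, hy, TensorProduct.tmul_add]⟩,
      fun j hj => by simp [ha j hj, hb j hj]⟩
  neg_mem' := by
    rintro a ⟨⟨x, hx⟩, ha⟩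
    exact ⟨⟨-x, by rw [map_neg, hx, TensorProduct.tmul_neg]⟩, fun j hj => by simp [ha j hj]⟩

/-- The projection `ℝ^d → ℝ^d/ℤ^d = (ℝ/ℤ)^d`. -/
def torusProj (ι : Type*) : (ι → ℝ) →+ (ι → UnitAddCircle) where
  toFun a i := (a i : UnitAddCircle)
  map_zero' := rfl
  map_add' _ _ := rfl

/-- `G_I ⊆ ℝ^d/ℤ^d`, the projection image of `G'_I`. -/
def G [Fintype ι] (I : Finset ι) : AddSubgroup (ι → UnitAddCircle) :=
  (Δ.preG I).map (torusProj ι)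

/-- `G_Δ`, the union of the finite groups `G_I` over `I ∈ Σ^(n)`. -/
def GUnion [Fintype ι] : Set (ι → UnitAddCircle) := ⋃ I ∈ Δ.facets, (Δ.G I : Set (ι → UnitAddCircle))

theorem finite_G [Fintype ι] [Module.Finite ℤ N] {I : Finset ι} (hI : I ∈ Δ.faces) :
    Finite (Δ.G I) := by
  classical
  choose D hD u' hu' using fun i => exists_intMultiple (Δ.dualVec ℚ I i)
  let ψ : N →+ (ι → ℝ) := AddMonoidHom.mk'
    (fun x i => if i ∈ I then ((Δ.dualVec ℚ I i x : ℚ) : ℝ) else 0) (by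
      intro x y; funext i; by_cases h : i ∈ I <;> simp [h])
  let φ : N →ₗ[ℤ] (ι → UnitAddCircle) := ((torusProj ι).comp ψ).toIntLinearMap
  have htor : Module.IsTorsion ℤ (LinearMap.range φ) := by
    rintro ⟨_, x, rfl⟩
    refine ⟨⟨∏ i, D i, mem_nonZeroDivisors_of_ne_zero (Finset.prod_ne_zero_iff.2 fun i _ => hD i)⟩,
      ?_⟩
    refine Subtype.ext (funext fun i => ?_)
    change (∏ i, D i) • (((if i ∈ I then ((Δ.dualVec ℚ I i x : ℚ) : ℝ) else 0 : ℝ)) :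
      UnitAddCircle) = 0
    by_cases h : i ∈ I
    · rw [if_pos h, ← Finset.prod_erase_mul _ _ (Finset.mem_univ i), mul_zsmul]
      have h2 : (D i • (((Δ.dualVec ℚ I i x : ℚ) : ℝ) : UnitAddCircle)) = 0 := by
        rw [← AddCircle.coe_zsmul]
        refine (AddCircle.coe_eq_zero_iff (1 : ℝ)).2 ⟨u' i x, ?_⟩
        have := congrArg (Rat.cast : ℚ → ℝ) (hu' i x)
        push_cast at this
        simp [this]
      rw [h2, zsmul_zero]
    · rw [if_neg h]; simp
  have hfin : Finite (LinearMap.range φ) := Module.finite_of_fg_torsion _ htor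
  have hsub : (Δ.G I : Set (ι → UnitAddCircle)) ⊆ (LinearMap.range φ : Set _) := by
    rintro _ ⟨a, ⟨⟨x, hx⟩, ha⟩, rfl⟩
    refine ⟨x, ?_⟩
    have hax : ψ x = a := by
      funext i
      change (if i ∈ I then ((Δ.dualVec ℚ I i x : ℚ) : ℝ) else 0) = a i
      by_cases h : i ∈ I
      · rw [if_pos h]
        let L : N →ₗ[ℤ] ℝ := (Rat.castHom ℝ).toAddMonoidHom.toIntLinearMap ∘ₗ Δ.dualVec ℚ I i
        have hL := congrArg (L.liftBaseChange ℝ) hx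
        have hv : ∀ k ∈ I, L (Δ.v k) = if k = i then 1 else 0 := by
          intro k hk
          change ((Δ.dualVec ℚ I i (Δ.v k) : ℚ) : ℝ) = _
          rw [Δ.dualVec_apply ℚ hI i hk]
          split_ifs <;> simp
        have hs : ∑ k, a k * L (Δ.v k) = a i := by
          rw [Finset.sum_eq_single i, hv i h, if_pos rfl, mul_one]
          · intro k _ hki
            by_cases hk : k ∈ I
            · rw [hv k hk, if_neg hki, mul_zero]
            · rw [ha k hk, zero_mul]
          · exact fun h => absurd (Finset.mem_univ i) h
        rw [eta, Fintype.linearCombination_apply, map_sum] at hL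
        simp only [map_smul, vR, LinearMap.liftBaseChange_tmul, one_mul, smul_eq_mul] at hL
        rw [hs] at hL
        exact hL.symm
      · rw [if_neg h, ha i h]
    change torusProj ι (ψ x) = torusProj ι a
    rw [hax]
  exact Set.Finite.subset (Set.toFinite _) hsub

/-- `ρ_i([a]) = exp(2π√-1 a_i)`. -/
def rho (i : ι) (g : ι → UnitAddCircle) : ℂ := (AddCircle.toCircle (g i) : ℂ)

end Groups

section Cohomology

variable [Fintype ι] (K : Type*) [Field K]

/-- The ideal of the face ring, generated by the `x_I = ∏_{i ∈ I} x_i` with `I ∉ Σ`. -/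
def faceIdeal : Ideal (MvPolynomial ι K) :=
  Ideal.span {p | ∃ I : Finset ι, I ∉ Δ.faces ∧ p = ∏ i ∈ I, MvPolynomial.X i}

/-- The linear form `π^*(u) = ∑ ⟨u, v_i⟩ x_i`, `u ∈ N^*`. -/
def linearForm (u : N →ₗ[ℤ] ℤ) : MvPolynomial ι K :=
  ∑ i, MvPolynomial.C ((u (Δ.v i) : ℤ) : K) * MvPolynomial.X i

/-- The ideal generated by the `x_I`, `I ∉ Σ`, and the linear forms `π^*(u)`, `u ∈ N^*`. -/
def cohIdeal : Ideal (MvPolynomial ι K) :=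
  Δ.faceIdeal K ⊔ Ideal.span (Set.range (Δ.linearForm K))

/-- `H_T^*(Δ)` with coefficients in `K`: the face ring of `Σ`. -/
abbrev EquivCoh : Type _ := MvPolynomial ι K ⧸ Δ.faceIdeal K

/-- `H^*(Δ)` with coefficients in `K`: the face ring modulo the linear forms. -/
abbrev Coh : Type _ := MvPolynomial ι K ⧸ Δ.cohIdeal K

/-- The projection `H_T^*(Δ) → H^*(Δ)`. -/
def toCoh : Δ.EquivCoh K →+* Δ.Coh K := Ideal.Quotient.factor le_sup_left

/-- The image `x̄_i` of `x_i` in `H^*(Δ)`. -/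
def xbar (i : ι) : Δ.Coh K := Ideal.Quotient.mk (Δ.cohIdeal K) (MvPolynomial.X i)

theorem isNilpotent_xbar [CharZero K] [Module.Finite ℤ N] (i : ι) :
    IsNilpotent (Δ.xbar K i) := by
  classical
  have hrel : ∀ u : N →ₗ[ℤ] ℤ, ∑ k, ((u (Δ.v k) : ℤ) : Δ.Coh K) * Δ.xbar K k = 0 := by
    intro u
    have h : Ideal.Quotient.mk (Δ.cohIdeal K) (Δ.linearForm K u) = 0 :=
      Ideal.Quotient.eq_zero_iff_mem.2
        (Ideal.mem_sup_right (Ideal.subset_span ⟨u, rfl⟩))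
    rw [linearForm, map_sum] at h
    simpa [xbar] using h
  have key : ∀ (m : ℕ) (J : Finset ι), Fintype.card ι < J.card + m → J.Nonempty →
      IsNilpotent (∏ j ∈ J, Δ.xbar K j) := by
    intro m
    induction m with
    | zero => intro J hJ; exact absurd (Finset.card_le_univ J) (by omega)
    | succ m ih =>
      intro J hJ hne
      by_cases hJf : J ∈ Δ.faces
      · obtain ⟨i, hi⟩ := hne
        obtain ⟨u, hu⟩ := Δ.exists_dualVec ℚ hJf i
        obtain ⟨D, hD, u', hu'⟩ := exists_intMultiple u
        have hui : u' (Δ.v i) = D := by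
          have := hu' (Δ.v i)
          rw [hu i hi, if_pos rfl, mul_one] at this
          exact_mod_cast this
        have huj : ∀ j ∈ J, j ≠ i → u' (Δ.v j) = 0 := by
          intro j hj hji
          have := hu' (Δ.v j)
          rw [hu j hj, if_neg hji, mul_zero] at this
          exact_mod_cast this
        have hsum : (D : Δ.Coh K) * (Δ.xbar K i * ∏ j ∈ J, Δ.xbar K j) =
            - ∑ k ∈ Finset.univ.erase i, ((u' (Δ.v k) : ℤ) : Δ.Coh K) *
              (Δ.xbar K k * ∏ j ∈ J, Δ.xbar K j) := by
          have h := congrArg (· * ∏ j ∈ J, Δ.xbar K j) (hrel u')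
          simp only [zero_mul] at h
          rw [← Finset.add_sum_erase _ _ (Finset.mem_univ i), hui, add_mul, Finset.sum_mul] at h
          simp only [mul_assoc] at h
          exact eq_neg_of_add_eq_zero_left h
        have hnil : IsNilpotent ((D : Δ.Coh K) * (Δ.xbar K i * ∏ j ∈ J, Δ.xbar K j)) := by
          rw [hsum]
          refine IsNilpotent.neg (isNilpotent_sum fun k hk => ?_)
          by_cases hkJ : k ∈ J
          · rw [huj k hkJ (Finset.ne_of_mem_erase hk), Int.cast_zero, zero_mul]
            exact IsNilpotent.zero
          · rw [← Finset.prod_insert hkJ]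
            refine (Commute.all _ _).isNilpotent_mul_left (ih _ ?_ (Finset.insert_nonempty _ _))
            rw [Finset.card_insert_of_notMem hkJ]; omega
        have hDu : IsUnit (D : Δ.Coh K) := by
          have : IsUnit (D : K) := isUnit_iff_ne_zero.2 (by exact_mod_cast hD)
          simpa using this.map (algebraMap K (Δ.Coh K))
        obtain ⟨E, hE⟩ := hDu
        have hnil2 : IsNilpotent (Δ.xbar K i * ∏ j ∈ J, Δ.xbar K j) := by
          have := (Commute.all ((E⁻¹ : (Δ.Coh K)ˣ) : Δ.Coh K) _).isNilpotent_mul_left hnil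
          rwa [← hE, Units.inv_mul_cancel_left] at this
        have hsq : IsNilpotent ((∏ j ∈ J, Δ.xbar K j) ^ 2) := by
          have := (Commute.all (∏ j ∈ J.erase i, Δ.xbar K j) _).isNilpotent_mul_left hnil2
          rw [← mul_assoc, mul_comm (∏ j ∈ J.erase i, Δ.xbar K j), Finset.mul_prod_erase _ _ hi,
            ← sq] at this
          exact this
        exact hsq.of_pow
      · have h : ∏ j ∈ J, Δ.xbar K j = 0 := by
          have : Ideal.Quotient.mk (Δ.cohIdeal K) (∏ j ∈ J, MvPolynomial.X j) = 0 :=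
            Ideal.Quotient.eq_zero_iff_mem.2
              (Ideal.mem_sup_left (Ideal.subset_span ⟨J, hJf, rfl⟩))
          simpa [xbar, map_prod] using this
        rw [h]
        exact IsNilpotent.zero
  simpa using key (Fintype.card ι) {i} (by simp) (Finset.singleton_nonempty i)

/-- `H^*(BT; K)`, the symmetric algebra of `H^2(BT; K) = Hom(N, K)`. -/
abbrev _root_.HBT (N : Type*) [AddCommGroup N] (K : Type*) [Field K] : Type _ :=
  SymmetricAlgebra K (N →ₗ[ℤ] K)

open scoped Classical in
/-- The restriction `ι_I^* : H_T^*(Δ) → H^*(BT)`, `x_i ↦ u_i^I` for `i ∈ I` and `x_i ↦ 0`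
for `i ∉ I`. -/
def restrict (I : Finset ι) (hI : I ∈ Δ.faces) : Δ.EquivCoh K →ₐ[K] HBT N K :=
  Ideal.Quotient.liftₐ (Δ.faceIdeal K)
    (MvPolynomial.aeval fun i => if i ∈ I then SymmetricAlgebra.ι K _ (Δ.dualVec K I i) else 0)
    (by
      intro a ha
      have h : Δ.faceIdeal K ≤ RingHom.ker (MvPolynomial.aeval (R := K) fun i =>
          if i ∈ I then SymmetricAlgebra.ι K _ (Δ.dualVec K I i) else 0) := by
        refine Ideal.span_le.2 ?_
        rintro p ⟨J, hJ, rfl⟩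
        have hJI : ¬ J ⊆ I := fun hs => hJ (Δ.down_closed I hI J hs)
        obtain ⟨j, hj, hjI⟩ := Finset.not_subset.1 hJI
        simp only [SetLike.mem_coe, RingHom.mem_ker, map_prod, MvPolynomial.aeval_X]
        exact Finset.prod_eq_zero hj (if_neg hjI)
      exact h ha)

/-- The index map
`π_!(x) = ∑_{I ∈ Σ^(n)} w(I) ι_I^*(x) / (|G_I| ∏_{i ∈ I} u_i^I)`, with values in the fraction
field of the polynomial ring `H^*(BT; K)`. -/
def gysin (x : Δ.EquivCoh K) : FractionRing (HBT N K) :=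
  ∑ I : {I // I ∈ Δ.facets},
    (Δ.w I : FractionRing (HBT N K)) *
        algebraMap (HBT N K) _ (Δ.restrict K I (Finset.mem_filter.1 I.2).1 x) /
      ((Nat.card (Δ.G I.1) : FractionRing (HBT N K)) *
        ∏ i ∈ I.1, algebraMap (HBT N K) _ (SymmetricAlgebra.ι K _ (Δ.dualVec K I i)))

/-- A linear map `E : H^*(Δ) → K` is induced by `π_!` if, whenever `π_!(x)` is the element `p` of
`H^*(BT; K)`, the value of `E` at the image of `x` is the image of `p` in
`H^*(BT; K) / (H^2(BT; K)) = K`. -/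
def IsInducedByGysin (E : Δ.Coh K →ₗ[K] K) : Prop :=
  ∀ (x : Δ.EquivCoh K) (p : HBT N K), algebraMap (HBT N K) (FractionRing (HBT N K)) p = Δ.gysin K x →
    E (Δ.toCoh K x) = SymmetricAlgebra.algebraMapInv p

end Cohomology

end SimplicialMultiFan

/-- The value `∑ f_k a^k` of a power series `f` at a nilpotent element `a`. -/
def PowerSeries.evalNilpotent {R A : Type*} [CommRing R] [CommRing A] [Algebra R A]
    (f : PowerSeries R) (a : A) : A :=
  ∑ k ∈ Finset.range (nilpotencyClass a), PowerSeries.coeff k f • a ^ k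

/-- The power series `1 - z e^{-t}`. -/
def toddDenom (z : ℂ) : PowerSeries ℂ :=
  1 - PowerSeries.C z * PowerSeries.rescale (-1) (PowerSeries.exp ℂ)

open scoped Classical in
/-- The power series `t / (1 - z e^{-t})`; for `z = 1` numerator and denominator are divided
by `t` first. -/
def toddSeries (z : ℂ) : PowerSeries ℂ :=
  if z = 1 then (PowerSeries.mk fun k => PowerSeries.coeff (k + 1) (toddDenom z))⁻¹
  else PowerSeries.X * (toddDenom z)⁻¹

theorem toddSeries_mul (z : ℂ) : toddSeries z * toddDenom z = PowerSeries.X := by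
  have h0 : PowerSeries.constantCoeff (toddDenom z) = 1 - z := by
    rw [← PowerSeries.coeff_zero_eq_constantCoeff_apply, toddDenom, map_sub,
      PowerSeries.coeff_C_mul, PowerSeries.coeff_rescale]
    simp [PowerSeries.coeff_exp]
  by_cases hz : z = 1
  · subst hz
    rw [toddSeries, if_pos rfl]
    set g : PowerSeries ℂ := PowerSeries.mk fun k => PowerSeries.coeff (k + 1) (toddDenom 1)
    have hg : toddDenom 1 = g * PowerSeries.X := by
      ext k
      cases k with
      | zero => rw [PowerSeries.coeff_zero_mul_X, PowerSeries.coeff_zero_eq_constantCoeff_apply, h0,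
          sub_self]
      | succ k => rw [PowerSeries.coeff_succ_mul_X, PowerSeries.coeff_mk]
    have hg0 : PowerSeries.constantCoeff g ≠ 0 := by
      rw [← PowerSeries.coeff_zero_eq_constantCoeff_apply, PowerSeries.coeff_mk]
      simp [toddDenom, PowerSeries.coeff_rescale, PowerSeries.coeff_exp, PowerSeries.coeff_one]
    rw [hg, ← mul_assoc, PowerSeries.inv_mul_cancel _ hg0, one_mul]
  · rw [toddSeries, if_neg hz, mul_assoc, PowerSeries.inv_mul_cancel, mul_one]
    rw [h0]
    exact sub_ne_zero.2 (Ne.symm hz)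

namespace SimplicialMultiFan

variable {N : Type*} [AddCommGroup N] {ι : Type*} (Δ : SimplicialMultiFan N ι) [Fintype ι]

/-- The Todd class `T(Δ) = ∑_{g ∈ G_Δ} ∏_i x̄_i / (1 - ρ_i(g) e^{-x̄_i})`. -/
def toddClass : Δ.Coh ℂ :=
  ∑ᶠ g ∈ Δ.GUnion, ∏ i, (toddSeries (rho i g)).evalNilpotent (Δ.xbar ℂ i)

end SimplicialMultiFan

/-- A simple multi-polytope: a complete simplicial multi-fan `Δ` together with affine hyperplanes
`F_i = {u | ⟨u, v_i⟩ = c_i}` of `Hom(N, ℝ)`, given by real numbers `c_i`. -/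
structure SimpleMultiPolytope (N : Type*) [AddCommGroup N] (ι : Type*) where
  fan : SimplicialMultiFan N ι
  complete : fan.IsComplete
  c : ι → ℝ

namespace SimpleMultiPolytope

variable {N : Type*} [AddCommGroup N] {ι : Type*} (P : SimpleMultiPolytope N ι)

/-- The affine hyperplane `F_i` in `Hom(N, ℝ)`, the dual of `N ⊗ ℝ`. -/
def hyperplane (i : ι) : Set (N →ₗ[ℤ] ℝ) := {u | u (P.fan.v i) = P.c i}

/-- The embedding of the dual lattice `N^*` into `Hom(N, ℝ)`. -/
def _root_.latticeToReal {N : Type*} [AddCommGroup N] (u : N →ₗ[ℤ] ℤ) : N →ₗ[ℤ] ℝ :=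
  (Int.castAddHom ℝ).toIntLinearMap ∘ₗ u

/-- `P` is a lattice multi-polytope: for `I ∈ Σ^(n)`, the vertex `u_I`, which is the only point of
`⋂_{i ∈ I} F_i`, lies in `N^*`. -/
def IsLattice : Prop :=
  ∀ I ∈ P.fan.facets, ∃ u : N →ₗ[ℤ] ℤ, ∀ i ∈ I, latticeToReal u ∈ P.hyperplane i

/-- The vertex `u_I`, `I ∈ Σ^(n)`. -/
def vertex (I : Finset ι) : N →ₗ[ℤ] ℝ := ∑ i ∈ I, P.c i • P.fan.dualVec ℝ I i

theorem vertex_mem {I : Finset ι} (hI : I ∈ P.fan.facets) {i : ι} (hi : i ∈ I) :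
    P.vertex I ∈ P.hyperplane i := by
  classical
  have h : ∀ j, P.fan.dualVec ℝ I j (P.fan.v i) = if i = j then 1 else 0 := fun j =>
    by
    rw [P.fan.dualVec_apply ℝ (Finset.mem_filter.1 hI).1 j hi]
  simp [hyperplane, vertex, LinearMap.sum_apply, h, hi]

/-- `⟨u_i^I, x⟩` for `x ∈ N ⊗ ℝ`. -/
def _root_.SimplicialMultiFan.dualPairing (Δ : SimplicialMultiFan N ι) (I : Finset ι) (i : ι)
    (x : RealSpace N) : ℝ := (Δ.dualVec ℝ I i).liftBaseChange ℝ x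

/-- The cone with apex `u_I` spanned by the vectors `(u_i^I)^+`, `i ∈ I`, which are
`u_i^I` or `-u_i^I` according to the sign of `⟨u_i^I, x⟩`. -/
def dualCone (x : RealSpace N) (I : Finset ι) : Set (N →ₗ[ℤ] ℝ) :=
  {u | u - P.vertex I ∈ PointedCone.hull ℝ
    ((fun i => if 0 < P.fan.dualPairing I i x then P.fan.dualVec ℝ I i
      else - P.fan.dualVec ℝ I i) '' (I : Set ι))}

open scoped Classical in
/-- The Duistermaat-Heckman function, computed with the generic vector `x`:
`∑_{I ∈ Σ^(n)} (-1)^I w(I) φ_I`. -/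
def DH (x : RealSpace N) (u : N →ₗ[ℤ] ℝ) : ℤ :=
  ∑ I ∈ P.fan.facets,
    (-1) ^ (I.filter fun i => 0 < P.fan.dualPairing I i x).card * P.fan.w I *
      (if u ∈ P.dualCone x I then 1 else 0)

/-- The multi-polytope obtained by moving `F_i` by `ε i` in the direction of `v_i`, that is, to
`{u | ⟨u, v_i⟩ = c_i + ε_i}`. -/
def shift (ε : ι → ℝ) : SimpleMultiPolytope N ι := { P with c := fun i => P.c i + ε i }

/-- `♯(P) = ∑_{u ∈ N^*} DH_{P_+}(u)`, where `P_+` is `P` with each `F_i` slightly moved by `ε i`,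
and `x` is the generic vector used for the Duistermaat-Heckman function. -/
def sharp (x : RealSpace N) (ε : ι → ℝ) : ℤ :=
  ∑ᶠ u : N →ₗ[ℤ] ℤ, (P.shift ε).DH x (latticeToReal u)

/-- The first Chern class `c_1(P) = ∑ c_i x̄_i`. -/
def chern [Fintype ι] : P.fan.Coh ℂ := ∑ i, (P.c i : ℂ) • P.fan.xbar ℂ i

theorem isNilpotent_chern [Fintype ι] [Module.Finite ℤ N] : IsNilpotent P.chern :=
  isNilpotent_sum fun i _ => (P.fan.isNilpotent_xbar ℂ i).smul _

/-- `e^{c_1(P)}`. -/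
def expChern [Fintype ι] : P.fan.Coh ℂ := (PowerSeries.exp ℂ).evalNilpotent P.chern

end SimpleMultiPolytope

end

/-! The proof is localization along a line. Choose a lattice point `z` at which every `u_i^I` takes
a nonzero integer value `a_i`. Since the `c_i` are integers and `0 < ε_i < 1`, a lattice point `u`
lies in the shifted cone of `I` exactly when the integers `b_i = ⟨u - u_I, v_i⟩` satisfy `b_i > 0`
where `a_i > 0` and `b_i ≤ 0` where `a_i < 0`. Averaging over `G_I` selects, among all integer
tuples `b`, those that come from `N^*` (`sum_prod_rho_zpow`). Graded by the value at `z`, the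
lattice points of the cone therefore have the generating function `q^{u_I(z)} |G_I|⁻¹ ∑_g ∏_i
(∑_{b_i} ρ_i(g)^{-b_i} q^{a_i b_i})`, and each inner series represents `± 1 / (1 - ρ_i(g)
q^{-a_i})`, the signs being those in the definition of `DH`.

The signed sum over all `I` is `∑_u DH(u) q^{u(z)}`. It is a finite sum: completeness makes `DH`
independent of the generic vector (`DH_eq_sum_degProj`, `DH_congr`), and different vectors bound the
support in all directions (`finite_support_DH`). Put `q = e^t` and multiply by `t^n`. Each factor
becomes a Todd series divided by `a_i`, so (`exists_sum_rescale_toddSeries`) `∑_I w(I) / (|G_I| ∏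
a_i) · e^{u_I(z) t} ∑_g ∏_i Todd_{ρ_i(g)}(a_i t) = t^n ∑_u DH(u) e^{u(z) t}`. The coefficient of
`t^n` on the right is `♯(P)`; on the left it is the localization formula along `z` for the integral
of `e^{c_1} T` (`apply_expChern_mul_toddClass`).

Integrality of `π_!` comes from the same identity. The numbers `c_i = D` for `i ∈ S` and `0`
otherwise define a lattice multi-polytope when `D` is a common denominator. An alternating sum over
`S ⊆ L` produces `∏_{i ∈ L} (e^{D a_i t} - 1)`, of order at least `t^{|L|}`, while the total is
divisible by `t^n`; if `|L| < n` the lowest coefficient vanishes, which says `π_!(x_L) = 0`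
(`sum_localization_eq_zero`, `gysin_prod_X_of_card_lt`). If `|L| = n`, only `I = L` contributes, and
it contributes a constant. The linear relations reduce every monomial to square-free ones
(`exists_gysin_monomial`). Finally, linear forms pass through `π_!` as factors of degree one, so the
degree-`0` part descends to `H^*(Δ)`. -/

noncomputable section

/-! ### Dual bases and the projected cones -/

namespace SimplicialMultiFan

variable {N : Type*} [AddCommGroup N] {ι : Type*} (Δ : SimplicialMultiFan N ι)

theorem mem_faces_of_mem_facets {I : Finset ι} (hI : I ∈ Δ.facets) : I ∈ Δ.faces :=
  (Finset.mem_filter.1 hI).1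

theorem card_of_mem_facets {I : Finset ι} (hI : I ∈ Δ.facets) :
    I.card = Module.finrank ℤ N := (Finset.mem_filter.1 hI).2

theorem vR_mem_coneSpan {J : Finset ι} {j : ι} (hj : j ∈ J) : Δ.vR j ∈ Δ.coneSpan J :=
  Submodule.subset_span (Submodule.subset_span ⟨j, hj, rfl⟩)

theorem vR_mem_cone {J : Finset ι} {j : ι} (hj : j ∈ J) : Δ.vR j ∈ Δ.cone J :=
  Submodule.subset_span ⟨j, hj, rfl⟩

theorem coneSpan_eq_span (J : Finset ι) :
    Δ.coneSpan J = Submodule.span ℝ (Δ.vR '' (J : Set ι)) := by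
  refine le_antisymm (Submodule.span_le.2 fun y hy => ?_) (Submodule.span_le.2 ?_)
  · exact Submodule.span_le_restrictScalars {c : ℝ // 0 ≤ c} ℝ _ hy
  · rintro _ ⟨j, hj, rfl⟩
    exact Δ.vR_mem_coneSpan hj

theorem coneSpan_mono {J L : Finset ι} (h : J ⊆ L) : Δ.coneSpan J ≤ Δ.coneSpan L := by
  rw [coneSpan_eq_span, coneSpan_eq_span]
  exact Submodule.span_mono (Set.image_mono (Finset.coe_subset.2 h))

/-- Coordinates with respect to the basis `v i`, `i ∈ I`, of `N ⊗ ℝ`. -/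
theorem eq_sum_liftBaseChange_smul [Module.Free ℤ N] [Module.Finite ℤ N] {I : Finset ι}
    (hI : I ∈ Δ.facets) (L : ι → N →ₗ[ℤ] ℝ)
    (hL : ∀ i ∈ I, L i (Δ.v i) = 1) (hL' : ∀ i ∈ I, ∀ j ∈ I, j ≠ i → L i (Δ.v j) = 0)
    (y : RealSpace N) :
    y = ∑ i ∈ I, (L i).liftBaseChange ℝ y • Δ.vR i := by
  classical
  have hcard : Fintype.card I = Module.finrank ℝ (RealSpace N) := by
    rw [Module.finrank_baseChange, Fintype.card_coe, Δ.card_of_mem_facets hI]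
  have hspan : (Submodule.span ℝ (Δ.vR '' (I : Set ι))) = ⊤ := by
    have := LinearIndependent.span_eq_top_of_card_eq_finrank'
      (Δ.linearIndependent I (Δ.mem_faces_of_mem_facets hI)) hcard
    rw [← this]
    congr 1
    ext y
    constructor
    · rintro ⟨i, hi, rfl⟩; exact ⟨⟨i, hi⟩, rfl⟩
    · rintro ⟨⟨i, hi⟩, rfl⟩; exact ⟨i, hi, rfl⟩
  have hy : y ∈ Submodule.span ℝ (Δ.vR '' (I : Set ι)) := hspan ▸ Submodule.mem_top
  induction hy using Submodule.span_induction with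
  | mem x hx =>
    obtain ⟨j, hj, rfl⟩ := hx
    have h1 : ∀ i, (L i).liftBaseChange ℝ (Δ.vR j) = L i (Δ.v j) := fun i => by
      simp [vR]
    rw [Finset.sum_eq_single j]
    · rw [h1, hL j hj, one_smul]
    · intro i hi hij
      rw [h1, hL' i hi j hj (Ne.symm hij), zero_smul]
    · exact fun h => absurd hj h
  | zero => simp
  | add x y _ _ hx hy =>
    conv_lhs => rw [hx, hy]
    simp only [map_add, add_smul, Finset.sum_add_distrib]
  | smul a x _ hx =>
    conv_lhs => rw [hx]
    simp only [map_smul, smul_eq_mul, Finset.smul_sum, mul_smul]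

theorem dualVec_self (K : Type*) [Field K] [CharZero K] {I : Finset ι} (hI : I ∈ Δ.faces)
    {i : ι} (hi : i ∈ I) : Δ.dualVec K I i (Δ.v i) = 1 := by
  rw [Δ.dualVec_apply K hI i hi, if_pos rfl]

theorem dualVec_of_ne (K : Type*) [Field K] [CharZero K] {I : Finset ι} (hI : I ∈ Δ.faces)
    {i j : ι} (hj : j ∈ I) (hji : j ≠ i) : Δ.dualVec K I i (Δ.v j) = 0 := by
  rw [Δ.dualVec_apply K hI i hj, if_neg hji]

/-- A common denominator of all dual bases. -/
theorem exists_common_denominator [Module.Finite ℤ N] [Fintype ι] :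
    ∃ D : ℤ, 0 < D ∧ ∀ I i, ∃ u : N →ₗ[ℤ] ℤ, ∀ x, (u x : ℚ) = D * Δ.dualVec ℚ I i x := by
  classical
  choose D hD u hu using fun p : Finset ι × ι => exists_intMultiple (Δ.dualVec ℚ p.1 p.2)
  -- The squares make the denominator positive while it stays divisible by every `D p`.
  refine ⟨∏ p, D p * D p, Finset.prod_pos fun p _ => mul_self_pos.2 (hD p), fun I i =>
    ⟨(D (I, i) * ∏ p ∈ Finset.univ.erase (I, i), D p * D p) • u (I, i), fun x => ?_⟩⟩
  rw [← Finset.mul_prod_erase _ _ (Finset.mem_univ (I, i))]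
  simp only [LinearMap.smul_apply, smul_eq_mul]
  push_cast
  rw [hu (I, i) x]
  ring

theorem one_tmul_injective [Module.Free ℤ N] :
    Function.Injective (fun x : N => ((1 : ℝ) ⊗ₜ[ℤ] x : RealSpace N)) := by
  intro x y hxy
  let b := Module.Free.chooseBasis ℤ N
  refine b.ext_elem fun k => ?_
  have := congrArg ((latticeToReal (b.coord k)).liftBaseChange ℝ) hxy
  simpa [latticeToReal] using this

/-- Expansion of `x ∈ N` in the rational basis `v i`, `i ∈ I`. -/
theorem apply_eq_sum_dualVec [Module.Free ℤ N] [Module.Finite ℤ N] {I : Finset ι}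
    (hI : I ∈ Δ.facets) (K : Type*) [Field K] [CharZero K] (f : N →ₗ[ℤ] K) (x : N) :
    f x = ∑ i ∈ I, (Δ.dualVec ℚ I i x : K) * f (Δ.v i) := by
  classical
  have hF := Δ.mem_faces_of_mem_facets hI
  choose D hD u hu using fun i : ι => exists_intMultiple (Δ.dualVec ℚ I i)
  set E : ℤ := ∏ i ∈ I, D i with hE
  have hE0 : E ≠ 0 := Finset.prod_ne_zero_iff.2 fun i _ => hD i
  set U : ι → ℤ := fun i => (∏ j ∈ I.erase i, D j) * u i x with hUdef
  have hU : ∀ i ∈ I, (U i : ℚ) = E * Δ.dualVec ℚ I i x := by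
    intro i hi
    rw [hUdef, hE, ← Finset.prod_erase_mul _ _ hi]
    push_cast
    rw [hu]
    ring
  -- After clearing denominators the expansion is a relation inside `N`: all coordinates of `y`
  -- vanish, and `N` embeds in `N ⊗ ℝ`. It can then be mapped to any field of characteristic zero.
  set y : N := E • x - ∑ i ∈ I, U i • Δ.v i with hy
  have hy0 : y = 0 := by
    apply one_tmul_injective
    simp only [TensorProduct.tmul_zero]
    let L : ι → N →ₗ[ℤ] ℝ := fun i =>
      (Rat.castHom ℝ).toAddMonoidHom.toIntLinearMap ∘ₗ Δ.dualVec ℚ I i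
    have hLa : ∀ i z, L i z = ((Δ.dualVec ℚ I i z : ℚ) : ℝ) := fun i z => rfl
    rw [Δ.eq_sum_liftBaseChange_smul hI L (fun i hi => by
        rw [hLa, Δ.dualVec_self ℚ hF hi, Rat.cast_one]) (fun i hi j hj hji => by
        rw [hLa, Δ.dualVec_of_ne ℚ hF hj hji, Rat.cast_zero]) (1 ⊗ₜ[ℤ] y)]
    refine Finset.sum_eq_zero fun i hi => ?_
    rw [LinearMap.liftBaseChange_tmul, one_smul, hLa]
    have : Δ.dualVec ℚ I i y = 0 := by
      rw [hy, map_sub, map_sum, Finset.sum_eq_single i]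
      · rw [map_smul, map_smul, Δ.dualVec_self ℚ hF hi, zsmul_eq_mul, zsmul_eq_mul, hU i hi]; ring
      · intro j hj hji
        rw [map_smul, Δ.dualVec_of_ne ℚ hF hj hji, smul_zero]
      · exact fun h => absurd hi h
    rw [this, Rat.cast_zero, zero_smul]
  have h1 : (E : K) * f x = ∑ i ∈ I, (U i : K) * f (Δ.v i) := by
    have := congrArg f hy0
    rw [hy, map_sub, map_zero, sub_eq_zero, map_smul, map_sum, zsmul_eq_mul] at this
    rw [this]
    exact Finset.sum_congr rfl fun i _ => by rw [map_smul, zsmul_eq_mul]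
  have hE0' : (E : K) ≠ 0 := Int.cast_ne_zero.2 hE0
  apply mul_left_cancel₀ hE0'
  rw [h1, Finset.mul_sum]
  refine Finset.sum_congr rfl fun i hi => ?_
  have := congrArg (Rat.cast : ℚ → K) (hU i hi)
  push_cast at this
  rw [this, mul_assoc]

/-- For a facet the dual basis is unique, so the choice in `dualVec` does no harm. One family of
rational numbers thus serves the real geometry of `DH` and the complex cohomology alike. -/
theorem dualVec_eq_cast [Module.Free ℤ N] [Module.Finite ℤ N] {I : Finset ι}
    (hI : I ∈ Δ.facets) (K : Type*) [Field K] [CharZero K] {i : ι} (hi : i ∈ I) (x : N) :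
    Δ.dualVec K I i x = (Δ.dualVec ℚ I i x : K) := by
  have hF := Δ.mem_faces_of_mem_facets hI
  rw [Δ.apply_eq_sum_dualVec hI K, Finset.sum_eq_single i]
  · rw [Δ.dualVec_self K hF hi, mul_one]
  · intro j hj hji
    rw [Δ.dualVec_of_ne K hF hj hji, mul_zero]
  · exact fun h => absurd hi h

theorem hom_ext_of_facet [Module.Free ℤ N] [Module.Finite ℤ N] {I : Finset ι}
    (hI : I ∈ Δ.facets) {K : Type*} [Field K] [CharZero K] {f g : N →ₗ[ℤ] K}
    (h : ∀ i ∈ I, f (Δ.v i) = g (Δ.v i)) : f = g := by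
  ext x
  rw [Δ.apply_eq_sum_dualVec hI K, Δ.apply_eq_sum_dualVec hI K g]
  exact Finset.sum_congr rfl fun i hi => by rw [h i hi]

theorem dualVec_ne_zero (K : Type*) [Field K] [CharZero K] {I : Finset ι} (hI : I ∈ Δ.faces)
    {i : ι} (hi : i ∈ I) : Δ.dualVec K I i ≠ 0 := by
  intro h
  have := Δ.dualVec_self K hI hi
  rw [h, LinearMap.zero_apply] at this
  exact zero_ne_one this

theorem hom_eq_sum_dualVec [Module.Free ℤ N] [Module.Finite ℤ N] {I : Finset ι}
    (hI : I ∈ Δ.facets) {K : Type*} [Field K] [CharZero K] (f : N →ₗ[ℤ] K) :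
    f = ∑ i ∈ I, f (Δ.v i) • Δ.dualVec K I i := by
  ext x
  rw [Δ.apply_eq_sum_dualVec hI K f x, LinearMap.sum_apply]
  refine Finset.sum_congr rfl fun i hi => ?_
  rw [LinearMap.smul_apply, Δ.dualVec_eq_cast hI K hi, smul_eq_mul, mul_comm]

theorem dualPairing_tmul (I : Finset ι) (i : ι) (x : N) :
    Δ.dualPairing I i (1 ⊗ₜ[ℤ] x) = Δ.dualVec ℝ I i x := by
  simp [dualPairing]

theorem dualPairing_vR {I : Finset ι} (i j : ι) :
    Δ.dualPairing I i (Δ.vR j) = Δ.dualVec ℝ I i (Δ.v j) := Δ.dualPairing_tmul I i _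

theorem eq_sum_dualPairing [Module.Free ℤ N] [Module.Finite ℤ N] {I : Finset ι}
    (hI : I ∈ Δ.facets) (y : RealSpace N) :
    y = ∑ i ∈ I, Δ.dualPairing I i y • Δ.vR i :=
  have hF := Δ.mem_faces_of_mem_facets hI
  Δ.eq_sum_liftBaseChange_smul hI _ (fun _ hi => Δ.dualVec_self ℝ hF hi)
    (fun _ _ _ hj hji => Δ.dualVec_of_ne ℝ hF hj hji) y

theorem dualPairing_eq_zero_of_mem_coneSpan {I J : Finset ι} (hI : I ∈ Δ.faces) (hJ : J ⊆ I)
    {i : ι} (hi : i ∉ J) {y : RealSpace N} (hy : y ∈ Δ.coneSpan J) :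
    Δ.dualPairing I i y = 0 := by
  have : Δ.coneSpan J ≤ LinearMap.ker ((Δ.dualVec ℝ I i).liftBaseChange ℝ) := by
    rw [coneSpan_eq_span, Submodule.span_le]
    rintro _ ⟨j, hj, rfl⟩
    change Δ.dualPairing I i (Δ.vR j) = 0
    rw [dualPairing_vR, Δ.dualVec_of_ne ℝ hI (hJ hj) (by rintro rfl; exact hi hj)]
  exact this hy

theorem dualPairing_nonneg_of_mem_cone {I : Finset ι} (hI : I ∈ Δ.faces) (i : ι)
    {y : RealSpace N} (hy : y ∈ Δ.cone I) : 0 ≤ Δ.dualPairing I i y := by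
  change y ∈ Submodule.span _ _ at hy
  induction hy using Submodule.span_induction with
  | mem z hz =>
    obtain ⟨j, hj, rfl⟩ := hz
    rw [dualPairing_vR, Δ.dualVec_apply ℝ hI i hj]
    split_ifs <;> norm_num
  | zero => simp [dualPairing]
  | add a b _ _ ha hb => rw [dualPairing, map_add]; exact add_nonneg ha hb
  | smul r a _ ha =>
    have : Δ.dualPairing I i (r • a) = (r : ℝ) * Δ.dualPairing I i a :=
      map_smul ((Δ.dualVec ℝ I i).liftBaseChange ℝ) (r : ℝ) a
    rw [this]
    exact mul_nonneg r.2 ha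

/-- If the `i`-th coordinate vanished, `x` would lie in the span of the wall `I \ {i}`, which has `n
- 1` vertices. -/
theorem IsGeneric.dualPairing_ne_zero [Module.Free ℤ N] [Module.Finite ℤ N]
    {Δ : SimplicialMultiFan N ι} {x : RealSpace N}
    (hx : Δ.IsGeneric x) {I : Finset ι} (hI : I ∈ Δ.facets) {i : ι} (hi : i ∈ I) :
    Δ.dualPairing I i x ≠ 0 := by
  classical
  intro h
  have hF := Δ.mem_faces_of_mem_facets hI
  refine hx (I.erase i) (Δ.down_closed I hF _ (Finset.erase_subset _ _)) ?_ ?_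
  · rw [← Δ.card_of_mem_facets hI]
    exact Finset.card_erase_lt_of_mem hi
  · rw [Δ.eq_sum_dualPairing hI x]
    refine Submodule.sum_mem _ fun j hj => ?_
    by_cases hji : j = i
    · subst hji; rw [h, zero_smul]; exact Submodule.zero_mem _
    · exact Submodule.smul_mem _ _ (Δ.vR_mem_coneSpan (Finset.mem_erase.2 ⟨hji, hj⟩))

/-- Completeness enlarges `J` to a facet `I`; a vector in the span of `J` has coordinate zero at
every vertex of `I` outside `J`. -/
theorem isGeneric_of_dualPairing_ne_zero {Δ : SimplicialMultiFan N ι} (hΔ : Δ.IsComplete)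
    {x : RealSpace N} (h : ∀ I ∈ Δ.facets, ∀ i ∈ I, Δ.dualPairing I i x ≠ 0) :
    Δ.IsGeneric x := by
  intro J hJ hcard hx
  obtain ⟨I, hI, hJI⟩ := (hΔ J hJ).1
  have hlt : J.card < I.card := by rwa [Δ.card_of_mem_facets hI]
  obtain ⟨i, hi, hiJ⟩ := Finset.exists_mem_notMem_of_card_lt_card hlt
  exact h I hI i hi
    (Δ.dualPairing_eq_zero_of_mem_coneSpan (Δ.mem_faces_of_mem_facets hI) hJI hiJ hx)

theorem IsGeneric.mkQ {Δ : SimplicialMultiFan N ι} {x : RealSpace N} (hx : Δ.IsGeneric x)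
    (K : Finset ι) : Δ.IsGenericProj K ((Δ.coneSpan K).mkQ x) := by
  intro J hJ hKJ hcard hmem
  refine hx J hJ hcard ?_
  have hle : Submodule.span ℝ (Δ.projCone K J : Set (RealSpace N ⧸ Δ.coneSpan K)) ≤
      (Δ.coneSpan J).map (Δ.coneSpan K).mkQ := by
    rw [Submodule.span_le]
    rintro _ ⟨y, hy, rfl⟩
    exact ⟨y, Submodule.subset_span hy, rfl⟩
  obtain ⟨y, hy, hyx⟩ := hle hmem
  have : x - y ∈ Δ.coneSpan K := by
    rw [← Submodule.ker_mkQ (Δ.coneSpan K), LinearMap.mem_ker, map_sub, hyx, sub_self]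
  have h2 := Submodule.add_mem _ (Δ.coneSpan_mono hKJ this) hy
  rwa [sub_add_cancel] at h2

/-- Modulo `V_K` only the coordinates outside `K` survive, and genericity turns `≥ 0` into `> 0`.
This translates the degrees of the projected fans into the sign conditions that occur in `DH`. -/
theorem mkQ_mem_projCone_iff [Module.Free ℤ N] [Module.Finite ℤ N]
    {Δ : SimplicialMultiFan N ι} {x : RealSpace N}
    (hx : Δ.IsGeneric x) {K I : Finset ι} (hI : I ∈ Δ.facets) (hK : K ⊆ I) :
    (Δ.coneSpan K).mkQ x ∈ Δ.projCone K I ↔ ∀ i ∈ I, i ∉ K → 0 < Δ.dualPairing I i x := by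
  classical
  have hF := Δ.mem_faces_of_mem_facets hI
  constructor
  · rintro ⟨y, hy, hyx⟩ i hi hiK
    have hsub : x - y ∈ Δ.coneSpan K := by
      have hyx' : (Δ.coneSpan K).mkQ y = (Δ.coneSpan K).mkQ x := hyx
      rw [← Submodule.ker_mkQ (Δ.coneSpan K), LinearMap.mem_ker, map_sub, hyx', sub_self]
    have h0 := Δ.dualPairing_eq_zero_of_mem_coneSpan hF hK hiK hsub
    have hxy : Δ.dualPairing I i x = Δ.dualPairing I i y := by
      rw [dualPairing, map_sub, sub_eq_zero] at h0
      exact h0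
    have hy0 := Δ.dualPairing_nonneg_of_mem_cone hF i hy
    exact lt_of_le_of_ne (hxy ▸ hy0) (Ne.symm (hx.dualPairing_ne_zero hI hi))
  · intro h
    refine ⟨∑ i ∈ I \ K, Δ.dualPairing I i x • Δ.vR i, ?_, ?_⟩
    · refine Submodule.sum_mem _ fun i hi => ?_
      obtain ⟨hi, hiK⟩ := Finset.mem_sdiff.1 hi
      exact Submodule.smul_mem (Δ.cone I) (⟨Δ.dualPairing I i x, (h i hi hiK).le⟩ : {c : ℝ // 0 ≤ c})
        (Δ.vR_mem_cone hi)
    · change (Δ.coneSpan K).mkQ _ = _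
      rw [← sub_eq_zero, ← map_sub, ← LinearMap.mem_ker, Submodule.ker_mkQ]
      conv =>
        congr
        · skip
        · rhs
          rw [Δ.eq_sum_dualPairing hI x, ← Finset.sum_sdiff hK]
      rw [sub_add_cancel_left]
      exact Submodule.neg_mem _ (Submodule.sum_mem _ fun j hj =>
        Submodule.smul_mem _ _ (Δ.vR_mem_coneSpan hj))

end SimplicialMultiFan

/-! ### Zariski density of the sublattices `D • N` -/

section Density

variable {N : Type*} [AddCommGroup N]

/-- Evaluation of polynomial functions on `N ⊗ K` at a lattice point. -/
def evalAt (K : Type*) [Field K] (z : N) : HBT N K →ₐ[K] K :=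
  SymmetricAlgebra.lift
    { toFun := fun u : N →ₗ[ℤ] K => u z
      map_add' := fun _ _ => rfl
      map_smul' := fun _ _ => rfl }

@[simp]
theorem evalAt_ι (K : Type*) [Field K] (z : N) (u : N →ₗ[ℤ] K) :
    evalAt K z (SymmetricAlgebra.ι K _ u) = u z := by
  simp [evalAt]

/-- Lattice points divisible by `D` are Zariski dense. -/
theorem eq_zero_of_evalAt_smul_eq_zero [Module.Free ℤ N] [Module.Finite ℤ N] {K : Type*} [Field K]
    [CharZero K] {D : ℤ} (hD : D ≠ 0) {p : HBT N K} (h : ∀ z : N, evalAt K (D • z) p = 0) :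
    p = 0 := by
  let b := Module.Free.chooseBasis ℤ N
  let β : Module.Basis _ K (N →ₗ[ℤ] K) := Module.Basis.ofEquivFun (b.constr K).symm
  have hβ : ∀ k j, β k (b j) = if j = k then 1 else 0 := by
    intro k j
    simp only [β, Module.Basis.coe_ofEquivFun, LinearEquiv.symm_symm, Module.Basis.constr_basis]
    rw [Pi.single_apply]
  apply (SymmetricAlgebra.equivMvPolynomial β).injective
  rw [map_zero]
  -- In coordinates the points `D • z` form a product of infinite subsets of `K`, and a polynomial
  -- vanishing on such a product is zero.
  refine MvPolynomial.funext_set (fun _ => Set.range fun m : ℤ => (D : K) * m) (fun _ => ?_) ?_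
  · refine Set.infinite_range_of_injective fun m m' hm => ?_
    exact Int.cast_injective (mul_left_cancel₀ (Int.cast_ne_zero.2 hD) hm)
  · intro x hx
    choose m hm using fun k => hx k (Set.mem_univ k)
    have key : (evalAt K (D • ∑ k, m k • b k)) =
        (MvPolynomial.aeval x).comp (SymmetricAlgebra.equivMvPolynomial β).toAlgHom := by
      apply SymmetricAlgebra.algHom_ext
      refine β.ext fun k => ?_
      change evalAt K _ (SymmetricAlgebra.ι K _ (β k)) =
        MvPolynomial.aeval x (SymmetricAlgebra.equivMvPolynomial β (SymmetricAlgebra.ι K _ (β k)))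
      rw [SymmetricAlgebra.equivMvPolynomial_ι_apply, MvPolynomial.aeval_X, evalAt_ι, map_smul,
        map_sum, ← hm k, Finset.sum_eq_single k]
      · rw [map_smul, hβ, if_pos rfl]; simp
      · intro j _ hj
        rw [map_smul, hβ, if_neg hj, smul_zero]
      · exact fun hk => absurd (Finset.mem_univ k) hk
    have h2 := DFunLike.congr_fun key p
    rw [h] at h2
    rw [map_zero]
    exact h2.symm

theorem symmetricAlgebra_ι_injective (K : Type*) [Field K] :
    Function.Injective (SymmetricAlgebra.ι K (N →ₗ[ℤ] K)) := by
  rw [injective_iff_map_eq_zero]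
  intro u hu
  ext z
  have := congrArg (evalAt K z) hu
  simpa using this

end Density

/-! ### Regular lattice points -/

namespace SimplicialMultiFan

variable {N : Type*} [AddCommGroup N] [Module.Free ℤ N] [Module.Finite ℤ N]
  {ι : Type*} (Δ : SimplicialMultiFan N ι)

/-- The lattice point `z` lies on no hyperplane spanned by a wall of a cone `C(I)`. -/
def IsRegular (z : N) : Prop := ∀ I ∈ Δ.facets, ∀ i ∈ I, Δ.dualVec ℚ I i z ≠ 0

/-- The product of all linear forms `u_i^I`. -/
def wallProd (K : Type*) [Field K] : HBT N K :=
  ∏ I ∈ Δ.facets, ∏ i ∈ I, SymmetricAlgebra.ι K _ (Δ.dualVec K I i)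

theorem wallProd_ne_zero (K : Type*) [Field K] [CharZero K] : Δ.wallProd K ≠ 0 := by
  refine Finset.prod_ne_zero_iff.2 fun I hI => Finset.prod_ne_zero_iff.2 fun i hi h => ?_
  exact Δ.dualVec_ne_zero K (Δ.mem_faces_of_mem_facets hI) hi
    (symmetricAlgebra_ι_injective K (h.trans (map_zero _).symm))

theorem evalAt_wallProd_ne_zero_iff (K : Type*) [Field K] [CharZero K] (z : N) :
    evalAt K z (Δ.wallProd K) ≠ 0 ↔ Δ.IsRegular z := by
  rw [wallProd, map_prod, Finset.prod_ne_zero_iff]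
  refine forall₂_congr fun I hI => ?_
  rw [map_prod, Finset.prod_ne_zero_iff]
  refine forall₂_congr fun i hi => ?_
  rw [evalAt_ι, Δ.dualVec_eq_cast hI K hi, Rat.cast_ne_zero]

/-- Otherwise the nonzero polynomial `wallProd` would vanish on all of `D • N`. -/
theorem exists_isRegular_smul {D : ℤ} (hD : D ≠ 0) : ∃ z : N, Δ.IsRegular (D • z) := by
  by_contra! h
  refine Δ.wallProd_ne_zero ℚ (eq_zero_of_evalAt_smul_eq_zero hD fun z => ?_)
  by_contra h2
  exact h z ((Δ.evalAt_wallProd_ne_zero_iff ℚ _).1 h2)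

theorem IsRegular.isGeneric {Δ : SimplicialMultiFan N ι} (hΔ : Δ.IsComplete) {z : N}
    (hz : Δ.IsRegular z) : Δ.IsGeneric (1 ⊗ₜ[ℤ] z) :=
  isGeneric_of_dualPairing_ne_zero hΔ fun I hI i hi => by
    rw [dualPairing_tmul, Δ.dualVec_eq_cast hI ℝ hi, Rat.cast_ne_zero]
    exact hz I hI i hi

end SimplicialMultiFan

/-! ### The Duistermaat-Heckman function: independence of the vector and finite support -/

namespace SimpleMultiPolytope

theorem vertex_apply_v {N : Type*} [AddCommGroup N] {ι : Type*}
    (P : SimpleMultiPolytope N ι) {I : Finset ι} (hI : I ∈ P.fan.facets) {i : ι} (hi : i ∈ I) :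
    P.vertex I (P.fan.v i) = P.c i := P.vertex_mem hI hi

variable {N : Type*} [AddCommGroup N] [Module.Free ℤ N] [Module.Finite ℤ N]
  {ι : Type*} (P : SimpleMultiPolytope N ι)

/-- In the basis `u_i^I` the difference `u - u_I` has coordinates `u(v_i) - c_i`, and the cone
prescribes their signs. As `u` avoids the hyperplanes, every inequality is strict. -/
theorem mem_dualCone_iff {x : RealSpace N} {I : Finset ι}
    (hI : I ∈ P.fan.facets) {u : N →ₗ[ℤ] ℝ} (hu : ∀ i ∈ I, u (P.fan.v i) ≠ P.c i) :
    u ∈ P.dualCone x I ↔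
      ∀ i ∈ I, (0 < P.fan.dualPairing I i x ↔ P.c i < u (P.fan.v i)) := by
  classical
  have hF := P.fan.mem_faces_of_mem_facets hI
  set s : ι → N →ₗ[ℤ] ℝ := fun i => if 0 < P.fan.dualPairing I i x then P.fan.dualVec ℝ I i
      else - P.fan.dualVec ℝ I i with hs
  constructor
  · intro h i hi
    have hi' : ∀ w ∈ PointedCone.hull ℝ (s '' (I : Set ι)),
        0 ≤ (if 0 < P.fan.dualPairing I i x then (1 : ℝ) else -1) * w (P.fan.v i) := by
      intro w hw
      induction hw using Submodule.span_induction with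
      | mem w hw =>
        obtain ⟨j, hj, rfl⟩ := hw
        have hd := P.fan.dualVec_apply ℝ hF j hi
        by_cases hij : i = j
        · subst hij
          rw [if_pos rfl] at hd
          simp only [hs]
          split_ifs <;> simp [hd]
        · rw [if_neg hij] at hd
          have : s j (P.fan.v i) = 0 := by
            simp only [hs]
            split_ifs <;> simp [hd]
          rw [this, mul_zero]
      | zero => simp
      | add a b _ _ ha hb => rw [LinearMap.add_apply, mul_add]; exact add_nonneg ha hb
      | smul r a _ ha =>
        have : (r • a) (P.fan.v i) = (r : ℝ) * a (P.fan.v i) := rfl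
        rw [this, mul_left_comm]
        exact mul_nonneg r.2 ha
    have h2 := hi' _ h
    rw [LinearMap.sub_apply, P.vertex_apply_v hI hi] at h2
    have h3 := hu i hi
    by_cases hp : 0 < P.fan.dualPairing I i x
    · rw [if_pos hp, one_mul] at h2
      exact iff_of_true hp (lt_of_le_of_ne (sub_nonneg.1 h2) (Ne.symm h3))
    · rw [if_neg hp] at h2
      exact iff_of_false hp (not_lt.2 (by linarith))
  · intro h
    change u - P.vertex I ∈ PointedCone.hull ℝ (s '' (I : Set ι))
    rw [P.fan.hom_eq_sum_dualVec hI (u - P.vertex I)]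
    refine Submodule.sum_mem _ fun i hi => ?_
    rw [LinearMap.sub_apply, P.vertex_apply_v hI hi]
    have hmem : s i ∈ PointedCone.hull ℝ (s '' (I : Set ι)) := Submodule.subset_span ⟨i, hi, rfl⟩
    have := Submodule.smul_mem _ (⟨|u (P.fan.v i) - P.c i|, abs_nonneg _⟩ : {c : ℝ // 0 ≤ c}) hmem
    convert this using 1
    change _ = |u (P.fan.v i) - P.c i| • s i
    simp only [hs]
    by_cases hp : 0 < P.fan.dualPairing I i x
    · rw [if_pos hp, abs_of_pos (sub_pos.2 ((h i hi).1 hp))]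
    · rw [if_neg hp, abs_of_nonpos (sub_nonpos.2 (not_lt.1 (fun h' => hp ((h i hi).2 h')))),
        smul_neg, neg_smul, neg_neg]

open scoped Classical in
/-- The Duistermaat-Heckman function in terms of the degrees of the projected multi-fans. -/
theorem DH_eq_sum_degProj {x : RealSpace N} (hx : P.fan.IsGeneric x) {u : N →ₗ[ℤ] ℝ}
    (hu : ∀ I ∈ P.fan.facets, ∀ i ∈ I, u (P.fan.v i) ≠ P.c i) :
    P.DH x u = ∑ L ∈ P.fan.faces, (∏ i ∈ L, if u (P.fan.v i) < P.c i then 1 else 0) *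
      (-1) ^ (Module.finrank ℤ N - L.card) * P.fan.degProj L ((P.fan.coneSpan L).mkQ x) := by
  -- The signed indicator of the cone of `I` equals `∏_{i ∈ I} ([u(v_i) < c_i] - [⟨u_i^I, x⟩ > 0])`:
  -- each factor is checked in the four cases of signs. Expanding over the subset `L` on which the
  -- first term is chosen separates `u` from `x`.
  have h1 : ∀ I ∈ P.fan.facets,
      (-1) ^ (I.filter fun i => 0 < P.fan.dualPairing I i x).card * P.fan.w I *
        (if u ∈ P.dualCone x I then 1 else 0) =
      ∑ L ∈ I.powerset, P.fan.w I * ((∏ i ∈ L, if u (P.fan.v i) < P.c i then 1 else 0) *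
        ∏ i ∈ I \ L, -(if 0 < P.fan.dualPairing I i x then 1 else 0)) := by
    intro I hI
    have h2 : (if u ∈ P.dualCone x I then (1 : ℤ) else 0) =
        ∏ i ∈ I, if (0 < P.fan.dualPairing I i x ↔ P.c i < u (P.fan.v i)) then 1 else 0 := by
      rw [Finset.prod_ite_zero, Finset.prod_const_one]
      exact if_congr (P.mem_dualCone_iff hI (hu I hI)) rfl rfl
    have h3 : (-1 : ℤ) ^ (I.filter fun i => 0 < P.fan.dualPairing I i x).card =
        ∏ i ∈ I, if 0 < P.fan.dualPairing I i x then -1 else 1 := by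
      rw [Finset.prod_ite, Finset.prod_const, Finset.prod_const_one, mul_one]
    rw [h2, h3, ← Finset.mul_sum, ← Finset.prod_add, mul_comm _ (P.fan.w I), mul_assoc,
      ← Finset.prod_mul_distrib]
    congr 1
    refine Finset.prod_congr rfl fun i hi => ?_
    rcases lt_or_gt_of_ne (hu I hI i hi) with h | h
    · by_cases hp : 0 < P.fan.dualPairing I i x
      · simp [h, hp, not_lt.2 h.le]
      · simp [h, hp, not_lt.2 h.le]
    · by_cases hp : 0 < P.fan.dualPairing I i x
      · simp [h, hp, not_lt.2 h.le]
      · simp [h, hp, not_lt.2 h.le]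
  rw [DH, Finset.sum_congr rfl h1, Finset.sum_comm' (t' := P.fan.faces)
    (s' := fun L => P.fan.facets.filter fun I => L ⊆ I)]
  · refine Finset.sum_congr rfl fun L hL => ?_
    rw [SimplicialMultiFan.degProj, Finset.mul_sum]
    -- For fixed `L`, what depends on `x` is the sum of `w(I)` over the facets containing `L` whose
    -- coordinates outside `L` are positive at `x`. This is the degree of `Δ_L`, which is constant
    -- by completeness.
    have h4 : (P.fan.facets.filter fun I => L ⊆ I ∧
        (P.fan.coneSpan L).mkQ x ∈ P.fan.projCone L I) =
        (P.fan.facets.filter fun I => L ⊆ I).filter fun I =>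
          ∀ i ∈ I \ L, 0 < P.fan.dualPairing I i x := by
      ext I
      simp only [Finset.mem_filter, and_assoc, Finset.mem_sdiff, and_imp]
      refine and_congr_right fun hI => and_congr_right fun hLI => ?_
      exact SimplicialMultiFan.mkQ_mem_projCone_iff hx hI hLI
    rw [h4]
    conv_rhs => rw [Finset.sum_filter]
    refine Finset.sum_congr rfl fun I hI => ?_
    obtain ⟨hI, hLI⟩ := Finset.mem_filter.1 hI
    have h5 : (∏ i ∈ I \ L, if 0 < P.fan.dualPairing I i x then (1 : ℤ) else 0) =
        if ∀ i ∈ I \ L, 0 < P.fan.dualPairing I i x then 1 else 0 := by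
      rw [Finset.prod_ite_zero, Finset.prod_const_one]
    rw [Finset.prod_neg, h5,
      Finset.card_sdiff_of_subset hLI, P.fan.card_of_mem_facets hI]
    split_ifs <;> ring
  · intro I L
    simp only [Finset.mem_powerset, Finset.mem_filter]
    constructor
    · rintro ⟨hI, hL⟩
      exact ⟨⟨hI, hL⟩, P.fan.down_closed I (P.fan.mem_faces_of_mem_facets hI) L hL⟩
    · rintro ⟨⟨hI, hL⟩, _⟩
      exact ⟨hI, hL⟩

/-- The Duistermaat-Heckman function does not depend on the generic vector. -/
theorem DH_congr {x y : RealSpace N} (hx : P.fan.IsGeneric x) (hy : P.fan.IsGeneric y)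
    {u : N →ₗ[ℤ] ℝ} (hu : ∀ I ∈ P.fan.facets, ∀ i ∈ I, u (P.fan.v i) ≠ P.c i) :
    P.DH x u = P.DH y u := by
  rw [P.DH_eq_sum_degProj hx hu, P.DH_eq_sum_degProj hy hu]
  refine Finset.sum_congr rfl fun L hL => ?_
  rw [(P.complete L hL).2 _ _ (hx.mkQ L) (hy.mkQ L)]

/-- On the cone of `I` defined by `z` itself, evaluation at `z` is minimal at the apex: each
coordinate of `u - u_I` has the sign of `⟨u_i^I, z⟩`. -/
theorem exists_vertex_le_of_DH_ne_zero {z : N} {u : N →ₗ[ℤ] ℝ}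
    (hu : ∀ I ∈ P.fan.facets, ∀ i ∈ I, u (P.fan.v i) ≠ P.c i)
    (h : P.DH (1 ⊗ₜ[ℤ] z) u ≠ 0) : ∃ I ∈ P.fan.facets, P.vertex I z ≤ u z := by
  classical
  obtain ⟨I, hI, hne⟩ := Finset.exists_ne_zero_of_sum_ne_zero h
  have hmem : u ∈ P.dualCone (1 ⊗ₜ[ℤ] z) I := by
    by_contra hn
    rw [if_neg hn, mul_zero] at hne
    exact hne rfl
  rw [P.mem_dualCone_iff hI (hu I hI)] at hmem
  refine ⟨I, hI, ?_⟩
  rw [← sub_nonneg, ← LinearMap.sub_apply, P.fan.hom_eq_sum_dualVec hI (u - P.vertex I),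
    LinearMap.sum_apply]
  refine Finset.sum_nonneg fun i hi => ?_
  rw [LinearMap.smul_apply, LinearMap.sub_apply, P.vertex_apply_v hI hi, smul_eq_mul,
    ← P.fan.dualPairing_tmul]
  have := hmem i hi
  by_cases hp : 0 < P.fan.dualPairing I i (1 ⊗ₜ[ℤ] z)
  · exact mul_nonneg (sub_nonneg.2 (this.1 hp).le) hp.le
  · exact mul_nonneg_of_nonpos_of_nonpos
      (sub_nonpos.2 (not_lt.1 fun h' => hp (this.2 h'))) (not_lt.1 hp)

/-- Since `DH` may be computed with any regular `z`, evaluation at each regular `z` is bounded below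
on the support. Every lattice point is a sum of two regular ones, so the same holds for all `y` and
`-y`, and in particular for a basis of `N`. -/
theorem finite_support_DH {x : RealSpace N} (hx : P.fan.IsGeneric x)
    (hu : ∀ u : N →ₗ[ℤ] ℤ, ∀ I ∈ P.fan.facets, ∀ i ∈ I, (u (P.fan.v i) : ℝ) ≠ P.c i) :
    {u : N →ₗ[ℤ] ℤ | P.DH x (latticeToReal u) ≠ 0}.Finite := by
  classical
  set S := {u : N →ₗ[ℤ] ℤ | P.DH x (latticeToReal u) ≠ 0} with hS
  have hlow : ∀ z : N, P.fan.IsRegular z → ∃ m : ℝ, ∀ u ∈ S, m ≤ u z := by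
    intro z hz
    refine ⟨-∑ I ∈ P.fan.facets, |P.vertex I z|, fun u hu' => ?_⟩
    have hDH : P.DH (1 ⊗ₜ[ℤ] z) (latticeToReal u) ≠ 0 := by
      rw [P.DH_congr (hz.isGeneric P.complete) hx (hu u)]; exact hu'
    obtain ⟨I, hI, hle⟩ := P.exists_vertex_le_of_DH_ne_zero (hu u) hDH
    have h1 : |P.vertex I z| ≤ ∑ I ∈ P.fan.facets, |P.vertex I z| :=
      Finset.single_le_sum (f := fun I => |P.vertex I z|) (fun _ _ => abs_nonneg _) hI
    have h2 : P.vertex I z ≤ u z := hle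
    have h3 := neg_abs_le (P.vertex I z)
    linarith
  obtain ⟨z, hz⟩ := P.fan.exists_isRegular_smul one_ne_zero
  rw [one_smul] at hz
  have hlow' : ∀ y : N, ∃ m : ℝ, ∀ u ∈ S, m ≤ u y := by
    intro y
    -- The integer `s` must avoid `0` and finitely many ratios at which `y + s • z` meets a wall. A
    -- ratio equal to an integer equals its floor, so excluding the floors suffices.
    obtain ⟨s, hs⟩ := Infinite.exists_notMem_finset
      (insert (0 : ℤ) (P.fan.facets.biUnion fun I => I.image fun i =>
        ⌊-P.fan.dualVec ℚ I i y / P.fan.dualVec ℚ I i z⌋))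
    have hs0 : s ≠ 0 := fun h => hs (h ▸ Finset.mem_insert_self _ _)
    have h1 : P.fan.IsRegular (y + s • z) := by
      intro I hI i hi h
      refine hs (Finset.mem_insert_of_mem (Finset.mem_biUnion.2 ⟨I, hI, Finset.mem_image.2
        ⟨i, hi, ?_⟩⟩))
      have hzi := hz I hI i hi
      have : -P.fan.dualVec ℚ I i y / P.fan.dualVec ℚ I i z = (s : ℚ) := by
        rw [map_add, map_smul, zsmul_eq_mul] at h
        rw [div_eq_iff hzi]
        linarith
      rw [this, Int.floor_intCast]
    have h2 : P.fan.IsRegular ((-s) • z) := by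
      intro I hI i hi
      rw [map_smul, zsmul_eq_mul]
      exact mul_ne_zero (by exact_mod_cast neg_ne_zero.2 hs0) (hz I hI i hi)
    obtain ⟨m1, hm1⟩ := hlow _ h1
    obtain ⟨m2, hm2⟩ := hlow _ h2
    refine ⟨m1 + m2, fun u hu' => ?_⟩
    have h3 := add_le_add (hm1 u hu') (hm2 u hu')
    have h4 : u (y + s • z) + u ((-s) • z) = u y := by
      rw [← map_add]; congr 1; rw [neg_smul]; abel
    rwa [← Int.cast_add, h4] at h3
  choose m hm using hlow'
  let b := Module.Free.chooseBasis ℤ N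
  have hfin : (Set.pi Set.univ fun k => Set.Icc ⌈m (b k)⌉ (-⌈m (-b k)⌉) : Set (_ → ℤ)).Finite :=
    Set.Finite.pi fun k => Set.finite_Icc _ _
  refine (hfin.image (b.constr ℤ)).subset fun u hu' => ⟨fun k => u (b k), fun k _ => ⟨?_, ?_⟩, ?_⟩
  · exact Int.ceil_le.2 (hm _ u hu')
  · have := Int.ceil_le.2 (hm (-b k) u hu')
    rw [map_neg] at this
    exact le_neg.1 this
  · exact b.ext fun k => by rw [Module.Basis.constr_basis]

end SimpleMultiPolytope

/-- Identities between fractions are transferred from one ring to another by clearing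
denominators. -/
theorem sum_eq_of_sum_fractions {A B C κ : Type*} [CommRing A] [CommRing B]
    [CommRing C] [IsDomain C] (φ : A →+* B) (hφ : Function.Injective φ) (ψ : A →+* C)
    (s : Finset κ) (n d : κ → A) (F : κ → B) (H : κ → C) (τ : C) (q : A)
    (hF : ∀ k ∈ s, F k * φ (d k) = φ (n k)) (hH : ∀ k ∈ s, H k * ψ (d k) = τ * ψ (n k))
    (hd : ∀ k ∈ s, ψ (d k) ≠ 0) (hq : ∑ k ∈ s, F k = φ q) : ∑ k ∈ s, H k = τ * ψ q := by
  classical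
  -- Injectivity of `φ` brings the cleared identity back to `A`, where `ψ` applies even if it does
  -- not extend to `B`.
  have h1 : ∑ k ∈ s, n k * ∏ j ∈ s.erase k, d j = q * ∏ j ∈ s, d j := by
    apply hφ
    rw [map_mul, ← hq, map_sum, Finset.sum_mul]
    refine Finset.sum_congr rfl fun k hk => ?_
    rw [map_mul, ← hF k hk, ← Finset.mul_prod_erase s d hk, map_mul, mul_assoc]
  apply mul_right_cancel₀ (b := ∏ j ∈ s, ψ (d j)) (Finset.prod_ne_zero_iff.2 hd)
  rw [← map_prod, mul_assoc, ← map_mul, ← h1, map_sum, Finset.mul_sum, Finset.sum_mul]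
  refine Finset.sum_congr rfl fun k hk => ?_
  rw [map_mul, ← mul_assoc, ← hH k hk, ← Finset.mul_prod_erase s d hk, map_mul, mul_assoc]

/-! ### Series of one-dimensional cones and Todd series -/

section Series

open PowerSeries

/-- The series `∑ ρ^(-b) q^(a b)`, where `b` runs through the positive integers if `a > 0` and
through the integers `b ≤ 0` if `a < 0`. -/
def coneSeries (a : ℤ) (ρ : ℂ) : PowerSeries ℂ :=
  PowerSeries.mk fun l => if a ∣ l ∧ (0 < a → l ≠ 0) then ρ⁻¹ ^ ((l : ℤ) / a) else 0

/-- The numerator of the rational function represented by `coneSeries a ρ`. -/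
def coneNum (a : ℤ) (ρ : ℂ) : Polynomial ℂ :=
  if 0 < a then Polynomial.C ρ⁻¹ * Polynomial.X ^ a.natAbs else 1

/-- The denominator of the rational function represented by `coneSeries a ρ`. -/
def coneDen (a : ℤ) (ρ : ℂ) : Polynomial ℂ :=
  1 - Polynomial.C (if 0 < a then ρ⁻¹ else ρ) * Polynomial.X ^ a.natAbs

/-- This is a geometric series of ratio `ρ⁻¹ q^a` for `a > 0` and `ρ q^{-a}` for `a < 0`. It starts
with its ratio in the first case and with `1` in the second; this asymmetry reflects the shift by
`ε`. -/
theorem coneSeries_mul_coneDen {a : ℤ} (ha : a ≠ 0) {ρ : ℂ} (hρ : ρ ≠ 0) :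
    coneSeries a ρ * (coneDen a ρ : PowerSeries ℂ) = (coneNum a ρ : PowerSeries ℂ) := by
  have hpos : 0 < a.natAbs := Int.natAbs_pos.2 ha
  have hsub : ∀ l : ℕ, a.natAbs ≤ l → ((l - a.natAbs : ℕ) : ℤ) = l - |a| := fun l hl => by
    rw [Nat.cast_sub hl, Int.natCast_natAbs]
  ext l
  rw [coneDen, Polynomial.coe_sub, Polynomial.coe_one, Polynomial.coe_mul, Polynomial.coe_C,
    Polynomial.coe_pow, Polynomial.coe_X, mul_sub, mul_one, map_sub, mul_left_comm,
    coeff_C_mul, coeff_mul_X_pow']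
  rcases lt_or_gt_of_ne ha with hneg | hp
  · have hna : ¬ 0 < a := not_lt.2 hneg.le
    rw [coneNum, if_neg hna, if_neg hna, Polynomial.coe_one, coeff_one, coneSeries, coeff_mk,
      coeff_mk]
    simp only [hna, false_imp_iff, and_true]
    rcases Nat.lt_or_ge l a.natAbs with hl | hl
    · rw [if_neg (not_le.2 hl), mul_zero, sub_zero]
      by_cases h0 : l = 0
      · subst h0; simp
      · rw [if_neg h0, if_neg]
        intro hdvd
        have := Int.natAbs_le_of_dvd_ne_zero hdvd (by exact_mod_cast h0)
        simp at this; omega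
    · have h0 : l ≠ 0 := by omega
      have habs : |a| = -a := abs_of_neg hneg
      rw [if_pos hl, if_neg h0, hsub l hl, habs, sub_neg_eq_add]
      by_cases hdvd : a ∣ (l : ℤ)
      · rw [if_pos hdvd, if_pos (dvd_add_self_right.2 hdvd), Int.add_ediv_of_dvd_left hdvd,
          Int.ediv_self ha, zpow_add₀ (inv_ne_zero hρ), zpow_one]
        field_simp
        simp
      · rw [if_neg hdvd, if_neg (fun h => hdvd (dvd_add_self_right.1 h)), mul_zero, sub_zero]
  · rw [coneNum, if_pos hp, if_pos hp, Polynomial.coe_mul, Polynomial.coe_C, Polynomial.coe_pow,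
      Polynomial.coe_X, coeff_C_mul, coeff_X_pow, coneSeries, coeff_mk, coeff_mk]
    simp only [hp, true_imp_iff]
    have habs : |a| = a := abs_of_pos hp
    have haa : (a.natAbs : ℤ) = a := by rw [Int.natCast_natAbs, habs]
    rcases Nat.lt_or_ge l a.natAbs with hl | hl
    · rw [if_neg (not_le.2 hl), mul_zero, sub_zero, if_neg hl.ne, mul_zero, if_neg]
      rintro ⟨hdvd, h0⟩
      have := Int.natAbs_le_of_dvd_ne_zero hdvd (by exact_mod_cast h0)
      simp at this; omega
    · have h0 : l ≠ 0 := by omega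
      rw [if_pos hl, hsub l hl, habs]
      by_cases hdvd : a ∣ (l : ℤ)
      · rw [if_pos ⟨hdvd, h0⟩]
        by_cases hla : l = a.natAbs
        · rw [if_neg (fun h => h.2 (by omega)), if_pos hla, hla, haa, Int.ediv_self ha]
          simp
        · rw [if_neg hla, if_pos ⟨dvd_sub_self_right.2 hdvd, by omega⟩,
            Int.sub_ediv_of_dvd _ (dvd_refl a), Int.ediv_self ha, zpow_sub₀ (inv_ne_zero hρ),
            zpow_one]
          field_simp
          simp
      · rw [if_neg (fun h => hdvd h.1), if_neg (fun h => hdvd (dvd_sub_self_right.1 h.1)), if_neg]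
        · simp
        · rintro rfl; exact hdvd (by rw [haa])

/-- Substitution of `e^t` into a polynomial. -/
def expSubst : Polynomial ℂ →ₐ[ℂ] PowerSeries ℂ := Polynomial.aeval (PowerSeries.exp ℂ)

theorem expSubst_X_pow (m : ℕ) :
    expSubst (Polynomial.X ^ m) = rescale (m : ℂ) (exp ℂ) := by
  rw [expSubst, map_pow, Polynomial.aeval_X, exp_pow_eq_rescale_exp]

theorem expSubst_C (c : ℂ) : expSubst (Polynomial.C c) = C c := by
  rw [expSubst, Polynomial.aeval_C]; rfl

/-- The constant term vanishes when `ρ = 1`, but the linear coefficient, a nonzero multiple of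
`|a|`, never does. -/
theorem expSubst_coneDen_ne_zero {a : ℤ} (ha : a ≠ 0) {ρ : ℂ} (hρ : ρ ≠ 0) :
    expSubst (coneDen a ρ) ≠ 0 := by
  intro h
  have h1 := congrArg (coeff 1) h
  rw [coneDen, map_sub, map_one, map_mul, expSubst_C, expSubst_X_pow, map_sub, coeff_one,
    if_neg one_ne_zero, coeff_C_mul, coeff_rescale, map_zero, zero_sub, neg_eq_zero] at h1
  have hn : ((a.natAbs : ℕ) : ℂ) ≠ 0 := Nat.cast_ne_zero.2 (Int.natAbs_ne_zero.2 ha)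
  have : (if 0 < a then ρ⁻¹ else ρ) ≠ 0 := by split_ifs <;> simp [hρ]
  rcases mul_eq_zero.1 h1 with h2 | h2
  · exact this h2
  · rw [pow_one] at h2
    simp [coeff_exp, ha] at h2

theorem rescale_toddSeries_mul (a ρ : ℂ) :
    rescale a (toddSeries ρ) * (1 - C ρ * rescale (-a) (exp ℂ)) = C a * X := by
  have h := congrArg (rescale a) (toddSeries_mul ρ)
  rw [map_mul, toddDenom, map_sub, map_one, map_mul, rescale_rescale, rescale_X] at h
  have hC : rescale a (C ρ) = C ρ := by
    ext k
    rw [coeff_rescale, coeff_C]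
    split_ifs with hk
    · rw [hk, pow_zero, one_mul]
    · rw [mul_zero]
  rw [hC] at h
  rw [← h]
  congr 5
  ring

/-- The rational function of the cone is `1 / (1 - ρ q^{-a})` for `a < 0` and its negative for `a >
0`. At `q = e^t` this matches the Todd series at `a t` divided by `a t`; the sign cancels the one in
`DH`. -/
theorem rescale_toddSeries_mul_coneDen {a : ℤ} (ha : a ≠ 0) {ρ : ℂ} (hρ : ρ ≠ 0) :
    rescale (a : ℂ) (toddSeries ρ) * expSubst (coneDen a ρ) =
      C ((if 0 < a then -1 else 1) * (a : ℂ)) * X * expSubst (coneNum a ρ) := by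
  have h := rescale_toddSeries_mul a ρ
  rcases lt_or_gt_of_ne ha with hneg | hp
  · have hna : ¬ 0 < a := not_lt.2 hneg.le
    have haa : ((a.natAbs : ℕ) : ℂ) = -a := by
      have : ((a.natAbs : ℕ) : ℤ) = -a := by rw [Int.natCast_natAbs, abs_of_neg hneg]
      simpa only [Int.cast_natCast, Int.cast_neg] using congrArg (Int.cast : ℤ → ℂ) this
    rw [coneDen, coneNum, if_neg hna, if_neg hna, if_neg hna, map_sub, map_mul, expSubst_C,
      expSubst_X_pow, map_one, mul_one, one_mul, haa, h]
  · have haa : ((a.natAbs : ℕ) : ℂ) = a := by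
      have : ((a.natAbs : ℕ) : ℤ) = a := by rw [Int.natCast_natAbs, abs_of_pos hp]
      simpa only [Int.cast_natCast] using congrArg (Int.cast : ℤ → ℂ) this
    rw [coneDen, coneNum, if_pos hp, if_pos hp, if_pos hp, map_sub, map_mul, expSubst_C,
      expSubst_X_pow, map_one, haa]
    have h1 : rescale (a : ℂ) (exp ℂ) * rescale (-(a : ℂ)) (exp ℂ) = 1 := by
      rw [exp_mul_exp_eq_exp_add, add_neg_cancel, rescale_zero]; simp
    have h2 : C ρ⁻¹ * C ρ = (1 : PowerSeries ℂ) := by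
      rw [← map_mul, inv_mul_cancel₀ hρ, map_one]
    have h3 : (1 : PowerSeries ℂ) - C ρ⁻¹ * rescale (a : ℂ) (exp ℂ) =
        (1 - C ρ * rescale (-(a : ℂ)) (exp ℂ)) * -(C ρ⁻¹ * rescale (a : ℂ) (exp ℂ)) := by
      linear_combination -(C ρ * C ρ⁻¹) * h1 - h2
    rw [h3, ← mul_assoc, h, map_mul, map_neg, map_one]
    ring

end Series

theorem rho_eq_one_iff {ι : Type*} (i : ι) (g : ι → UnitAddCircle) :
    SimplicialMultiFan.rho i g = 1 ↔ g i = 0 := by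
  rw [SimplicialMultiFan.rho, Circle.coe_eq_one, ← AddCircle.toCircle_zero,
    (AddCircle.injective_toCircle one_ne_zero).eq_iff]

theorem rho_ne_zero {ι : Type*} (i : ι) (g : ι → UnitAddCircle) :
    SimplicialMultiFan.rho i g ≠ 0 := Circle.coe_ne_zero _

/-! ### The groups `G_I`, their characters, and lattice points of cones -/

namespace SimplicialMultiFan

section

variable {N : Type*} [AddCommGroup N] [Module.Free ℤ N] [Module.Finite ℤ N]
  {ι : Type*} (Δ : SimplicialMultiFan N ι)

theorem apply_eq_sum_int {I : Finset ι} (hI : I ∈ Δ.facets) {z : N} {a : ι → ℤ}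
    (ha : ∀ i ∈ I, (a i : ℚ) = Δ.dualVec ℚ I i z) (u : N →ₗ[ℤ] ℤ) :
    u z = ∑ i ∈ I, a i * u (Δ.v i) := by
  have h := Δ.apply_eq_sum_dualVec hI ℝ (latticeToReal u) z
  have h2 : ((u z : ℤ) : ℝ) = ((∑ i ∈ I, a i * u (Δ.v i) : ℤ) : ℝ) := by
    change ((u z : ℤ) : ℝ) = _ at h
    rw [h, Int.cast_sum]
    refine Finset.sum_congr rfl fun i hi => ?_
    rw [← ha i hi, Rat.cast_intCast, Int.cast_mul]
    rfl
  exact_mod_cast h2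

theorem int_hom_ext_of_facet {I : Finset ι} (hI : I ∈ Δ.facets) {u w : N →ₗ[ℤ] ℤ}
    (h : ∀ i ∈ I, u (Δ.v i) = w (Δ.v i)) : u = w := by
  have h1 : latticeToReal u = latticeToReal w := Δ.hom_ext_of_facet hI fun i hi => by
    change ((u (Δ.v i) : ℤ) : ℝ) = ((w (Δ.v i) : ℤ) : ℝ)
    rw [h i hi]
  ext x
  have h2 : ((u x : ℤ) : ℝ) = ((w x : ℤ) : ℝ) := DFunLike.congr_fun h1 x
  exact_mod_cast h2

end

variable {N : Type*} [AddCommGroup N] [Module.Finite ℤ N]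
  {ι : Type*} [Fintype ι] (Δ : SimplicialMultiFan N ι)

theorem finite_GUnion : Δ.GUnion.Finite :=
  Δ.facets.finite_toSet.biUnion fun _ hI =>
    have := Δ.finite_G (Δ.mem_faces_of_mem_facets hI)
    Set.toFinite _

open scoped Classical in
/-- The elements of `G_Δ` supported in `I`; for `I ∈ Σ^(n)` this is `G_I`. -/
def groupFinset (I : Finset ι) : Finset (ι → UnitAddCircle) :=
  Δ.finite_GUnion.toFinset.filter fun g => ∀ i ∉ I, g i = 0

theorem natCard_G_ne_zero {I : Finset ι} (hI : I ∈ Δ.facets) : Nat.card (Δ.G I) ≠ 0 := by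
  have := Δ.finite_G (Δ.mem_faces_of_mem_facets hI)
  exact Nat.card_pos.ne'

/-- An element of `G_J` supported in `I` has a representative with integral coordinates off `I`.
Subtracting these multiples of the `v_i` from the lattice point gives a representative for `G_I`. -/
theorem mem_groupFinset_iff {I : Finset ι} (hI : I ∈ Δ.facets) {g : ι → UnitAddCircle} :
    g ∈ Δ.groupFinset I ↔ g ∈ Δ.G I := by
  classical
  rw [groupFinset, Finset.mem_filter, Set.Finite.mem_toFinset]
  constructor
  · rintro ⟨hg, h0⟩
    simp only [GUnion, Set.mem_iUnion] at hg
    obtain ⟨J, hJ, a, ⟨⟨x, hx⟩, ha⟩, rfl⟩ := hg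
    have hint : ∀ i, ∃ m : ℤ, i ∉ I → a i = m := by
      intro i
      by_cases hi : i ∈ I
      · exact ⟨0, fun h => absurd hi h⟩
      · obtain ⟨m, hm⟩ := (AddCircle.coe_eq_zero_iff (1 : ℝ)).1 (h0 i hi)
        exact ⟨m, fun _ => by rw [← hm]; simp⟩
    choose m hm using hint
    refine ⟨fun i => if i ∈ I then a i else 0,
      ⟨⟨x - ∑ i ∈ Finset.univ.filter (· ∉ I), m i • Δ.v i, ?_⟩, fun j hj => if_neg hj⟩, ?_⟩
    · rw [TensorProduct.tmul_sub, ← hx, eta, Fintype.linearCombination_apply,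
        Fintype.linearCombination_apply, TensorProduct.tmul_sum, eq_sub_iff_add_eq,
        ← Finset.sum_filter_add_sum_filter_not Finset.univ (· ∈ I) (fun i => a i • Δ.vR i)]
      congr 1
      · rw [Finset.sum_filter]
        simp only [ite_smul, zero_smul]
      · refine Finset.sum_congr rfl fun i hi => ?_
        rw [hm i (Finset.mem_filter.1 hi).2, TensorProduct.tmul_smul, vR, Int.cast_smul_eq_zsmul]
    · funext i
      change (((if i ∈ I then a i else 0 : ℝ)) : UnitAddCircle) = (a i : UnitAddCircle)
      split_ifs with hi
      · rfl
      · exact (h0 i hi).symm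
  · intro hg
    refine ⟨Set.mem_biUnion hI hg, ?_⟩
    obtain ⟨a, ⟨_, ha⟩, rfl⟩ := hg
    intro i hi
    change ((a i : ℝ) : UnitAddCircle) = 0
    rw [ha i hi]; rfl

variable [Module.Free ℤ N]

open scoped Classical in
-- This presents `G_I` as the quotient of `N` by the sublattice spanned by the `v_i`, `i ∈ I`,
-- through the coordinates modulo `ℤ`.
theorem mem_G_iff {I : Finset ι} (hI : I ∈ Δ.facets) {g : ι → UnitAddCircle} :
    g ∈ Δ.G I ↔ ∃ x : N, ∀ i, g i = if i ∈ I then (Δ.dualVec ℝ I i x : UnitAddCircle) else 0 := by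
  have hF := Δ.mem_faces_of_mem_facets hI
  constructor
  · rintro ⟨a, ⟨⟨x, hx⟩, ha⟩, rfl⟩
    refine ⟨x, fun i => ?_⟩
    change ((a i : ℝ) : UnitAddCircle) = _
    split_ifs with hi
    · congr 1
      rw [← dualPairing_tmul, ← hx, eta, Fintype.linearCombination_apply, dualPairing, map_sum,
        Finset.sum_eq_single i]
      · rw [map_smul]
        change a i = a i • Δ.dualPairing I i (Δ.vR i)
        rw [dualPairing_vR, Δ.dualVec_self ℝ hF hi, smul_eq_mul, mul_one]
      · intro j _ hji
        rw [map_smul]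
        change a j • Δ.dualPairing I i (Δ.vR j) = 0
        by_cases hj : j ∈ I
        · rw [dualPairing_vR, Δ.dualVec_of_ne ℝ hF hj hji, smul_zero]
        · rw [ha j hj, zero_smul]
      · exact fun h => absurd (Finset.mem_univ i) h
    · rw [ha i hi]; rfl
  · rintro ⟨x, hx⟩
    refine ⟨fun i => if i ∈ I then Δ.dualVec ℝ I i x else 0, ⟨⟨x, ?_⟩, fun j hj => if_neg hj⟩, ?_⟩
    · rw [eta, Fintype.linearCombination_apply, Δ.eq_sum_dualPairing hI (1 ⊗ₜ[ℤ] x)]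
      simp only [dualPairing_tmul, ite_smul, zero_smul, Finset.sum_ite_mem, Finset.univ_inter]
    · funext i
      rw [hx i]
      change (((if i ∈ I then Δ.dualVec ℝ I i x else 0 : ℝ)) : UnitAddCircle) = _
      split_ifs <;> rfl

open scoped Classical in
/-- Orthogonality of characters of `G_I`. -/
theorem sum_prod_rho_zpow {I : Finset ι} (hI : I ∈ Δ.facets) (b : ι → ℤ) :
    ∑ g ∈ Δ.groupFinset I, ∏ i ∈ I, rho i g ^ b i =
      if ∃ u : N →ₗ[ℤ] ℤ, ∀ i ∈ I, u (Δ.v i) = b i then (Nat.card (Δ.G I) : ℂ) else 0 := by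
  have hF := Δ.mem_faces_of_mem_facets hI
  have := Δ.finite_G hF
  have := Fintype.ofFinite (Δ.G I)
  let ψ : AddChar (Δ.G I) ℂ :=
    { toFun := fun g => ∏ i ∈ I, rho i (g : ι → UnitAddCircle) ^ b i
      map_zero_eq_one' := Finset.prod_eq_one fun i _ => by
        rw [(rho_eq_one_iff i _).2 rfl, one_zpow]
      map_add_eq_mul' := fun g h => by
        rw [← Finset.prod_mul_distrib]
        refine Finset.prod_congr rfl fun i _ => ?_
        rw [← mul_zpow]
        congr 1
        simp [rho, AddCircle.toCircle_add] }
  have h1 : ∑ g ∈ Δ.groupFinset I, ∏ i ∈ I, rho i g ^ b i = ∑ g : Δ.G I, ψ g :=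
    Finset.sum_subtype _ (fun g => Δ.mem_groupFinset_iff hI) _
  rw [h1, AddChar.sum_eq_ite, Nat.card_eq_fintype_card]
  refine if_congr ?_ rfl rfl
  have hval : ∀ (g : Δ.G I) (x : N),
      (∀ i, g.1 i = if i ∈ I then (Δ.dualVec ℝ I i x : UnitAddCircle) else 0) →
      ψ g = AddCircle.toCircle (((∑ i ∈ I, b i * Δ.dualVec ℝ I i x : ℝ)) : UnitAddCircle) := by
    intro g x hgx
    have h2 : (((∑ i ∈ I, b i * Δ.dualVec ℝ I i x : ℝ)) : UnitAddCircle) =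
        ∑ i ∈ I, b i • g.1 i := by
      rw [← QuotientAddGroup.mk'_apply, map_sum]
      refine Finset.sum_congr rfl fun i hi => ?_
      rw [hgx i, if_pos hi, ← zsmul_eq_mul, map_zsmul]
      rfl
    rw [h2]
    have h3 : ∀ s : Finset ι, ((AddCircle.toCircle (∑ i ∈ s, b i • g.1 i) : Circle) : ℂ) =
        ∏ i ∈ s, rho i g.1 ^ b i := by
      intro s
      induction s using Finset.induction_on with
      | empty => simp
      | insert i s hi ih =>
        rw [Finset.sum_insert hi, Finset.prod_insert hi, AddCircle.toCircle_add, Circle.coe_mul,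
          ih, AddCircle.toCircle_zsmul, Circle.coe_zpow]
        rfl
    exact (h3 I).symm
  have htriv : ∀ r : ℝ, ((AddCircle.toCircle (r : UnitAddCircle) : Circle) : ℂ) = 1 ↔
      ∃ m : ℤ, (m : ℝ) = r := by
    intro r
    rw [Circle.coe_eq_one, ← AddCircle.toCircle_zero,
      (AddCircle.injective_toCircle one_ne_zero).eq_iff, AddCircle.coe_eq_zero_iff]
    simp
  -- On the class of `x` the character is `exp(2π√-1 ∑ b_i u_i^I(x))`. It is trivial exactly when `∑
  -- b_i u_i^I` takes integer values on `N`, that is, lies in `N^*`.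
  constructor
  · intro hψ
    have hint : ∀ x : N, ∃ m : ℤ, (m : ℝ) = ∑ i ∈ I, b i * Δ.dualVec ℝ I i x := by
      intro x
      let g : Δ.G I := ⟨fun i => if i ∈ I then (Δ.dualVec ℝ I i x : UnitAddCircle) else 0,
        (Δ.mem_G_iff hI).2 ⟨x, fun i => rfl⟩⟩
      rw [← htriv, ← hval g x (fun _ => rfl), hψ, AddChar.zero_apply]
    choose m hm using hint
    let f : N →ₗ[ℤ] ℝ := ∑ i ∈ I, (b i : ℝ) • Δ.dualVec ℝ I i
    have hf : ∀ x, (m x : ℝ) = f x := fun x => by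
      rw [hm]; simp [f, LinearMap.sum_apply]
    refine ⟨(AddMonoidHom.mk' m fun x y => ?_).toIntLinearMap, fun i hi => ?_⟩
    · have : ((m (x + y) : ℤ) : ℝ) = ((m x + m y : ℤ) : ℝ) := by
        rw [Int.cast_add, hf, hf, hf, map_add]
      exact_mod_cast this
    · change m (Δ.v i) = b i
      have : (m (Δ.v i) : ℝ) = b i := by
        rw [hm, Finset.sum_eq_single i]
        · rw [Δ.dualVec_self ℝ hF hi, mul_one]
        · intro j _ hji
          rw [Δ.dualVec_of_ne ℝ hF hi (Ne.symm hji), mul_zero]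
        · exact fun h => absurd hi h
      exact_mod_cast this
  · rintro ⟨u, hu⟩
    ext g
    obtain ⟨x, hx⟩ := (Δ.mem_G_iff hI).1 g.2
    rw [hval g x hx, AddChar.zero_apply, htriv]
    refine ⟨u x, ?_⟩
    have := Δ.apply_eq_sum_dualVec hI ℝ (latticeToReal u) x
    change (u x : ℝ) = _ at this
    rw [this]
    refine Finset.sum_congr rfl fun i hi => ?_
    change _ * ((u (Δ.v i) : ℤ) : ℝ) = _
    rw [hu i hi, Δ.dualVec_eq_cast hI ℝ hi, mul_comm]

/-- The lattice points of level `k` in a shifted dual cone. -/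
def levelSet (I : Finset ι) (a : ι → ℤ) (z : N) (k : ℤ) : Set (N →ₗ[ℤ] ℤ) :=
  {u | u z = k ∧ ∀ i ∈ I, (0 < a i ↔ 0 < u (Δ.v i))}

/-- A coefficient of the product runs over tuples `l_i = a_i b_i ≥ 0` of sum `k`, and summing the
characters over `G_I` keeps the tuples whose `b` comes from a lattice point. Each level is finite
because the `l_i` are nonnegative. -/
theorem levelSet_finite_and_coeff {I : Finset ι} (hI : I ∈ Δ.facets) {z : N} {a : ι → ℤ}
    (ha : ∀ i ∈ I, (a i : ℚ) = Δ.dualVec ℚ I i z) (ha0 : ∀ i ∈ I, a i ≠ 0) (k : ℕ) :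
    (Δ.levelSet I a z k).Finite ∧
    PowerSeries.coeff k (∑ g ∈ Δ.groupFinset I, ∏ i ∈ I, coneSeries (a i) (rho i g)) =
      Nat.card (Δ.G I) * ((Δ.levelSet I a z k).ncard : ℂ) := by
  classical
  set T : Finset (ι →₀ ℕ) := (Finset.finsuppAntidiag I k).filter fun l =>
    (∀ i ∈ I, a i ∣ l i ∧ (0 < a i → l i ≠ 0)) ∧
      ∃ u : N →ₗ[ℤ] ℤ, ∀ i ∈ I, u (Δ.v i) = (l i : ℤ) / a i with hT
  let f : (N →ₗ[ℤ] ℤ) → (ι →₀ ℕ) := fun u =>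
    Finsupp.onFinset I (fun i => if i ∈ I then (a i * u (Δ.v i)).toNat else 0)
      (fun i hi => by by_contra h; exact hi (if_neg h))
  have hf : ∀ u, ∀ i ∈ I, f u i = (a i * u (Δ.v i)).toNat := fun u i hi => if_pos hi
  have hnn : ∀ u ∈ Δ.levelSet I a z k, ∀ i ∈ I, 0 ≤ a i * u (Δ.v i) := by
    rintro u ⟨_, hu⟩ i hi
    by_cases hp : 0 < a i
    · exact (mul_pos hp ((hu i hi).1 hp)).le
    · exact mul_nonneg_of_nonpos_of_nonpos (not_lt.1 hp)
        (not_lt.1 fun h => hp ((hu i hi).2 h))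
  have hfc : ∀ u ∈ Δ.levelSet I a z k, ∀ i ∈ I, (f u i : ℤ) = a i * u (Δ.v i) :=
    fun u hu i hi => by rw [hf u i hi, Int.toNat_of_nonneg (hnn u hu i hi)]
  have hbij : Set.BijOn f (Δ.levelSet I a z k) (T : Set (ι →₀ ℕ)) := by
    refine ⟨fun u hu => ?_, fun u hu w hw huw => ?_, fun l hl => ?_⟩
    · rw [Finset.mem_coe, hT, Finset.mem_filter, Finset.mem_finsuppAntidiag]
      refine ⟨⟨?_, Finsupp.support_onFinset_subset⟩, fun i hi => ⟨?_, ?_⟩, u, fun i hi => ?_⟩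
      · have h1 := Δ.apply_eq_sum_int hI ha u
        rw [hu.1, ← Finset.sum_congr rfl (hfc u hu), ← Nat.cast_sum] at h1
        exact_mod_cast h1.symm
      · rw [hfc u hu i hi]; exact dvd_mul_right _ _
      · intro hp h0
        have h1 := hfc u hu i hi
        rw [h0, Nat.cast_zero] at h1
        exact (mul_pos hp ((hu.2 i hi).1 hp)).ne h1
      · rw [hfc u hu i hi, Int.mul_ediv_cancel_left _ (ha0 i hi)]
    · refine Δ.int_hom_ext_of_facet hI fun i hi => ?_
      apply mul_left_cancel₀ (ha0 i hi)
      rw [← hfc u hu i hi, ← hfc w hw i hi, huw]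
    · rw [Finset.mem_coe, hT, Finset.mem_filter, Finset.mem_finsuppAntidiag] at hl
      obtain ⟨⟨hsum, hsupp⟩, hdvd, u, hu⟩ := hl
      have hau : ∀ i ∈ I, a i * u (Δ.v i) = l i := fun i hi => by
        rw [hu i hi, Int.mul_ediv_cancel' (hdvd i hi).1]
      refine ⟨u, ⟨?_, fun i hi => ?_⟩, ?_⟩
      · rw [Δ.apply_eq_sum_int hI ha u, Finset.sum_congr rfl hau, ← Nat.cast_sum, hsum]
      · have h1 := hau i hi
        constructor
        · intro hp
          have h2 : 0 < a i * u (Δ.v i) := by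
            rw [h1]; exact_mod_cast Nat.pos_of_ne_zero ((hdvd i hi).2 hp)
          exact (mul_pos_iff_of_pos_left hp).1 h2
        · intro hp
          by_contra hn
          have h2 : a i * u (Δ.v i) < 0 :=
            mul_neg_of_neg_of_pos (lt_of_le_of_ne (not_lt.1 hn) (ha0 i hi)) hp
          rw [h1] at h2
          exact absurd h2 (not_lt.2 (Nat.cast_nonneg _))
      · ext i
        by_cases hi : i ∈ I
        · rw [hf u i hi, hau i hi, Int.toNat_natCast]
        · rw [Finsupp.notMem_support_iff.1 fun h => hi (hsupp h)]
          exact if_neg hi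
  refine ⟨hbij.finite_iff_finite.2 T.finite_toSet, ?_⟩
  have hcard : (Δ.levelSet I a z k).ncard = T.card := by
    rw [← hbij.injOn.ncard_image, hbij.image_eq, Set.ncard_coe_finset]
  rw [hcard, map_sum]
  simp only [PowerSeries.coeff_prod]
  rw [Finset.sum_comm]
  have hterm : ∀ l ∈ Finset.finsuppAntidiag I k,
      ∑ g ∈ Δ.groupFinset I, ∏ i ∈ I, PowerSeries.coeff (l i) (coneSeries (a i) (rho i g)) =
      if (∀ i ∈ I, a i ∣ l i ∧ (0 < a i → l i ≠ 0)) ∧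
        ∃ u : N →ₗ[ℤ] ℤ, ∀ i ∈ I, u (Δ.v i) = (l i : ℤ) / a i then
        (Nat.card (Δ.G I) : ℂ) else 0 := by
    intro l _
    simp only [coneSeries, PowerSeries.coeff_mk, Finset.prod_ite_zero]
    by_cases hc : ∀ i ∈ I, a i ∣ l i ∧ (0 < a i → l i ≠ 0)
    · simp only [if_pos hc, and_iff_right hc]
      -- The series carries `ρ^{-b}`; passing from `u` to `-u` removes the sign from the condition.
      have h1 := Δ.sum_prod_rho_zpow hI fun i => -((l i : ℤ) / a i)
      have h2 : (∃ u : N →ₗ[ℤ] ℤ, ∀ i ∈ I, u (Δ.v i) = -((l i : ℤ) / a i)) ↔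
          ∃ u : N →ₗ[ℤ] ℤ, ∀ i ∈ I, u (Δ.v i) = (l i : ℤ) / a i := by
        constructor
        · rintro ⟨u, hu⟩
          exact ⟨-u, fun i hi => by rw [LinearMap.neg_apply, hu i hi, neg_neg]⟩
        · rintro ⟨u, hu⟩
          exact ⟨-u, fun i hi => by rw [LinearMap.neg_apply, hu i hi]⟩
      rw [if_congr h2 rfl rfl] at h1
      rw [← h1]
      refine Finset.sum_congr rfl fun g _ => Finset.prod_congr rfl fun i _ => ?_
      rw [inv_zpow, zpow_neg]
    · rw [if_neg (fun h => hc h.1)]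
      exact Finset.sum_eq_zero fun g _ => if_neg hc
  rw [Finset.sum_congr rfl hterm, ← Finset.sum_filter, ← hT, Finset.sum_const, nsmul_eq_mul,
    mul_comm]

end SimplicialMultiFan

/-! ### Generating functions of lattice points of multi-polytopes -/

namespace SimpleMultiPolytope

/-- For `i` in a facet, `c_i` is an integer, so `c_i + ε_i` lies strictly between consecutive
integers. -/
theorem IsLattice.shift_ne {N : Type*} [AddCommGroup N] {ι : Type*}
    {P : SimpleMultiPolytope N ι} (hP : P.IsLattice) {ε : ι → ℝ}
    (hε : ∀ i, 0 < ε i ∧ ε i < 1) (u : N →ₗ[ℤ] ℤ) :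
    ∀ I ∈ (P.shift ε).fan.facets, ∀ i ∈ I,
      latticeToReal u ((P.shift ε).fan.v i) ≠ (P.shift ε).c i := by
  intro I hI i hi h
  obtain ⟨w, hw⟩ := hP I hI
  have h1 : ((w (P.fan.v i) : ℤ) : ℝ) = P.c i := hw i hi
  have h2 : ((u (P.fan.v i) : ℤ) : ℝ) = P.c i + ε i := h
  rw [← h1] at h2
  have h3 := hε i
  have h4 : (w (P.fan.v i) : ℝ) < u (P.fan.v i) := by linarith
  have h5 : (u (P.fan.v i) : ℝ) < w (P.fan.v i) + 1 := by linarith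
  have h6 : w (P.fan.v i) < u (P.fan.v i) := by exact_mod_cast h4
  have h7 : u (P.fan.v i) < w (P.fan.v i) + 1 := by exact_mod_cast h5
  omega

variable {N : Type*} [AddCommGroup N] [Module.Free ℤ N] [Module.Finite ℤ N]
  {ι : Type*}

/-- The lattice points of a shifted dual cone of level `k` form a translate of `levelSet`. -/
theorem latticeToReal_mem_dualCone_shift_iff {P : SimpleMultiPolytope N ι} (hP : P.IsLattice)
    {ε : ι → ℝ} (hε : ∀ i, 0 < ε i ∧ ε i < 1) {z : N} {I : Finset ι} (hI : I ∈ P.fan.facets)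
    {a : ι → ℤ} (ha : ∀ i ∈ I, (a i : ℚ) = P.fan.dualVec ℚ I i z)
    {w : N →ₗ[ℤ] ℤ} (hw : ∀ i ∈ I, latticeToReal w ∈ P.hyperplane i) (u : N →ₗ[ℤ] ℤ) :
    latticeToReal u ∈ (P.shift ε).dualCone (1 ⊗ₜ[ℤ] z) I ↔
      ∀ i ∈ I, (0 < a i ↔ 0 < (u - w) (P.fan.v i)) := by
  rw [(P.shift ε).mem_dualCone_iff hI (hP.shift_ne hε u I hI)]
  refine forall₂_congr fun i hi => ?_
  refine iff_congr ?_ ?_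
  · change 0 < P.fan.dualPairing I i (1 ⊗ₜ[ℤ] z) ↔ _
    rw [SimplicialMultiFan.dualPairing_tmul, P.fan.dualVec_eq_cast hI ℝ hi, ← ha i hi]
    simp
  · have h1 : ((w (P.fan.v i) : ℤ) : ℝ) = P.c i := hw i hi
    change P.c i + ε i < ((u (P.fan.v i) : ℤ) : ℝ) ↔ _
    rw [LinearMap.sub_apply, ← h1, sub_pos]
    have h3 := hε i
    constructor
    · intro h
      have : (w (P.fan.v i) : ℝ) < u (P.fan.v i) := by linarith
      exact_mod_cast this
    · intro h
      have : (w (P.fan.v i) : ℝ) + 1 ≤ u (P.fan.v i) := by exact_mod_cast h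
      linarith

variable [Fintype ι]

open PowerSeries in
/-- The lattice points of the shifted dual cones, counted by their value at `z`. -/
theorem sum_coneSeries {P : SimpleMultiPolytope N ι} (hP : P.IsLattice)
    {ε : ι → ℝ} (hε : ∀ i, 0 < ε i ∧ ε i < 1) {z : N}
    {a : Finset ι → ι → ℤ}
    (ha : ∀ I ∈ P.fan.facets, ∀ i ∈ I, (a I i : ℚ) = P.fan.dualVec ℚ I i z)
    (ha0 : ∀ I ∈ P.fan.facets, ∀ i ∈ I, a I i ≠ 0)
    {w : Finset ι → N →ₗ[ℤ] ℤ}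
    (hw : ∀ I ∈ P.fan.facets, ∀ i ∈ I, latticeToReal (w I) ∈ P.hyperplane i)
    (S : Finset (N →ₗ[ℤ] ℤ))
    (hS : ∀ u, u ∈ S ↔ (P.shift ε).DH (1 ⊗ₜ[ℤ] z) (latticeToReal u) ≠ 0)
    (M : ℤ) (hM : ∀ I ∈ P.fan.facets, 0 ≤ M + w I z) (hM' : ∀ u ∈ S, 0 ≤ M + u z) :
    ∑ I ∈ P.fan.facets, C ((-1) ^ (I.filter fun i => 0 < a I i).card * (P.fan.w I : ℂ) /
        Nat.card (P.fan.G I)) * (X ^ (M + w I z).toNat *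
        ∑ g ∈ P.fan.groupFinset I, ∏ i ∈ I, coneSeries (a I i) (SimplicialMultiFan.rho i g)) =
      ∑ u ∈ S, C ((P.shift ε).DH (1 ⊗ₜ[ℤ] z) (latticeToReal u) : ℂ) *
        X ^ (M + u z).toNat := by
  classical
  ext K
  -- The identity is compared coefficient by coefficient. `A I` is the level of the cone of `I` that
  -- contributes to `q^K`; the shift by `M` keeps exponents nonnegative, so that power series can
  -- replace Laurent series.
  set A : Finset ι → Set (N →ₗ[ℤ] ℤ) := fun I =>
    {u | latticeToReal u ∈ (P.shift ε).dualCone (1 ⊗ₜ[ℤ] z) I ∧ M + u z = K} with hA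
  have key : ∀ I ∈ P.fan.facets, (A I).Finite ∧
      coeff K (X ^ (M + w I z).toNat * ∑ g ∈ P.fan.groupFinset I,
        ∏ i ∈ I, coneSeries (a I i) (SimplicialMultiFan.rho i g)) =
        Nat.card (P.fan.G I) * ((A I).ncard : ℂ) := by
    intro I hI
    have hAmem : ∀ u, u ∈ A I ↔ u - w I ∈ P.fan.levelSet I (a I) z (K - M - w I z) := by
      intro u
      rw [hA, Set.mem_ofPred_eq,
        latticeToReal_mem_dualCone_shift_iff hP hε hI (ha I hI) (hw I hI) u, and_comm,
        SimplicialMultiFan.levelSet, Set.mem_ofPred_eq, LinearMap.sub_apply]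
      exact and_congr_left fun _ => ⟨fun h => by omega, fun h => by omega⟩
    have hMI := hM I hI
    rw [coeff_X_pow_mul']
    by_cases hK : (M + w I z).toNat ≤ K
    · rw [if_pos hK]
      have hcast : ((K - (M + w I z).toNat : ℕ) : ℤ) = K - M - w I z := by omega
      obtain ⟨h1, h2⟩ := P.fan.levelSet_finite_and_coeff hI (ha I hI) (ha0 I hI)
        (K - (M + w I z).toNat)
      rw [hcast] at h1 h2
      have himg : A I = (fun u => u + w I) '' P.fan.levelSet I (a I) z (K - M - w I z) := by
        ext u
        rw [hAmem]
        constructor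
        · exact fun h => ⟨_, h, sub_add_cancel _ _⟩
        · rintro ⟨y, hy, rfl⟩
          rwa [add_sub_cancel_right]
      rw [himg]
      exact ⟨h1.image _, by rw [h2, (add_left_injective (w I)).injOn.ncard_image]⟩
    · rw [if_neg hK]
      have hemp : A I = ∅ := by
        rw [Set.eq_empty_iff_forall_notMem]
        intro u hu
        have hu' := (hAmem u).1 hu
        have h1 := P.fan.apply_eq_sum_int hI (ha I hI) (u - w I)
        rw [hu'.1] at h1
        have h2 : 0 ≤ ∑ i ∈ I, a I i * (u - w I) (P.fan.v i) := Finset.sum_nonneg fun i hi => by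
          by_cases hp : 0 < a I i
          · exact (mul_pos hp ((hu'.2 i hi).1 hp)).le
          · exact mul_nonneg_of_nonpos_of_nonpos (not_lt.1 hp)
              (not_lt.1 fun h => hp ((hu'.2 i hi).2 h))
        omega
      rw [hemp]
      simp
  set U : Finset (N →ₗ[ℤ] ℤ) := P.fan.facets.attach.biUnion fun I => (key I.1 I.2).1.toFinset
    with hU
  have hUmem : ∀ u, u ∈ U ↔ ∃ I ∈ P.fan.facets, u ∈ A I := by
    intro u
    simp [hU]
  have hDH : ∀ u, (P.shift ε).DH (1 ⊗ₜ[ℤ] z) (latticeToReal u) =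
      ∑ I ∈ P.fan.facets, (-1) ^ (I.filter fun i => 0 < a I i).card * P.fan.w I *
        (if latticeToReal u ∈ (P.shift ε).dualCone (1 ⊗ₜ[ℤ] z) I then 1 else 0) := by
    intro u
    refine Finset.sum_congr rfl fun I hI => ?_
    congr 3
    refine congrArg Finset.card (Finset.filter_congr fun i hi => ?_)
    change 0 < P.fan.dualPairing I i (1 ⊗ₜ[ℤ] z) ↔ _
    rw [SimplicialMultiFan.dualPairing_tmul, P.fan.dualVec_eq_cast hI ℝ hi, ← ha I hI i hi]
    simp
  have hR : coeff K (∑ u ∈ S, C ((P.shift ε).DH (1 ⊗ₜ[ℤ] z) (latticeToReal u) : ℂ) *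
        (X : PowerSeries ℂ) ^ (M + u z).toNat) =
      ∑ u ∈ U, ((P.shift ε).DH (1 ⊗ₜ[ℤ] z) (latticeToReal u) : ℂ) := by
    rw [map_sum]
    simp only [coeff_C_mul, coeff_X_pow, mul_ite, mul_one, mul_zero]
    rw [← Finset.sum_filter]
    -- A point of `U` outside `S` lies in some cones, but their contributions to `DH` cancel.
    refine Finset.sum_subset_zero_on_sdiff ?_ ?_ (fun _ _ => rfl)
    · intro u hu
      obtain ⟨huS, huK⟩ := Finset.mem_filter.1 hu
      have h0 := (hS u).1 huS
      rw [hDH] at h0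
      obtain ⟨I, hI, hne⟩ := Finset.exists_ne_zero_of_sum_ne_zero h0
      refine (hUmem u).2 ⟨I, hI, ?_, ?_⟩
      · by_contra hn
        rw [if_neg hn, mul_zero] at hne
        exact hne rfl
      · have := hM' u huS
        omega
    · intro u hu
      obtain ⟨huU, hun⟩ := Finset.mem_sdiff.1 hu
      obtain ⟨I, hI, hc, hlev⟩ := (hUmem u).1 huU
      by_contra hne
      refine hun (Finset.mem_filter.2 ⟨(hS u).2 (fun h => hne (by rw [h, Int.cast_zero])), ?_⟩)
      omega
  rw [hR, map_sum]
  have hcomm : ∑ u ∈ U, ((P.shift ε).DH (1 ⊗ₜ[ℤ] z) (latticeToReal u) : ℂ) =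
      ∑ I ∈ P.fan.facets, ∑ u ∈ U, (((-1) ^ (I.filter fun i => 0 < a I i).card * P.fan.w I *
        (if latticeToReal u ∈ (P.shift ε).dualCone (1 ⊗ₜ[ℤ] z) I then 1 else 0) : ℤ) : ℂ) := by
    rw [Finset.sum_comm]
    exact Finset.sum_congr rfl fun u _ => by rw [hDH, Int.cast_sum]
  rw [hcomm]
  refine Finset.sum_congr rfl fun I hI => ?_
  rw [coeff_C_mul, (key I hI).2, ← Int.cast_sum, ← Finset.mul_sum, Finset.sum_boole]
  have hcard : (U.filter fun u => latticeToReal u ∈ (P.shift ε).dualCone (1 ⊗ₜ[ℤ] z) I).card =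
      (A I).ncard := by
    rw [← Set.ncard_coe_finset]
    congr 1
    ext u
    rw [Finset.coe_filter, Set.mem_ofPred_eq, hUmem]
    constructor
    · rintro ⟨⟨J, hJ, hu⟩, hc⟩
      exact ⟨hc, hu.2⟩
    · exact fun h => ⟨⟨I, hI, h⟩, h.1⟩
  rw [hcard]
  have hG : (Nat.card (P.fan.G I) : ℂ) ≠ 0 := Nat.cast_ne_zero.2 (P.fan.natCard_G_ne_zero hI)
  push_cast
  field_simp

open PowerSeries in
/-- The fixed point formula for the lattice points of a multi-polytope along a one-parameter
subgroup. -/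
theorem exists_sum_rescale_toddSeries {P : SimpleMultiPolytope N ι} (hP : P.IsLattice)
    {z : N} {a : Finset ι → ι → ℤ}
    (ha : ∀ I ∈ P.fan.facets, ∀ i ∈ I, (a I i : ℚ) = P.fan.dualVec ℚ I i z)
    (ha0 : ∀ I ∈ P.fan.facets, ∀ i ∈ I, a I i ≠ 0) :
    ∃ R : PowerSeries ℂ,
      ∑ I ∈ P.fan.facets, C ((P.fan.w I : ℂ) / (Nat.card (P.fan.G I) * ∏ i ∈ I, (a I i : ℂ))) *
        (rescale (∑ i ∈ I, (P.c i : ℂ) * a I i) (exp ℂ) *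
        ∑ g ∈ P.fan.groupFinset I, ∏ i ∈ I,
          rescale (a I i : ℂ) (toddSeries (SimplicialMultiFan.rho i g))) =
        X ^ Module.finrank ℤ N * R ∧
      ∀ ε : ι → ℝ, (∀ i, 0 < ε i ∧ ε i < 1) →
        constantCoeff R = ((P.sharp (1 ⊗ₜ[ℤ] z) ε : ℤ) : ℂ) := by
  classical
  have hz : P.fan.IsRegular z := fun I hI i hi => by
    rw [← ha I hI i hi]; exact Int.cast_ne_zero.2 (ha0 I hI i hi)
  have hgen := hz.isGeneric P.complete
  have hw' : ∀ I, ∃ u : N →ₗ[ℤ] ℤ, I ∈ P.fan.facets → ∀ i ∈ I, latticeToReal u ∈ P.hyperplane i := by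
    intro I
    by_cases hI : I ∈ P.fan.facets
    · obtain ⟨u, hu⟩ := hP I hI
      exact ⟨u, fun _ => hu⟩
    · exact ⟨0, fun h => absurd h hI⟩
  choose w hw using hw'
  have main : ∀ ε : ι → ℝ, (∀ i, 0 < ε i ∧ ε i < 1) → ∃ R : PowerSeries ℂ,
      ∑ I ∈ P.fan.facets, C ((P.fan.w I : ℂ) / (Nat.card (P.fan.G I) * ∏ i ∈ I, (a I i : ℂ))) *
        (rescale (∑ i ∈ I, (P.c i : ℂ) * a I i) (exp ℂ) *
        ∑ g ∈ P.fan.groupFinset I, ∏ i ∈ I,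
          rescale (a I i : ℂ) (toddSeries (SimplicialMultiFan.rho i g))) =
        X ^ Module.finrank ℤ N * R ∧
        constantCoeff R = ((P.sharp (1 ⊗ₜ[ℤ] z) ε : ℤ) : ℂ) := by
    intro ε hε
    have hfin : {u : N →ₗ[ℤ] ℤ | (P.shift ε).DH (1 ⊗ₜ[ℤ] z) (latticeToReal u) ≠ 0}.Finite :=
      (P.shift ε).finite_support_DH hgen (hP.shift_ne hε)
    set S := hfin.toFinset with hS
    have hSmem : ∀ u, u ∈ S ↔ (P.shift ε).DH (1 ⊗ₜ[ℤ] z) (latticeToReal u) ≠ 0 := fun u => by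
      rw [hS, Set.Finite.mem_toFinset]; rfl
    set M : ℤ := ∑ I ∈ P.fan.facets, |w I z| + ∑ u ∈ S, |u z| with hMdef
    have hM : ∀ I ∈ P.fan.facets, 0 ≤ M + w I z := by
      intro I hI
      have h1 := Finset.single_le_sum (f := fun I => |w I z|) (fun _ _ => abs_nonneg _) hI
      have h2 : 0 ≤ ∑ u ∈ S, |u z| := Finset.sum_nonneg fun _ _ => abs_nonneg _
      have h3 := neg_abs_le (w I z)
      linarith
    have hM' : ∀ u ∈ S, 0 ≤ M + u z := by
      intro u hu
      have h1 := Finset.single_le_sum (f := fun u : N →ₗ[ℤ] ℤ => |u z|)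
        (fun _ _ => abs_nonneg _) hu
      have h2 : 0 ≤ ∑ I ∈ P.fan.facets, |w I z| := Finset.sum_nonneg fun _ _ => abs_nonneg _
      have h3 := neg_abs_le (u z)
      linarith
    have hq := sum_coneSeries hP hε ha ha0 (fun I hI => hw I hI) S hSmem M hM hM'
    set s : Finset (Σ _ : Finset ι, ι → UnitAddCircle) :=
      P.fan.facets.sigma fun I => P.fan.groupFinset I with hs
    set n : (Σ _ : Finset ι, ι → UnitAddCircle) → Polynomial ℂ := fun k =>
      Polynomial.C ((-1) ^ (k.1.filter fun i => 0 < a k.1 i).card * (P.fan.w k.1 : ℂ) /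
        Nat.card (P.fan.G k.1)) * (Polynomial.X ^ (M + w k.1 z).toNat *
        ∏ i ∈ k.1, coneNum (a k.1 i) (SimplicialMultiFan.rho i k.2)) with hn
    set d : (Σ _ : Finset ι, ι → UnitAddCircle) → Polynomial ℂ := fun k =>
        ∏ i ∈ k.1, coneDen (a k.1 i) (SimplicialMultiFan.rho i k.2) with hd
    set F : (Σ _ : Finset ι, ι → UnitAddCircle) → PowerSeries ℂ := fun k =>
      C ((-1) ^ (k.1.filter fun i => 0 < a k.1 i).card * (P.fan.w k.1 : ℂ) /
        Nat.card (P.fan.G k.1)) * (X ^ (M + w k.1 z).toNat *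
        ∏ i ∈ k.1, coneSeries (a k.1 i) (SimplicialMultiFan.rho i k.2)) with hF
    set H : (Σ _ : Finset ι, ι → UnitAddCircle) → PowerSeries ℂ := fun k =>
      C ((P.fan.w k.1 : ℂ) / (Nat.card (P.fan.G k.1) * ∏ i ∈ k.1, (a k.1 i : ℂ))) *
        (rescale (((M + w k.1 z : ℤ)) : ℂ) (exp ℂ) * ∏ i ∈ k.1,
          rescale (a k.1 i : ℂ) (toddSeries (SimplicialMultiFan.rho i k.2))) with hH
    set q : Polynomial ℂ := ∑ u ∈ S,
      Polynomial.C ((P.shift ε).DH (1 ⊗ₜ[ℤ] z) (latticeToReal u) : ℂ) *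
        Polynomial.X ^ (M + u z).toNat with hqdef
    have hcoe : ∀ m : ℤ, 0 ≤ m → expSubst (Polynomial.X ^ m.toNat) = rescale (m : ℂ) (exp ℂ) := by
      intro m hm
      rw [expSubst_X_pow]
      have h1 := congrArg (Int.cast : ℤ → ℂ) (Int.toNat_of_nonneg hm)
      rw [Int.cast_natCast] at h1
      rw [h1]
    -- The infinite cone series cannot be evaluated at `q = e^t`, whose constant term is `1`. The
    -- identity is therefore read as one between polynomial fractions and transferred; the factor
    -- `t^n` absorbs the poles at `t = 0`.
    have htrans := sum_eq_of_sum_fractions (Polynomial.coeToPowerSeries.ringHom (R := ℂ))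
      (Polynomial.coe_injective ℂ) (expSubst : Polynomial ℂ →+* PowerSeries ℂ) s n d F H
      (X ^ Module.finrank ℤ N) q ?_ ?_ ?_ ?_
    · refine ⟨∑ u ∈ S, C ((P.shift ε).DH (1 ⊗ₜ[ℤ] z) (latticeToReal u) : ℂ) *
        rescale ((u z : ℤ) : ℂ) (exp ℂ), ?_, ?_⟩
      · have hinv : rescale (-(M : ℂ)) (exp ℂ) * rescale (M : ℂ) (exp ℂ) = 1 := by
          rw [exp_mul_exp_eq_exp_add, neg_add_cancel, rescale_zero]; simp
        have hqe : (expSubst : Polynomial ℂ →+* PowerSeries ℂ) q = rescale (M : ℂ) (exp ℂ) *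
            ∑ u ∈ S, C ((P.shift ε).DH (1 ⊗ₜ[ℤ] z) (latticeToReal u) : ℂ) *
              rescale ((u z : ℤ) : ℂ) (exp ℂ) := by
          rw [hqdef, map_sum, Finset.mul_sum]
          refine Finset.sum_congr rfl fun u hu => ?_
          change expSubst _ = _
          rw [map_mul, expSubst_C, hcoe _ (hM' u hu), mul_left_comm, exp_mul_exp_eq_exp_add,
            Int.cast_add]
        have hHe : ∑ k ∈ s, H k = rescale (M : ℂ) (exp ℂ) * ∑ I ∈ P.fan.facets,
            C ((P.fan.w I : ℂ) / (Nat.card (P.fan.G I) * ∏ i ∈ I, (a I i : ℂ))) *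
            (rescale (∑ i ∈ I, (P.c i : ℂ) * a I i) (exp ℂ) *
            ∑ g ∈ P.fan.groupFinset I, ∏ i ∈ I,
              rescale (a I i : ℂ) (toddSeries (SimplicialMultiFan.rho i g))) := by
          rw [hs, Finset.sum_sigma, Finset.mul_sum]
          refine Finset.sum_congr rfl fun I hI => ?_
          have hwz : ((w I z : ℤ) : ℂ) = ∑ i ∈ I, (P.c i : ℂ) * a I i := by
            rw [P.fan.apply_eq_sum_int hI (ha I hI), Int.cast_sum]
            refine Finset.sum_congr rfl fun i hi => ?_
            have h1 : ((w I (P.fan.v i) : ℤ) : ℝ) = P.c i := hw I hI i hi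
            rw [← h1]
            push_cast
            ring
          rw [mul_left_comm, ← mul_assoc (rescale (M : ℂ) (exp ℂ)), exp_mul_exp_eq_exp_add,
            ← hwz, ← Int.cast_add, Finset.mul_sum, Finset.mul_sum]
        rw [hqe, hHe] at htrans
        have := congrArg (rescale (-(M : ℂ)) (exp ℂ) * ·) htrans
        rw [mul_left_comm (X ^ Module.finrank ℤ N), ← mul_assoc, ← mul_assoc, hinv, one_mul,
          one_mul] at this
        exact this
      · rw [map_sum]
        simp only [map_mul, constantCoeff_C]
        have hc1 : ∀ r : ℂ, constantCoeff (rescale r (exp ℂ)) = 1 := fun r => by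
          rw [← coeff_zero_eq_constantCoeff_apply, coeff_rescale]; simp
        simp only [hc1, mul_one]
        rw [sharp, finsum_eq_sum_of_support_subset (s := S), Int.cast_sum]
        intro u hu
        exact (hSmem u).2 hu
    · intro k hk
      have hI := (Finset.mem_sigma.1 hk).1
      simp only [hF, hd, hn, map_mul, map_prod, map_pow,
        Polynomial.coeToPowerSeries.ringHom_apply, Polynomial.coe_C, Polynomial.coe_X]
      rw [mul_assoc, mul_assoc, ← Finset.prod_mul_distrib]
      congr 2
      exact Finset.prod_congr rfl fun i hi =>
        coneSeries_mul_coneDen (ha0 _ hI i hi) (rho_ne_zero i k.2)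
    · intro k hk
      have hI := (Finset.mem_sigma.1 hk).1
      change H k * expSubst (d k) = X ^ _ * expSubst (n k)
      simp only [hH, hd, hn, map_mul expSubst, map_prod expSubst, expSubst_C, hcoe _ (hM _ hI)]
      rw [mul_assoc, mul_assoc, ← Finset.prod_mul_distrib,
        Finset.prod_congr rfl fun i hi =>
          rescale_toddSeries_mul_coneDen (ha0 _ hI i hi) (rho_ne_zero i k.2),
        Finset.prod_mul_distrib, Finset.prod_mul_distrib, Finset.prod_const,
        P.fan.card_of_mem_facets hI, ← map_prod, Finset.prod_mul_distrib]
      have hsgn : ∏ i ∈ k.1, (if 0 < a k.1 i then (-1 : ℂ) else 1) =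
          (-1) ^ (k.1.filter fun i => 0 < a k.1 i).card := by
        rw [Finset.prod_ite, Finset.prod_const, Finset.prod_const_one, mul_one]
      have hcst : (C ((P.fan.w k.1 : ℂ) / (Nat.card (P.fan.G k.1) * ∏ i ∈ k.1, (a k.1 i : ℂ))) :
          PowerSeries ℂ) * C ((∏ i ∈ k.1, (if 0 < a k.1 i then (-1 : ℂ) else 1)) *
            ∏ i ∈ k.1, (a k.1 i : ℂ)) =
          C ((-1) ^ (k.1.filter fun i => 0 < a k.1 i).card * (P.fan.w k.1 : ℂ) /
            Nat.card (P.fan.G k.1)) := by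
        rw [hsgn, ← map_mul]
        congr 1
        have h1 : ∏ i ∈ k.1, (a k.1 i : ℂ) ≠ 0 := Finset.prod_ne_zero_iff.2 fun i hi =>
          Int.cast_ne_zero.2 (ha0 _ hI i hi)
        field_simp
      rw [← hcst]
      ring
    · intro k hk
      have hI := (Finset.mem_sigma.1 hk).1
      change expSubst (d k) ≠ 0
      simp only [hd, map_prod]
      exact Finset.prod_ne_zero_iff.2 fun i hi =>
        expSubst_coneDen_ne_zero (ha0 _ hI i hi) (rho_ne_zero i k.2)
    · rw [hs, Finset.sum_sigma, Polynomial.coeToPowerSeries.ringHom_apply, hqdef]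
      simp only [hF, ← Finset.mul_sum]
      rw [hq, ← Polynomial.coeToPowerSeries.ringHom_apply, map_sum]
      refine Finset.sum_congr rfl fun u _ => ?_
      rw [Polynomial.coeToPowerSeries.ringHom_apply, Polynomial.coe_mul, Polynomial.coe_C,
        Polynomial.coe_pow, Polynomial.coe_X]
  -- The localization sum does not involve `ε`, so cancelling `t^n` shows that one `R` serves all
  -- admissible shifts.
  obtain ⟨R, hR, -⟩ := main (fun _ => 1 / 2) fun _ => by norm_num
  refine ⟨R, hR, fun ε hε => ?_⟩
  obtain ⟨R', hR', hc⟩ := main ε hε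
  rw [hR] at hR'
  rw [← hc, mul_left_cancel₀ (pow_ne_zero _ X_ne_zero) hR']

end SimpleMultiPolytope

/-! ### Lowest-order terms of the series -/

section Series

open PowerSeries

theorem constantCoeff_rescale {R : Type*} [CommRing R] (r : R) (f : PowerSeries R) :
    constantCoeff (rescale r f) = constantCoeff f := by
  rw [← coeff_zero_eq_constantCoeff_apply, coeff_rescale, pow_zero, one_mul,
    coeff_zero_eq_constantCoeff_apply]

open scoped Classical in
theorem constantCoeff_toddSeries (z : ℂ) :
    constantCoeff (toddSeries z) = if z = 1 then 1 else 0 := by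
  rw [toddSeries]
  split_ifs with hz
  · rw [constantCoeff_inv, ← coeff_zero_eq_constantCoeff_apply, coeff_mk, toddDenom, hz]
    simp [coeff_rescale, coeff_exp, coeff_one]
  · rw [map_mul, constantCoeff_X, zero_mul]

theorem prod_rescale_exp {κ : Type*} (s : Finset κ) (r : κ → ℂ) :
    ∏ i ∈ s, rescale (r i) (exp ℂ) = rescale (∑ i ∈ s, r i) (exp ℂ) := by
  classical
  induction s using Finset.induction_on with
  | empty => rw [Finset.prod_empty, Finset.sum_empty, rescale_zero]; simp
  | insert i s hi ih => rw [Finset.prod_insert hi, Finset.sum_insert hi, ih, exp_mul_exp_eq_exp_add]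

theorem rescale_exp_sub_one (r : ℂ) :
    ∃ f : PowerSeries ℂ, rescale r (exp ℂ) - 1 = X * f ∧ constantCoeff f = r := by
  refine ⟨mk fun k => coeff (k + 1) (rescale r (exp ℂ)), ?_, ?_⟩
  · ext k
    cases k with
    | zero => simp [constantCoeff_rescale]
    | succ k => rw [coeff_succ_X_mul, coeff_mk, map_sub, coeff_one, if_neg (Nat.succ_ne_zero k),
        sub_zero]
  · rw [← coeff_zero_eq_constantCoeff_apply, coeff_mk, coeff_rescale]
    simp [coeff_exp]

end Series

/-! ### Vanishing of localization sums in low degree -/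

namespace SimplicialMultiFan

variable {N : Type*} [AddCommGroup N] [Module.Free ℤ N] [Module.Finite ℤ N]
  {ι : Type*} [Fintype ι] (Δ : SimplicialMultiFan N ι)

/-- The vertex at `I` is `∑_{i ∈ I ∩ S} D u_i^I`, integral by the choice of `D`. These auxiliary
multi-polytopes feed the lattice-point identity back into the study of `π_!`. -/
theorem isLattice_of_denominator {N : Type*} [AddCommGroup N] {ι : Type*} [DecidableEq ι]
    (Δ : SimplicialMultiFan N ι) (hΔ : Δ.IsComplete) {D : ℤ}
    (hD : ∀ I i, ∃ u : N →ₗ[ℤ] ℤ, ∀ x, (u x : ℚ) = D * Δ.dualVec ℚ I i x) (S : Finset ι) :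
    ({ fan := Δ, complete := hΔ, c := fun i => if i ∈ S then (D : ℝ) else 0 } :
      SimpleMultiPolytope N ι).IsLattice := by
  intro I hI
  have hF := Δ.mem_faces_of_mem_facets hI
  choose u hu using hD I
  refine ⟨∑ i ∈ I ∩ S, u i, fun j hj => ?_⟩
  change (((∑ i ∈ I ∩ S, u i) (Δ.v j) : ℤ) : ℝ) = if j ∈ S then (D : ℝ) else 0
  have h1 : ∀ i, u i (Δ.v j) = if j = i then D else 0 := fun i => by
    have := hu i (Δ.v j)
    rw [Δ.dualVec_apply ℚ hF i hj] at this
    split_ifs at this ⊢ with h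
    · rw [mul_one] at this; exact_mod_cast this
    · rw [mul_zero] at this; exact_mod_cast this
  rw [LinearMap.sum_apply, Finset.sum_congr rfl fun i _ => h1 i, Finset.sum_ite_eq]
  simp only [Finset.mem_inter, hj, true_and]
  split_ifs <;> simp

open PowerSeries in
-- The Todd series has constant term `0` unless `ρ = 1`, so only the identity of `G_I` contributes.
theorem constantCoeff_sum_prod_toddSeries {N : Type*} [AddCommGroup N] [Module.Finite ℤ N]
    {ι : Type*} [Fintype ι] (Δ : SimplicialMultiFan N ι) (I : Finset ι) (hI : I ∈ Δ.facets) (a : ι → ℂ) :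
    constantCoeff (∑ g ∈ Δ.groupFinset I, ∏ i ∈ I, rescale (a i) (toddSeries (rho i g))) = 1 := by
  classical
  rw [map_sum, Finset.sum_eq_single (0 : ι → UnitAddCircle)]
  · rw [map_prod]
    refine Finset.prod_eq_one fun i _ => ?_
    rw [constantCoeff_rescale, constantCoeff_toddSeries, if_pos ((rho_eq_one_iff i _).2 rfl)]
  · intro g hg hg0
    obtain ⟨i, hi⟩ := Function.ne_iff.1 hg0
    have hiI : i ∈ I := by
      by_contra h
      exact hi ((Finset.mem_filter.1 hg).2 i h)
    rw [map_prod]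
    refine Finset.prod_eq_zero hiI ?_
    rw [constantCoeff_rescale, constantCoeff_toddSeries, if_neg fun h => hi ((rho_eq_one_iff i g).1 h)]
  · exact fun h => absurd ((Δ.mem_groupFinset_iff hI).2 (zero_mem _)) h

open PowerSeries in
/-- The localization sum of a square-free monomial of degree less than `n` vanishes. -/
theorem sum_localization_eq_zero (hΔ : Δ.IsComplete) {z : N} {a : Finset ι → ι → ℤ}
    (ha : ∀ I ∈ Δ.facets, ∀ i ∈ I, (a I i : ℚ) = Δ.dualVec ℚ I i z)
    (ha0 : ∀ I ∈ Δ.facets, ∀ i ∈ I, a I i ≠ 0) {L : Finset ι}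
    (hL : L.card < Module.finrank ℤ N) [DecidableEq ι] :
    ∑ I ∈ Δ.facets, (Δ.w I : ℂ) / (Nat.card (Δ.G I) * ∏ i ∈ I, (a I i : ℂ)) *
      ∏ i ∈ L, (if i ∈ I then (a I i : ℂ) else 0) = 0 := by
  obtain ⟨D, hD0, hD⟩ := Δ.exists_common_denominator
  set α : Finset ι → ℂ := fun I => (Δ.w I : ℂ) / (Nat.card (Δ.G I) * ∏ i ∈ I, (a I i : ℂ)) with hα
  set T : Finset ι → PowerSeries ℂ := fun I => ∑ g ∈ Δ.groupFinset I, ∏ i ∈ I,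
    rescale (a I i : ℂ) (toddSeries (rho i g)) with hT
  set r : Finset ι → ι → ℂ := fun I i => if i ∈ I then (D : ℂ) * a I i else 0 with hr
  have hdvd : ∀ S : Finset ι, (X : PowerSeries ℂ) ^ Module.finrank ℤ N ∣
      ∑ I ∈ Δ.facets, C (α I) * (rescale (∑ i ∈ S, r I i) (exp ℂ) * T I) := by
    intro S
    obtain ⟨R, hR, -⟩ := SimpleMultiPolytope.exists_sum_rescale_toddSeries
      (Δ.isLattice_of_denominator hΔ hD S) ha ha0
    refine ⟨R, ?_⟩
    rw [← hR]
    refine Finset.sum_congr rfl fun I _ => ?_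
    congr 4
    have h1 : ∀ i, ((if i ∈ S then (D : ℝ) else 0 : ℝ) : ℂ) * a I i =
        if i ∈ S then (D : ℂ) * a I i else 0 := fun i => by split_ifs <;> simp
    simp only [h1, hr]
    rw [Finset.sum_ite_mem, Finset.sum_ite_mem, Finset.inter_comm]
  choose f hf hfc using fun (I : Finset ι) (i : ι) => rescale_exp_sub_one (r I i)
  -- The alternating sum over `S` is the expansion of `∏_{i ∈ L} (e^{r_i t} - 1)`, and every factor
  -- is divisible by `t`.
  have hprod : ∀ I, ∑ S ∈ L.powerset, (-1) ^ (L \ S).card * rescale (∑ i ∈ S, r I i) (exp ℂ) =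
      X ^ L.card * ∏ i ∈ L, f I i := by
    intro I
    rw [← Finset.prod_const, ← Finset.prod_mul_distrib,
      ← Finset.prod_congr rfl fun i _ => hf I i]
    simp only [sub_eq_add_neg]
    rw [Finset.prod_add]
    refine Finset.sum_congr rfl fun S _ => ?_
    rw [prod_rescale_exp, Finset.prod_const, mul_comm]
  have hsum : (X : PowerSeries ℂ) ^ Module.finrank ℤ N ∣
      X ^ L.card * ∑ I ∈ Δ.facets, C (α I) * ((∏ i ∈ L, f I i) * T I) := by
    have h1 := Finset.dvd_sum (s := L.powerset) fun S _ => (hdvd S).mul_left ((-1) ^ (L \ S).card)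
    convert h1 using 1
    simp only [Finset.mul_sum]
    rw [Finset.sum_comm]
    refine Finset.sum_congr rfl fun I _ => ?_
    have h2 : X ^ L.card * (C (α I) * ((∏ i ∈ L, f I i) * T I)) =
        C (α I) * ((X ^ L.card * ∏ i ∈ L, f I i) * T I) := by ring
    rw [h2, ← hprod, Finset.sum_mul, Finset.mul_sum]
    exact Finset.sum_congr rfl fun S _ => by ring
  obtain ⟨R, hR⟩ := hsum
  -- Cancelling `t^{|L|}` leaves at least one factor `t`, so the constant term is zero. That term is
  -- `D^{|L|}` times the sum in question.
  have hlt : Module.finrank ℤ N = L.card + (Module.finrank ℤ N - L.card - 1 + 1) := by omega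
  rw [hlt, pow_add, mul_assoc] at hR
  have h0 := congrArg constantCoeff (mul_left_cancel₀ (pow_ne_zero _ X_ne_zero) hR)
  rw [map_mul, map_pow, constantCoeff_X, pow_succ, mul_zero, zero_mul, map_sum] at h0
  have h3 : ∀ I ∈ Δ.facets, constantCoeff (C (α I) * ((∏ i ∈ L, f I i) * T I)) =
      (D : ℂ) ^ L.card * (α I * ∏ i ∈ L, (if i ∈ I then (a I i : ℂ) else 0)) := by
    intro I hI
    rw [map_mul, map_mul, map_prod, constantCoeff_C, hT,
      Δ.constantCoeff_sum_prod_toddSeries I hI, mul_one, mul_left_comm]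
    congr 1
    rw [← Finset.prod_const, ← Finset.prod_mul_distrib]
    refine Finset.prod_congr rfl fun i _ => ?_
    rw [hfc, hr]
    by_cases hi : i ∈ I <;> simp [hi]
  rw [Finset.sum_congr rfl h3, ← Finset.mul_sum] at h0
  exact (mul_eq_zero.1 h0).resolve_left (pow_ne_zero _ (Int.cast_ne_zero.2 hD0.ne'))

end SimplicialMultiFan

/-! ### Integrality of the index map -/

namespace SimplicialMultiFan

variable {N : Type*} [AddCommGroup N] {ι : Type*} (Δ : SimplicialMultiFan N ι)

open scoped Classical in
/-- The homomorphism `x_i ↦ u_i^I` (`i ∈ I`), `x_i ↦ 0` (`i ∉ I`) on polynomials. -/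
def restrictPoly (K : Type*) [Field K] (I : Finset ι) : MvPolynomial ι K →ₐ[K] HBT N K :=
  MvPolynomial.aeval fun i => if i ∈ I then SymmetricAlgebra.ι K _ (Δ.dualVec K I i) else 0

theorem restrict_mk (K : Type*) [Field K] {I : Finset ι} (hI : I ∈ Δ.faces)
    (x : MvPolynomial ι K) :
    Δ.restrict K I hI (Ideal.Quotient.mk _ x) = Δ.restrictPoly K I x := rfl

theorem restrictPoly_C (K : Type*) [Field K] (I : Finset ι) (c : K) :
    Δ.restrictPoly K I (MvPolynomial.C c) = algebraMap K _ c := by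
  rw [restrictPoly, MvPolynomial.algHom_C]

open scoped Classical in
theorem restrictPoly_X (K : Type*) [Field K] (I : Finset ι) (i : ι) :
    Δ.restrictPoly K I (MvPolynomial.X i) =
      if i ∈ I then SymmetricAlgebra.ι K _ (Δ.dualVec K I i) else 0 := by
  rw [restrictPoly, MvPolynomial.aeval_X]

open scoped Classical in
theorem restrictPoly_prod_X (K : Type*) [Field K] (I L : Finset ι) :
    Δ.restrictPoly K I (∏ i ∈ L, MvPolynomial.X i) =
      ∏ i ∈ L, if i ∈ I then SymmetricAlgebra.ι K _ (Δ.dualVec K I i) else 0 := by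
  rw [map_prod]
  exact Finset.prod_congr rfl fun i _ => Δ.restrictPoly_X K I i

theorem card_le_of_mem_faces (hΔ : Δ.IsComplete) {L : Finset ι} (hL : L ∈ Δ.faces) :
    L.card ≤ Module.finrank ℤ N := by
  obtain ⟨I, hI, hLI⟩ := (hΔ L hL).1
  rw [← Δ.card_of_mem_facets hI]
  exact Finset.card_le_card hLI

variable [Fintype ι]

/-- The denominator of the contribution of `I` to `π_!`. -/
def gysinDen (I : Finset ι) : HBT N ℂ :=
  (Nat.card (Δ.G I) : HBT N ℂ) * ∏ i ∈ I, SymmetricAlgebra.ι ℂ _ (Δ.dualVec ℂ I i)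

theorem gysin_mk (x : MvPolynomial ι ℂ) :
    Δ.gysin ℂ (Ideal.Quotient.mk _ x) =
      ∑ I ∈ Δ.facets, algebraMap (HBT N ℂ) (FractionRing (HBT N ℂ)) (Δ.w I * Δ.restrictPoly ℂ I x) /
        algebraMap (HBT N ℂ) (FractionRing (HBT N ℂ)) (Δ.gysinDen I) := by
  rw [gysin, ← Finset.sum_coe_sort Δ.facets]
  refine Finset.sum_congr rfl fun I _ => ?_
  rw [restrict_mk, gysinDen, map_mul, map_mul, map_intCast, map_natCast, map_prod]

theorem gysin_add (x y : MvPolynomial ι ℂ) : Δ.gysin ℂ (Ideal.Quotient.mk _ (x + y)) =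
    Δ.gysin ℂ (Ideal.Quotient.mk _ x) + Δ.gysin ℂ (Ideal.Quotient.mk _ y) := by
  rw [gysin_mk, gysin_mk, gysin_mk, ← Finset.sum_add_distrib]
  refine Finset.sum_congr rfl fun I _ => ?_
  rw [map_add (Δ.restrictPoly ℂ I), mul_add, map_add, add_div]

/-- An element with the same restriction to all facets is a scalar from `H^*(BT)`, and `π_!` is
linear over these. Constants and the elements `∑ u(v_i) x_i` are the cases needed. -/
theorem gysin_mul_of_restrictPoly {x : MvPolynomial ι ℂ} {p : HBT N ℂ}
    (h : ∀ I ∈ Δ.facets, Δ.restrictPoly ℂ I x = p) (y : MvPolynomial ι ℂ) :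
    Δ.gysin ℂ (Ideal.Quotient.mk _ (x * y)) =
      algebraMap (HBT N ℂ) (FractionRing (HBT N ℂ)) p * Δ.gysin ℂ (Ideal.Quotient.mk _ y) := by
  rw [gysin_mk, gysin_mk, Finset.mul_sum]
  refine Finset.sum_congr rfl fun I hI => ?_
  rw [map_mul (Δ.restrictPoly ℂ I), h I hI]
  simp only [map_mul]
  ring

/-- The element `∑ u(v_i) x_i` for a complex linear form `u`. -/
def complexLinearForm (u : N →ₗ[ℤ] ℂ) : MvPolynomial ι ℂ :=
  ∑ i, MvPolynomial.C (u (Δ.v i)) * MvPolynomial.X i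

theorem restrictPoly_complexLinearForm [Module.Free ℤ N] [Module.Finite ℤ N] {I : Finset ι}
    (hI : I ∈ Δ.facets) (u : N →ₗ[ℤ] ℂ) :
    Δ.restrictPoly ℂ I (Δ.complexLinearForm u) = SymmetricAlgebra.ι ℂ _ u := by
  classical
  conv_rhs => rw [Δ.hom_eq_sum_dualVec hI u]
  simp only [complexLinearForm, map_sum, map_mul, restrictPoly_C, restrictPoly_X, mul_ite,
    mul_zero, Finset.sum_ite_mem, Finset.univ_inter, map_smul, Algebra.smul_def]

variable [Module.Free ℤ N] [Module.Finite ℤ N]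

theorem gysinDen_ne_zero {I : Finset ι} (hI : I ∈ Δ.facets) : Δ.gysinDen I ≠ 0 := by
  refine mul_ne_zero ?_ (Finset.prod_ne_zero_iff.2 fun i hi h => ?_)
  · rw [← map_natCast (algebraMap ℂ (HBT N ℂ)), Ne, SymmetricAlgebra.algebraMap_eq_zero_iff]
    exact Nat.cast_ne_zero.2 (Δ.natCard_G_ne_zero hI)
  · exact Δ.dualVec_ne_zero ℂ (Δ.mem_faces_of_mem_facets hI) hi
      (symmetricAlgebra_ι_injective ℂ (h.trans (map_zero _).symm))

/-- At regular points the cleared numerator vanishes by `sum_localization_eq_zero`; density of `D •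
N` makes it zero as a polynomial. -/
theorem gysin_prod_X_of_card_lt (hΔ : Δ.IsComplete) {L : Finset ι}
    (hL : L.card < Module.finrank ℤ N) :
    Δ.gysin ℂ (Ideal.Quotient.mk _ (∏ i ∈ L, MvPolynomial.X i)) = 0 := by
  classical
  obtain ⟨D, hD0, hD⟩ := Δ.exists_common_denominator
  choose u hu using hD
  set x : MvPolynomial ι ℂ := ∏ i ∈ L, MvPolynomial.X i with hx
  set p : HBT N ℂ := ∑ I ∈ Δ.facets, (Δ.w I * Δ.restrictPoly ℂ I x) *
    ∏ J ∈ Δ.facets.erase I, Δ.gysinDen J with hp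
  have hmap : Δ.gysin ℂ (Ideal.Quotient.mk _ x) *
      algebraMap (HBT N ℂ) (FractionRing (HBT N ℂ)) (∏ J ∈ Δ.facets, Δ.gysinDen J) =
      algebraMap (HBT N ℂ) (FractionRing (HBT N ℂ)) p := by
    rw [gysin_mk, hp, map_sum, Finset.sum_mul]
    refine Finset.sum_congr rfl fun I hI => ?_
    have h0 : algebraMap (HBT N ℂ) (FractionRing (HBT N ℂ)) (Δ.gysinDen I) ≠ 0 := by
      rw [Ne, IsFractionRing.to_map_eq_zero_iff]
      exact Δ.gysinDen_ne_zero hI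
    have h1 : ∀ q r : HBT N ℂ, algebraMap (HBT N ℂ) (FractionRing (HBT N ℂ)) q /
        algebraMap _ _ (Δ.gysinDen I) * algebraMap _ _ (Δ.gysinDen I * r) =
        algebraMap _ _ (q * r) := fun q r => by
      rw [map_mul, map_mul, ← mul_assoc, div_mul_cancel₀ _ h0]
    rw [← Finset.mul_prod_erase _ _ hI, h1]
  have hp0 : p = 0 := by
    -- The factor `wallProd` covers the points where the localization sum has a vanishing
    -- denominator.
    have hpw : p * Δ.wallProd ℂ = 0 := by
      refine eq_zero_of_evalAt_smul_eq_zero hD0.ne' fun z => ?_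
      rw [map_mul]
      by_cases hreg : Δ.IsRegular (D • z)
      · have ha : ∀ I ∈ Δ.facets, ∀ i ∈ I, ((u I i z : ℤ) : ℚ) = Δ.dualVec ℚ I i (D • z) := by
          intro I _ i _
          rw [hu, map_smul, zsmul_eq_mul]
        have ha0 : ∀ I ∈ Δ.facets, ∀ i ∈ I, u I i z ≠ 0 := by
          intro I hI i hi h
          have := ha I hI i hi
          rw [h, Int.cast_zero] at this
          exact hreg I hI i hi this.symm
        have hac : ∀ I ∈ Δ.facets, ∀ i ∈ I,
            Δ.dualVec ℂ I i (D • z) = ((u I i z : ℤ) : ℂ) := by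
          intro I hI i hi
          rw [Δ.dualVec_eq_cast hI ℂ hi, ← ha I hI i hi, Rat.cast_intCast]
        have hden : ∀ I ∈ Δ.facets, evalAt ℂ (D • z) (Δ.gysinDen I) =
            Nat.card (Δ.G I) * ∏ i ∈ I, ((u I i z : ℤ) : ℂ) := by
          intro I hI
          rw [gysinDen, map_mul, map_natCast, map_prod]
          congr 1
          exact Finset.prod_congr rfl fun i hi => by rw [evalAt_ι, hac I hI i hi]
        have hden0 : ∀ I ∈ Δ.facets, evalAt ℂ (D • z) (Δ.gysinDen I) ≠ 0 := by
          intro I hI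
          rw [hden I hI]
          exact mul_ne_zero (Nat.cast_ne_zero.2 (Δ.natCard_G_ne_zero hI))
            (Finset.prod_ne_zero_iff.2 fun i hi => Int.cast_ne_zero.2 (ha0 I hI i hi))
        have hpz : evalAt ℂ (D • z) p = 0 := by
          have hv := congrArg (· * ∏ J ∈ Δ.facets, evalAt ℂ (D • z) (Δ.gysinDen J))
            (Δ.sum_localization_eq_zero hΔ ha ha0 hL)
          rw [zero_mul, Finset.sum_mul] at hv
          rw [hp, map_sum, ← hv]
          refine Finset.sum_congr rfl fun I hI => ?_
          have h1 : evalAt ℂ (D • z) (Δ.restrictPoly ℂ I x) =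
              ∏ i ∈ L, if i ∈ I then ((u I i z : ℤ) : ℂ) else 0 := by
            rw [hx, restrictPoly_prod_X, map_prod]
            refine Finset.prod_congr rfl fun i _ => ?_
            split_ifs with hi
            · rw [evalAt_ι, hac I hI i hi]
            · rw [map_zero]
          rw [← Finset.mul_prod_erase _ _ hI, ← hden I hI, map_mul, map_mul, map_intCast,
            h1, map_prod]
          have h2 := hden0 I hI
          field_simp
        rw [hpz, zero_mul]
      · have : evalAt ℂ (D • z) (Δ.wallProd ℂ) = 0 := by
          by_contra h
          exact hreg ((Δ.evalAt_wallProd_ne_zero_iff ℂ _).1 h)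
        rw [this, mul_zero]
    exact (mul_eq_zero.1 hpw).resolve_right (Δ.wallProd_ne_zero ℂ)
  rw [hp0, map_zero, mul_eq_zero] at hmap
  refine hmap.resolve_right ?_
  rw [IsFractionRing.to_map_eq_zero_iff]
  exact Finset.prod_ne_zero_iff.2 fun I hI => Δ.gysinDen_ne_zero hI

/-- In top degree only `I = L` contributes, and there the numerator cancels the product of the
`u_i^L`, leaving the constant `w(L) / |G_L|`. -/
theorem exists_gysin_prod_X (hΔ : Δ.IsComplete) {L : Finset ι} (hL : L ∈ Δ.faces) :
    ∃ p : HBT N ℂ, algebraMap (HBT N ℂ) (FractionRing (HBT N ℂ)) p =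
      Δ.gysin ℂ (Ideal.Quotient.mk _ (∏ i ∈ L, MvPolynomial.X i)) := by
  classical
  rcases (Δ.card_le_of_mem_faces hΔ hL).lt_or_eq with hlt | heq
  · exact ⟨0, by rw [Δ.gysin_prod_X_of_card_lt hΔ hlt, map_zero]⟩
  have hLf : L ∈ Δ.facets := Finset.mem_filter.2 ⟨hL, heq⟩
  refine ⟨algebraMap ℂ _ ((Δ.w L : ℂ) / Nat.card (Δ.G L)), ?_⟩
  rw [gysin_mk, Finset.sum_eq_single L]
  · have h0 : algebraMap (HBT N ℂ) (FractionRing (HBT N ℂ)) (Δ.gysinDen L) ≠ 0 := by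
      rw [Ne, IsFractionRing.to_map_eq_zero_iff]
      exact Δ.gysinDen_ne_zero hLf
    rw [eq_div_iff h0, ← map_mul, restrictPoly_prod_X, gysinDen]
    congr 1
    have h1 : (Nat.card (Δ.G L) : ℂ) ≠ 0 := Nat.cast_ne_zero.2 (Δ.natCard_G_ne_zero hLf)
    rw [← mul_assoc, ← map_natCast (algebraMap ℂ (HBT N ℂ)), ← map_mul, div_mul_cancel₀ _ h1,
      map_intCast]
    congr 1
    exact Finset.prod_congr rfl fun i hi => (if_pos hi).symm
  · intro I hI hIL
    have hne : ¬ L ⊆ I := fun h => hIL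
      (Finset.eq_of_subset_of_card_le h (by rw [heq, Δ.card_of_mem_facets hI])).symm
    obtain ⟨j, hj, hjI⟩ := Finset.not_subset.1 hne
    rw [restrictPoly_prod_X, Finset.prod_eq_zero hj (if_neg hjI), mul_zero, map_zero, zero_div]
  · exact fun h => absurd hLf h

theorem exists_gysin_monomial (hΔ : Δ.IsComplete) (s : ι →₀ ℕ) :
    ∃ p : HBT N ℂ, algebraMap (HBT N ℂ) (FractionRing (HBT N ℂ)) p =
      Δ.gysin ℂ (Ideal.Quotient.mk _ (MvPolynomial.monomial s 1)) := by
  classical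
  -- Induction on the degree, and within one degree on the number of vertices missing from the
  -- support; `k` exceeds that number.
  have key : ∀ d k : ℕ, ∀ s : ι →₀ ℕ, s.degree = d → Fintype.card ι < s.support.card + k →
      ∃ p : HBT N ℂ, algebraMap (HBT N ℂ) (FractionRing (HBT N ℂ)) p =
      Δ.gysin ℂ (Ideal.Quotient.mk _ (MvPolynomial.monomial s 1)) := by
    intro d
    induction d with
    | zero =>
      intro k s hs _
      rw [Finsupp.degree_eq_zero_iff] at hs
      subst hs
      simpa using Δ.exists_gysin_prod_X hΔ Δ.empty_mem
    | succ d ihd =>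
      intro k
      induction k with
      | zero => intro s _ hk; exact absurd (Finset.card_le_univ s.support) (by omega)
      | succ k ihk =>
        intro s hs hk
        by_cases hF : s.support ∈ Δ.faces
        · by_cases hsq : ∀ i ∈ s.support, s i = 1
          · have : MvPolynomial.monomial s (1 : ℂ) = ∏ i ∈ s.support, MvPolynomial.X i := by
              rw [MvPolynomial.monomial_eq, map_one, one_mul, Finsupp.prod]
              exact Finset.prod_congr rfl fun i hi => by rw [hsq i hi, pow_one]
            rw [this]
            exact Δ.exists_gysin_prod_X hΔ hF
          · push Not at hsq
            obtain ⟨i, hi, hi1⟩ := hsq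
            have hi2 : 2 ≤ s i := by
              have := Finsupp.mem_support_iff.1 hi
              omega
            obtain ⟨I, hI, hsI⟩ := (hΔ _ hF).1
            have hIF := Δ.mem_faces_of_mem_facets hI
            set t : ι →₀ ℕ := s - Finsupp.single i 1 with ht
            have hst : s = t + Finsupp.single i 1 := by
              rw [ht, tsub_add_cancel_of_le]
              rw [Finsupp.single_le_iff]; omega
            have htd : t.degree = d := by
              rw [hst, map_add, Finsupp.degree_single] at hs
              omega
            have hts : t.support = s.support := by
              ext j
              rw [Finsupp.mem_support_iff, Finsupp.mem_support_iff, ht, Finsupp.tsub_apply]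
              by_cases hji : i = j
              · subst hji; rw [Finsupp.single_eq_same]; omega
              · rw [Finsupp.single_eq_of_ne' hji, tsub_zero]
            -- With `I` a facet containing the support, `x_i = ∑ u(v_j) x_j - ∑_{j ∉ I} u(v_j) x_j`.
            -- Replacing one factor `x_i` gives a term of smaller degree times a scalar of
            -- `H^*(BT)`, and terms of the same degree with larger support; `i` stays in the support
            -- since its exponent was at least `2`.
            set u := Δ.dualVec ℂ I i with hu
            have hform : Δ.complexLinearForm u = MvPolynomial.X i +
                ∑ j ∈ Finset.univ.filter (· ∉ I),
                  MvPolynomial.C (u (Δ.v j)) * MvPolynomial.X j := by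
              rw [complexLinearForm, ← Finset.sum_filter_add_sum_filter_not Finset.univ (· ∈ I)]
              congr 1
              rw [Finset.sum_eq_single i]
              · rw [hu, Δ.dualVec_self ℂ hIF (hsI hi), map_one, one_mul]
              · intro j hj hji
                rw [hu, Δ.dualVec_of_ne ℂ hIF (Finset.mem_filter.1 hj).2 hji, map_zero, zero_mul]
              · exact fun h => absurd (Finset.mem_filter.2 ⟨Finset.mem_univ _, hsI hi⟩) h
            have hmon : MvPolynomial.monomial s (1 : ℂ) =
                Δ.complexLinearForm u * MvPolynomial.monomial t 1 +
                ∑ j ∈ Finset.univ.filter (· ∉ I), MvPolynomial.C (-u (Δ.v j)) *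
                  MvPolynomial.monomial (t + Finsupp.single j 1) 1 := by
              have hX : ∀ j, MvPolynomial.monomial (t + Finsupp.single j 1) (1 : ℂ) =
                  MvPolynomial.X j * MvPolynomial.monomial t 1 := fun j => by
                rw [MvPolynomial.X, MvPolynomial.monomial_mul, add_comm, one_mul]
              rw [hform, add_mul, hst, hX i, Finset.sum_mul, add_assoc, ← Finset.sum_add_distrib,
                Finset.sum_eq_zero, add_zero]
              intro j _
              rw [hX j, map_neg]
              ring
            have hsumPol : ∀ A : Finset ι, (∀ j ∈ A, j ∉ I) →
                ∃ p : HBT N ℂ, algebraMap (HBT N ℂ) (FractionRing (HBT N ℂ)) p =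
                Δ.gysin ℂ (Ideal.Quotient.mk _ (∑ j ∈ A, MvPolynomial.C (-u (Δ.v j)) *
                  MvPolynomial.monomial (t + Finsupp.single j 1) 1)) := by
              intro A hA
              induction A using Finset.induction_on with
              | empty => exact ⟨0, by rw [Finset.sum_empty, gysin_mk]; simp⟩
              | insert j A hjA ihA =>
                obtain ⟨p, hp⟩ := ihA fun j' hj' => hA j' (Finset.mem_insert_of_mem hj')
                have hjI := hA j (Finset.mem_insert_self _ _)
                have hjs : j ∉ s.support := fun h => hjI (hsI h)
                obtain ⟨q, hq⟩ := ihk (t + Finsupp.single j 1)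
                  (by rw [map_add, Finsupp.degree_single, htd]) (by
                    have : s.support.card < (t + Finsupp.single j 1).support.card := by
                      refine Finset.card_lt_card
                        ((Finset.ssubset_iff_of_subset fun m hm => ?_).2 ⟨j, ?_, hjs⟩)
                      · rw [← hts, Finsupp.mem_support_iff] at hm
                        rw [Finsupp.mem_support_iff, Finsupp.add_apply]
                        omega
                      · rw [Finsupp.mem_support_iff, Finsupp.add_apply, Finsupp.single_eq_same]
                        omega
                    omega)
                refine ⟨algebraMap ℂ _ (-u (Δ.v j)) * q + p, ?_⟩
                rw [Finset.sum_insert hjA, gysin_add, ← hp,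
                  Δ.gysin_mul_of_restrictPoly (fun I _ => Δ.restrictPoly_C ℂ I _), ← hq, map_add,
                  map_mul]
            obtain ⟨p, hp⟩ := hsumPol _ fun j hj => (Finset.mem_filter.1 hj).2
            obtain ⟨q, hq⟩ := ihd (Fintype.card ι + 1) t htd (by omega)
            refine ⟨SymmetricAlgebra.ι ℂ _ u * q + p, ?_⟩
            rw [hmon, gysin_add, ← hp,
              Δ.gysin_mul_of_restrictPoly (fun I hI => Δ.restrictPoly_complexLinearForm hI u),
              ← hq, map_add, map_mul]
        · refine ⟨0, ?_⟩
          rw [map_zero, gysin_mk]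
          refine (Finset.sum_eq_zero fun I hI => ?_).symm
          have hne : ¬ s.support ⊆ I := fun h =>
            hF (Δ.down_closed I (Δ.mem_faces_of_mem_facets hI) _ h)
          obtain ⟨j, hj, hjI⟩ := Finset.not_subset.1 hne
          have h0 : Δ.restrictPoly ℂ I (MvPolynomial.monomial s 1) = 0 := by
            rw [MvPolynomial.monomial_eq, map_mul, Finsupp.prod, map_prod,
              Finset.prod_eq_zero hj, mul_zero]
            rw [map_pow, restrictPoly_X, if_neg hjI, zero_pow (Finsupp.mem_support_iff.1 hj)]
          rw [h0, mul_zero, map_zero, zero_div]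
  exact key s.degree (Fintype.card ι + 1) s rfl (by omega)

/-- The index map takes its values in `H^*(BT)`. -/
theorem exists_gysin (hΔ : Δ.IsComplete) (x : MvPolynomial ι ℂ) :
    ∃ p : HBT N ℂ, algebraMap (HBT N ℂ) (FractionRing (HBT N ℂ)) p =
      Δ.gysin ℂ (Ideal.Quotient.mk _ x) := by
  induction x using MvPolynomial.induction_on' with
  | monomial s c =>
    obtain ⟨p, hp⟩ := Δ.exists_gysin_monomial hΔ s
    refine ⟨algebraMap ℂ _ c * p, ?_⟩
    have : MvPolynomial.monomial s c = MvPolynomial.C c * MvPolynomial.monomial s 1 := by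
      rw [MvPolynomial.C_mul_monomial, mul_one]
    rw [this, Δ.gysin_mul_of_restrictPoly (fun I _ => Δ.restrictPoly_C ℂ I _), ← hp, map_mul]
  | add x y hx hy =>
    obtain ⟨p, hp⟩ := hx
    obtain ⟨q, hq⟩ := hy
    exact ⟨p + q, by rw [gysin_add, ← hp, ← hq, map_add]⟩

end SimplicialMultiFan

/-! ### Truncated evaluation of power series -/

section TruncatedEvaluation

open PowerSeries

/-- The value `∑_{k < M} f_k a^k`. -/
def truncEval {A : Type*} [CommRing A] [Algebra ℂ A] (f : PowerSeries ℂ) (M : ℕ) (a : A) : A :=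
  ∑ k ∈ Finset.range M, coeff k f • a ^ k

theorem map_truncEval {A B : Type*} [CommRing A] [Algebra ℂ A] [CommRing B] [Algebra ℂ B]
    (φ : A →ₐ[ℂ] B) (f : PowerSeries ℂ) (M : ℕ) (a : A) :
    φ (truncEval f M a) = truncEval f M (φ a) := by
  simp only [truncEval, map_sum, map_smul, map_pow]

/-- A common truncation order for all nilpotent elements makes the evaluations liftable to the
polynomial ring. -/
theorem evalNilpotent_eq_truncEval {A : Type*} [CommRing A] [Algebra ℂ A] (f : PowerSeries ℂ)
    {a : A} (ha : IsNilpotent a) {M : ℕ} (hM : nilpotencyClass a ≤ M) :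
    f.evalNilpotent a = truncEval f M a := by
  refine Finset.sum_subset (Finset.range_mono hM) fun k _ hk => ?_
  rw [pow_eq_zero_of_le (not_lt.1 fun h => hk (Finset.mem_range.2 h)) (pow_nilpotencyClass ha),
    smul_zero]

theorem mk_truncEval (f : PowerSeries ℂ) (M : ℕ) (r : ℂ) :
    Ideal.Quotient.mk (Ideal.span {(X : PowerSeries ℂ) ^ M}) (truncEval f M (C r * X)) =
      Ideal.Quotient.mk _ (rescale r f) := by
  rw [Ideal.Quotient.eq, Ideal.mem_span_singleton, X_pow_dvd_iff]
  intro m hm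
  rw [map_sub, sub_eq_zero, truncEval, map_sum, Finset.sum_eq_single m, mul_pow, ← map_pow,
    coeff_smul, coeff_C_mul, coeff_X_pow_self, coeff_rescale, mul_one, smul_eq_mul, mul_comm]
  · intro k _ hkm
    rw [mul_pow, ← map_pow, coeff_smul, coeff_C_mul, coeff_X_pow, if_neg (Ne.symm hkm), mul_zero,
      smul_zero]
  · exact fun h => absurd (Finset.mem_range.2 hm) h

theorem coeff_eq_of_mk_eq {M n : ℕ} (hn : n < M) {f g : PowerSeries ℂ}
    (h : Ideal.Quotient.mk (Ideal.span {(X : PowerSeries ℂ) ^ M}) f = Ideal.Quotient.mk _ g) :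
    coeff n f = coeff n g := by
  rw [Ideal.Quotient.eq, Ideal.mem_span_singleton, X_pow_dvd_iff] at h
  have := h n hn
  rwa [map_sub, sub_eq_zero] at this

open scoped Classical in
theorem rescale_zero_toddSeries (z : ℂ) :
    rescale (0 : ℂ) (toddSeries z) = if z = 1 then 1 else 0 := by
  rw [rescale_zero, RingHom.comp_apply, constantCoeff_toddSeries]
  split_ifs <;> simp

end TruncatedEvaluation

/-! ### Restriction to a line -/

section Line

open PowerSeries

variable {N : Type*} [AddCommGroup N]

/-- Restriction of polynomial functions to the line spanned by a lattice point. -/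
def lineEval (z : N) : HBT N ℂ →ₐ[ℂ] PowerSeries ℂ :=
  SymmetricAlgebra.lift
    { toFun := fun u : N →ₗ[ℤ] ℂ => u z • (X : PowerSeries ℂ)
      map_add' := fun _ _ => add_smul _ _ _
      map_smul' := fun _ _ => mul_smul _ _ _ }

theorem lineEval_ι (z : N) (u : N →ₗ[ℤ] ℂ) :
    lineEval z (SymmetricAlgebra.ι ℂ _ u) = C (u z) * X := by
  rw [lineEval, SymmetricAlgebra.lift_ι_apply]
  exact smul_eq_C_mul _ _

theorem constantCoeff_lineEval (z : N) (p : HBT N ℂ) :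
    constantCoeff (lineEval z p) = SymmetricAlgebra.algebraMapInv p := by
  induction p using SymmetricAlgebra.induction with
  | algebraMap r => rw [AlgHom.commutes, AlgHom.commutes]; simp
  | ι u => rw [lineEval_ι, map_mul, constantCoeff_X, mul_zero, SymmetricAlgebra.algebraMapInv_ι]
  | mul p q hp hq => rw [map_mul, map_mul, map_mul, hp, hq]
  | add p q hp hq => rw [map_add, map_add, map_add, hp, hq]

end Line

/-! ### The localization formula and the integral over `Δ` -/

namespace SimplicialMultiFan

open PowerSeries

variable {N : Type*} [AddCommGroup N] {ι : Type*} (Δ : SimplicialMultiFan N ι)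

open scoped Classical in
/-- The substitution `x_i ↦ a_i t` for `i ∈ I` and `x_i ↦ 0` for `i ∉ I`. -/
def lineSubst (I : Finset ι) (a : ι → ℤ) : MvPolynomial ι ℂ →ₐ[ℂ] PowerSeries ℂ :=
  MvPolynomial.aeval fun i => C (if i ∈ I then (a i : ℂ) else 0) * X

theorem lineEval_restrictPoly [Module.Free ℤ N] [Module.Finite ℤ N] {z : N} {I : Finset ι} (hI : I ∈ Δ.facets) {a : ι → ℤ}
    (ha : ∀ i ∈ I, (a i : ℚ) = Δ.dualVec ℚ I i z) (x : MvPolynomial ι ℂ) :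
    lineEval z (Δ.restrictPoly ℂ I x) = lineSubst I a x := by
  classical
  change ((lineEval z).comp (Δ.restrictPoly ℂ I)) x = _
  congr 1
  refine MvPolynomial.algHom_ext fun i => ?_
  rw [AlgHom.comp_apply, restrictPoly_X, lineSubst, MvPolynomial.aeval_X]
  split_ifs with hi
  · rw [lineEval_ι, Δ.dualVec_eq_cast hI ℂ hi, ← ha i hi, Rat.cast_intCast]
  · rw [map_zero, map_zero, zero_mul]

variable [Fintype ι]

/-- The localization formula for the integral over `Δ`. -/
def localInt (a : Finset ι → ι → ℤ) : MvPolynomial ι ℂ →ₗ[ℂ] ℂ :=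
  ∑ I ∈ Δ.facets, ((Δ.w I : ℂ) / (Nat.card (Δ.G I) * ∏ i ∈ I, (a I i : ℂ))) •
    (coeff (Module.finrank ℤ N) ∘ₗ (lineSubst I (a I)).toLinearMap)

theorem localInt_apply (a : Finset ι → ι → ℤ) (x : MvPolynomial ι ℂ) :
    Δ.localInt a x = coeff (Module.finrank ℤ N) (∑ I ∈ Δ.facets,
      C ((Δ.w I : ℂ) / (Nat.card (Δ.G I) * ∏ i ∈ I, (a I i : ℂ))) * lineSubst I (a I) x) := by
  rw [localInt, LinearMap.sum_apply, map_sum]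
  refine Finset.sum_congr rfl fun I _ => ?_
  rw [coeff_C_mul]
  rfl

/-- The restriction of the Todd class to `I`. -/
theorem sum_prod_rescale_toddSeries [Module.Finite ℤ N] (I : Finset ι) (a : ι → ℂ) [DecidableEq ι] :
    ∑ g ∈ Δ.finite_GUnion.toFinset, ∏ i,
      rescale (if i ∈ I then a i else 0) (toddSeries (rho i g)) =
    ∑ g ∈ Δ.groupFinset I, ∏ i ∈ I, rescale (a i) (toddSeries (rho i g)) := by
  rw [groupFinset, Finset.sum_filter]
  refine Finset.sum_congr rfl fun g _ => ?_
  have h0 : ∀ i ∉ I, rescale (if i ∈ I then a i else 0) (toddSeries (rho i g)) =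
      if rho i g = 1 then 1 else 0 := fun i hi => by
    rw [if_neg hi, rescale_zero_toddSeries]
  by_cases hg : ∀ i ∉ I, g i = 0
  · rw [if_pos hg, ← Finset.prod_subset (Finset.subset_univ I)]
    · exact Finset.prod_congr rfl fun i hi => by rw [if_pos hi]
    · intro i _ hi
      rw [h0 i hi, if_pos ((rho_eq_one_iff i g).2 (hg i hi))]
  · rw [if_neg hg]
    push Not at hg
    obtain ⟨i, hi, hgi⟩ := hg
    refine Finset.prod_eq_zero (Finset.mem_univ i) ?_
    rw [h0 i hi, if_neg fun h => hgi ((rho_eq_one_iff i g).1 h)]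

variable [Module.Free ℤ N] [Module.Finite ℤ N]

/-- Along the line through `z` the denominator of `I` is `|G_I| ∏ a_i · t^n`. The value of `π_!(x)`
at the origin is thus the coefficient of `t^n` in the sum of the numerators over the constants. -/
theorem algebraMapInv_eq_localInt {z : N} {a : Finset ι → ι → ℤ}
    (ha : ∀ I ∈ Δ.facets, ∀ i ∈ I, (a I i : ℚ) = Δ.dualVec ℚ I i z)
    (ha0 : ∀ I ∈ Δ.facets, ∀ i ∈ I, a I i ≠ 0) {x : MvPolynomial ι ℂ} {p : HBT N ℂ}
    (hp : algebraMap (HBT N ℂ) (FractionRing (HBT N ℂ)) p = Δ.gysin ℂ (Ideal.Quotient.mk _ x)) :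
    SymmetricAlgebra.algebraMapInv p = Δ.localInt a x := by
  classical
  have hden : ∀ I ∈ Δ.facets, lineEval z (Δ.gysinDen I) =
      C (Nat.card (Δ.G I) * ∏ i ∈ I, (a I i : ℂ)) * X ^ Module.finrank ℤ N := by
    intro I hI
    rw [gysinDen, map_mul, map_natCast, map_prod, map_mul, map_natCast, map_prod,
      ← Δ.card_of_mem_facets hI, ← Finset.prod_const, mul_assoc, ← Finset.prod_mul_distrib]
    congr 1
    refine Finset.prod_congr rfl fun i hi => ?_
    rw [lineEval_ι, Δ.dualVec_eq_cast hI ℂ hi, ← ha I hI i hi, Rat.cast_intCast]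
  have hc : ∀ I ∈ Δ.facets, (Nat.card (Δ.G I) * ∏ i ∈ I, (a I i : ℂ)) ≠ 0 := fun I hI =>
    mul_ne_zero (Nat.cast_ne_zero.2 (Δ.natCard_G_ne_zero hI))
      (Finset.prod_ne_zero_iff.2 fun i hi => Int.cast_ne_zero.2 (ha0 I hI i hi))
  have h := sum_eq_of_sum_fractions (algebraMap (HBT N ℂ) (FractionRing (HBT N ℂ)))
    (IsFractionRing.injective _ _) (lineEval z : HBT N ℂ →+* PowerSeries ℂ) Δ.facets
    (fun I => Δ.w I * Δ.restrictPoly ℂ I x) (fun I => Δ.gysinDen I)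
    (fun I => algebraMap (HBT N ℂ) (FractionRing (HBT N ℂ)) (Δ.w I * Δ.restrictPoly ℂ I x) /
        algebraMap (HBT N ℂ) (FractionRing (HBT N ℂ)) (Δ.gysinDen I))
    (fun I => C ((Δ.w I : ℂ) / (Nat.card (Δ.G I) * ∏ i ∈ I, (a I i : ℂ))) * lineSubst I (a I) x)
    (X ^ Module.finrank ℤ N) p ?_ ?_ ?_ ?_
  · rw [localInt_apply, h, coeff_X_pow_mul', if_pos le_rfl, Nat.sub_self,
      coeff_zero_eq_constantCoeff_apply]
    exact (constantCoeff_lineEval z p).symm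
  · intro I hI
    refine div_mul_cancel₀ _ ?_
    rw [Ne, IsFractionRing.to_map_eq_zero_iff]
    exact Δ.gysinDen_ne_zero hI
  · intro I hI
    change _ * lineEval z (Δ.gysinDen I) = _ * lineEval z (_ * _)
    rw [hden I hI, map_mul (lineEval z), map_intCast, Δ.lineEval_restrictPoly hI (ha I hI)]
    have h1 : (C ((Δ.w I : ℂ) / (Nat.card (Δ.G I) * ∏ i ∈ I, (a I i : ℂ))) : PowerSeries ℂ) *
        C (Nat.card (Δ.G I) * ∏ i ∈ I, (a I i : ℂ)) = (Δ.w I : PowerSeries ℂ) := by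
      rw [← map_mul, div_mul_cancel₀ _ (hc I hI), map_intCast]
    rw [← h1]
    ring
  · intro I hI
    change lineEval z (Δ.gysinDen I) ≠ 0
    rw [hden I hI]
    refine mul_ne_zero (fun h0 => hc I hI ?_) (pow_ne_zero _ X_ne_zero)
    have := congrArg constantCoeff h0
    rwa [constantCoeff_C, map_zero] at this
  · rw [hp, gysin_mk]

/-- The face ideal is killed already by `π_!`. A linear form comes out of `π_!` as a factor of
degree one; integrality of the cofactor, from `exists_gysin`, then makes the degree-`0` part vanish.
-/
theorem localInt_eq_zero_of_mem_cohIdeal (hΔ : Δ.IsComplete) {z : N} {a : Finset ι → ι → ℤ}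
    (ha : ∀ I ∈ Δ.facets, ∀ i ∈ I, (a I i : ℚ) = Δ.dualVec ℚ I i z)
    (ha0 : ∀ I ∈ Δ.facets, ∀ i ∈ I, a I i ≠ 0) {x : MvPolynomial ι ℂ}
    (hx : x ∈ Δ.cohIdeal ℂ) : Δ.localInt a x = 0 := by
  obtain ⟨f, hf, l, hl, rfl⟩ := Submodule.mem_sup.1 hx
  have h1 : Δ.localInt a f = 0 := by
    rw [← Δ.algebraMapInv_eq_localInt ha ha0 (p := 0), map_zero]
    rw [Ideal.Quotient.eq_zero_iff_mem.2 hf, ← map_zero (Ideal.Quotient.mk (Δ.faceIdeal ℂ)),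
      gysin_mk]
    simp
  have h2 : ∀ y, Δ.localInt a (y * l) = 0 := by
    clear hx
    induction hl using Submodule.span_induction with
    | mem l hl =>
      intro y
      obtain ⟨u, rfl⟩ := hl
      obtain ⟨p, hp⟩ := Δ.exists_gysin hΔ y
      set u' : N →ₗ[ℤ] ℂ := (Int.castAddHom ℂ).toIntLinearMap ∘ₗ u with hu'
      have hu : Δ.linearForm ℂ u = Δ.complexLinearForm u' := rfl
      rw [hu, mul_comm, ← Δ.algebraMapInv_eq_localInt ha ha0
        (p := SymmetricAlgebra.ι ℂ _ u' * p), map_mul, SymmetricAlgebra.algebraMapInv_ι, zero_mul]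
      rw [Δ.gysin_mul_of_restrictPoly (fun I hI => Δ.restrictPoly_complexLinearForm hI u'), map_mul,
        hp]
    | zero => intro y; rw [mul_zero, map_zero]
    | add l l' _ _ h h' => intro y; rw [mul_add, map_add, h, h', add_zero]
    | smul b l _ h => intro y; rw [smul_eq_mul, ← mul_assoc, h]
  have h3 := h2 1
  rw [one_mul] at h3
  rw [map_add, h1, h3, add_zero]

theorem IsInducedByGysin.apply_mk {Δ : SimplicialMultiFan N ι} (hΔ : Δ.IsComplete)
    {E : Δ.Coh ℂ →ₗ[ℂ] ℂ} (hE : Δ.IsInducedByGysin ℂ E) {z : N} {a : Finset ι → ι → ℤ}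
    (ha : ∀ I ∈ Δ.facets, ∀ i ∈ I, (a I i : ℚ) = Δ.dualVec ℚ I i z)
    (ha0 : ∀ I ∈ Δ.facets, ∀ i ∈ I, a I i ≠ 0) (x : MvPolynomial ι ℂ) :
    E (Ideal.Quotient.mk _ x) = Δ.localInt a x := by
  obtain ⟨p, hp⟩ := Δ.exists_gysin hΔ x
  rw [← Δ.algebraMapInv_eq_localInt ha ha0 hp]
  exact hE _ p hp

/-- Taking a multiple of the common denominator makes all the values `u_i^I(z)` integers. -/
theorem exists_regular_point :
    ∃ (z : N) (a : Finset ι → ι → ℤ), (∀ I ∈ Δ.facets, ∀ i ∈ I, (a I i : ℚ) = Δ.dualVec ℚ I i z) ∧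
      (∀ I ∈ Δ.facets, ∀ i ∈ I, a I i ≠ 0) ∧ Δ.IsRegular z := by
  obtain ⟨D, hD0, hD⟩ := Δ.exists_common_denominator
  choose u hu using hD
  obtain ⟨z, hz⟩ := Δ.exists_isRegular_smul hD0.ne'
  have ha : ∀ I i, ((u I i z : ℤ) : ℚ) = Δ.dualVec ℚ I i (D • z) := fun I i => by
    rw [hu, map_smul, zsmul_eq_mul]
  refine ⟨D • z, fun I i => u I i z, fun I _ i _ => ha I i, fun I hI i hi h => ?_, hz⟩
  have h0 : u I i z = 0 := h
  have h1 := ha I i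
  rw [h0, Int.cast_zero] at h1
  exact hz I hI i hi h1.symm

theorem existsUnique_isInducedByGysin (hΔ : Δ.IsComplete) :
    ∃! E : Δ.Coh ℂ →ₗ[ℂ] ℂ, Δ.IsInducedByGysin ℂ E := by
  obtain ⟨z, a, ha, ha0, -⟩ := Δ.exists_regular_point
  let π : MvPolynomial ι ℂ →ₗ[ℂ] Δ.Coh ℂ := (Ideal.Quotient.mkₐ ℂ (Δ.cohIdeal ℂ)).toLinearMap
  have hπ : Function.Surjective π := Ideal.Quotient.mk_surjective
  -- Any linear section will do, as `localInt` vanishes on the kernel of the projection.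
  obtain ⟨σ, hσ⟩ := LinearMap.exists_rightInverse_of_surjective π (LinearMap.range_eq_top.2 hπ)
  refine ⟨Δ.localInt a ∘ₗ σ, ?_, ?_⟩
  · intro x p hp
    obtain ⟨y, rfl⟩ := Ideal.Quotient.mk_surjective x
    rw [Δ.algebraMapInv_eq_localInt ha ha0 hp, ← sub_eq_zero]
    change Δ.localInt a (σ (π y)) - Δ.localInt a y = 0
    rw [← map_sub]
    refine Δ.localInt_eq_zero_of_mem_cohIdeal hΔ ha ha0 (Ideal.Quotient.eq.1 ?_)
    exact LinearMap.congr_fun hσ (π y)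
  · intro E hE
    refine LinearMap.ext fun c => ?_
    obtain ⟨y, rfl⟩ := Ideal.Quotient.mk_surjective c
    refine (hE.apply_mk hΔ ha ha0 y).trans ?_
    change _ = Δ.localInt a (σ (π y))
    rw [← sub_eq_zero, ← map_sub]
    refine Δ.localInt_eq_zero_of_mem_cohIdeal hΔ ha ha0 (Ideal.Quotient.eq.1 ?_)
    exact (LinearMap.congr_fun hσ (π y)).symm

end SimplicialMultiFan

/-! ### Evaluation of `e^{c_1} T` by localization -/

namespace SimpleMultiPolytope

open PowerSeries

variable {N : Type*} [AddCommGroup N] [Module.Free ℤ N] [Module.Finite ℤ N]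
  {ι : Type*}

theorem sharp_congr {P : SimpleMultiPolytope N ι} (hP : P.IsLattice) {x y : RealSpace N}
    (hx : P.fan.IsGeneric x) (hy : P.fan.IsGeneric y) {ε : ι → ℝ}
    (hε : ∀ i, 0 < ε i ∧ ε i < 1) : P.sharp x ε = P.sharp y ε :=
  finsum_congr fun u => (P.shift ε).DH_congr hx hy (hP.shift_ne hε u)

variable [Fintype ι]

/-- Evaluation of `e^{c_1} T` by localization. -/
theorem apply_expChern_mul_toddClass (P : SimpleMultiPolytope N ι) {E : P.fan.Coh ℂ →ₗ[ℂ] ℂ}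
    (hE : P.fan.IsInducedByGysin ℂ E) {z : N} {a : Finset ι → ι → ℤ}
    (ha : ∀ I ∈ P.fan.facets, ∀ i ∈ I, (a I i : ℚ) = P.fan.dualVec ℚ I i z)
    (ha0 : ∀ I ∈ P.fan.facets, ∀ i ∈ I, a I i ≠ 0) :
    E (P.expChern * P.fan.toddClass) = coeff (Module.finrank ℤ N)
      (∑ I ∈ P.fan.facets, C ((P.fan.w I : ℂ) / (Nat.card (P.fan.G I) * ∏ i ∈ I, (a I i : ℂ))) *
        (rescale (∑ i ∈ I, (P.c i : ℂ) * a I i) (exp ℂ) *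
        ∑ g ∈ P.fan.groupFinset I, ∏ i ∈ I,
          rescale (a I i : ℂ) (toddSeries (SimplicialMultiFan.rho i g)))) := by
  classical
  -- The truncation order exceeds all nilpotency classes, so the class lifts to the polynomial `y`,
  -- and exceeds `n`, so the coefficient of `t^n` is unaffected.
  set M : ℕ := Module.finrank ℤ N + 1 + nilpotencyClass P.chern +
    ∑ i, nilpotencyClass (P.fan.xbar ℂ i) with hM
  set κ : MvPolynomial ι ℂ →ₐ[ℂ] P.fan.Coh ℂ := Ideal.Quotient.mkₐ ℂ (P.fan.cohIdeal ℂ) with hκ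
  have hκX : ∀ i, κ (MvPolynomial.X i) = P.fan.xbar ℂ i := fun i => rfl
  set y : MvPolynomial ι ℂ := truncEval (exp ℂ) M (∑ i, (P.c i : ℂ) • MvPolynomial.X i) *
    ∑ g ∈ P.fan.finite_GUnion.toFinset, ∏ i,
      truncEval (toddSeries (SimplicialMultiFan.rho i g)) M (MvPolynomial.X i) with hy
  have hlift : P.expChern * P.fan.toddClass = κ y := by
    rw [hy, map_mul, map_truncEval, map_sum, map_sum]
    congr 1
    · rw [expChern, evalNilpotent_eq_truncEval _ P.isNilpotent_chern (M := M) (by omega)]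
      simp only [map_smul, hκX]
      rfl
    · rw [SimplicialMultiFan.toddClass, finsum_mem_eq_finite_toFinset_sum _ P.fan.finite_GUnion]
      refine Finset.sum_congr rfl fun g _ => ?_
      rw [map_prod]
      refine Finset.prod_congr rfl fun i _ => ?_
      have hi := Finset.single_le_sum (f := fun i => nilpotencyClass (P.fan.xbar ℂ i))
        (fun _ _ => Nat.zero_le _) (Finset.mem_univ i)
      rw [map_truncEval, hκX, evalNilpotent_eq_truncEval _ (P.fan.isNilpotent_xbar ℂ i)]
      exact hi.trans (by omega)
  rw [hlift]
  refine (hE.apply_mk P.complete ha ha0 y).trans ?_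
  rw [SimplicialMultiFan.localInt_apply, map_sum, map_sum]
  refine Finset.sum_congr rfl fun I _ => ?_
  rw [coeff_C_mul, coeff_C_mul]
  congr 1
  refine coeff_eq_of_mk_eq (M := M) (by omega) ?_
  set θ := SimplicialMultiFan.lineSubst I (a I) with hθ
  have hθX : ∀ i, θ (MvPolynomial.X i) = C (if i ∈ I then (a I i : ℂ) else 0) * X := fun i => by
    rw [hθ, SimplicialMultiFan.lineSubst, MvPolynomial.aeval_X]
  have hchern : θ (∑ i, (P.c i : ℂ) • MvPolynomial.X i) =
      C (∑ i ∈ I, (P.c i : ℂ) * a I i) * X := by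
    rw [map_sum, map_sum, Finset.sum_mul, ← Finset.sum_subset (Finset.subset_univ I)]
    · refine Finset.sum_congr rfl fun i hi => ?_
      rw [map_smul, hθX, if_pos hi, smul_eq_C_mul, map_mul, mul_assoc]
    · intro i _ hi
      rw [map_smul, hθX, if_neg hi, map_zero, zero_mul, smul_zero]
  rw [hy, map_mul, map_truncEval, hchern, map_sum θ, map_mul, mk_truncEval, map_mul,
    -- Restricting to `I` sets `x_i = 0` off `I`, where the Todd series leaves `1` or `0` according
    -- to whether `ρ_i(g) = 1`; the sum over `G_Δ` thereby shrinks to `G_I`.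
    ← P.fan.sum_prod_rescale_toddSeries I (fun i => (a I i : ℂ)), map_sum, map_sum]
  congr 1
  refine Finset.sum_congr rfl fun g _ => ?_
  rw [map_prod, map_prod, map_prod]
  refine Finset.prod_congr rfl fun i _ => ?_
  rw [map_truncEval, hθX, mk_truncEval]

end SimpleMultiPolytope

end

theorem theorem8p5 {N : Type*} [AddCommGroup N] [Module.Free ℤ N] [Module.Finite ℤ N]
    {ι : Type*} [Fintype ι] (P : SimpleMultiPolytope N ι) (hP : P.IsLattice) :
    (∀ x : P.fan.EquivCoh ℂ, ∃ p : HBT N ℂ,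
      algebraMap (HBT N ℂ) (FractionRing (HBT N ℂ)) p = P.fan.gysin ℂ x) ∧
    (∃! E : P.fan.Coh ℂ →ₗ[ℂ] ℂ, P.fan.IsInducedByGysin ℂ E) ∧
    ∀ E : P.fan.Coh ℂ →ₗ[ℂ] ℂ, P.fan.IsInducedByGysin ℂ E →
      ∀ (x : RealSpace N) (ε : ι → ℝ), P.fan.IsGeneric x → (∀ i, 0 < ε i ∧ ε i < 1) →
        {u : N →ₗ[ℤ] ℤ | (P.shift ε).DH x (latticeToReal u) ≠ 0}.Finite ∧
        E (P.expChern * P.fan.toddClass) = (P.sharp x ε : ℂ) := by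
  refine ⟨fun x => ?_, P.fan.existsUnique_isInducedByGysin P.complete, fun E hE x ε hx hε =>
    ⟨(P.shift ε).finite_support_DH hx (hP.shift_ne hε), ?_⟩⟩
  · obtain ⟨y, rfl⟩ := Ideal.Quotient.mk_surjective x
    exact P.fan.exists_gysin P.complete y
  -- Both sides are computed at one regular `z`; `sharp_congr` then replaces `z` by the given
  -- generic vector.
  · obtain ⟨z, a, ha, ha0, hz⟩ := P.fan.exists_regular_point
    obtain ⟨R, hR, hR0⟩ := SimpleMultiPolytope.exists_sum_rescale_toddSeries hP ha ha0
    rw [P.apply_expChern_mul_toddClass hE ha ha0, hR, PowerSeries.coeff_X_pow_mul', if_pos le_rfl,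
      Nat.sub_self, PowerSeries.coeff_zero_eq_constantCoeff_apply, hR0 ε hε,
      SimpleMultiPolytope.sharp_congr hP hx (hz.isGeneric P.complete) hε]
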